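/- Let $X$ and $Y$ be random vectors with values in $[0,\infty)^d$ and standard Pareto margins, $P(X_j>t)=P(Y_j>t)=1/t$ for $t\ge 1$ (the case of known margins, after standardization). All topological notions refer to the space $[0,\infty)^d$. Assume that $X$ is multivariate regularly varying: there is a probability measure $\nu_X$ on $\{x\ge 0:\|x\|_\infty>1\}$ with $$\lim_{u\to\infty}P(X/u\in B\mid \|X\|_\infty>u)=\nu_X(B)$$ for all Borel sets $B\subset\{x\ge 0:\|x\|_\infty>1\}$ with $\nu_X(\partial B)=0$. Extend $\nu_X$ to sets $B\subset[0,\infty)^d$ bounded away from the origin by $\nu_X(B)=\nu_X(B/\mu_B)/\mu_B$ with $\mu_B=\inf\{\|x\|_\infty:x\in B\}$. Assume the second-order condition: there is a function $a_X$ with $a_X(u)\to 0$ such that for every $\varepsilon>0$ and every Borel set $B\subset[0,\infty)^d\setminus[0,\varepsilon)^d$ with $\nu_X(\partial B)=0$, $$\frac{P(X/u\in B)}{P(\|X\|_\infty>u)}-\nu_X(B)=O(a_X(u)),\qquad u\to\infty.$$ Assume the same for $Y$ with $\nu_Y$ and $a_Y$. Let $X_1,X_2,\dots$ and $Y_1,Y_2,\dots$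 be i.i.d. copies of $X$ and of $Y$, the two samples being independent of each other. Let $r:[0,\infty)^d\to[0,\infty)$ be measurable with $r(tx)=t\,r(x)$ for all $t>0$, such that $\Omega_r=\{x\ge 0: r(x)>1\}$ is bounded away from the origin, $\nu_X(\Omega_r)>0$ and $\nu_Y(\Omega_r)>0$. Let $\mathcal A_r$ be the class of Borel sets $B\subset\Omega_r$ with $tB\subset B$ for all $t>1$, and let $A_1,\dots,A_K$ be a partition of $\Omega_r$ such that each $A_j$ is obtained from sets of $\mathcal A_r$ by finitely many unions, intersections and complementations, and $\nu_X(\partial A_j)=\nu_Y(\partial A_j)=0$. Then the limits $$p_j=\lim_{u\to\infty}P(X\in uA_j\mid r(X)>u),\qquad q_j=\lim_{u\to\infty}P(Y\in uA_j\mid r(Y)>u)$$ exist; assume that they all lie in $(0,1)$. Let $R^X_{1,n}\le\dots\le R^X_{n,n}$ be the order statistics of $r(X_1),\dots,r(X_n)$, put $\hat p_j=\frac1{k_n}\sum_{i=1}^n 1\{X_i\in R^X_{n-k_n,n}A_j\}$, define $\hat q_j$ in the same way from $Y_1,\dots,Y_n$, and let $$D_K=\sum_{j=1}^K(p_j-q_j)(\log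 p_j-\log q_j),\qquad \hat D_K=\sum_{j=1}^K(\hat p_j-\hat q_j)(\log\hat p_j-\log\hat q_j).$$ Let $U_X(t)=\inf\{u:P(\|X\|_\infty>u)\le 1/t\}$, define $U_Y$ in the same way, and let $k_n$ be positive integers with $k_n\to\infty$, $k_n/n\to0$, $\sqrt{k_n}\,a_X(U_X(n/k_n))\to0$ and $\sqrt{k_n}\,a_Y(U_Y(n/k_n))\to 0$. (i) If $p_j=q_j$ for all $j$, then $\frac{k_n}{2}\hat D_K\to\chi^2(K-1)$ in distribution as $n\to\infty$. (ii) If $p_j\ne q_j$ for some $j$, then $\sqrt{k_n}(\hat D_K-D_K)\to N(0,\sigma^2)$ in distribution as $n\to\infty$, where $$\sigma^2=\sum_{j=1}^K\bigl(D_{1j}^2p_j(1-p_j)+D_{2j}^2q_j(1-q_j)\bigr)-2\sum_{1\le i<j\le K}\bigl(D_{1i}D_{1j}p_ip_j+D_{2i}D_{2j}q_iq_j\bigr)$$ with $D_{1j}=\frac{\partial D_K}{\partial p_j}=\log\frac{p_j}{q_j}+1-\frac{q_j}{p_j}$ and $D_{2j}=\frac{\partial D_K}{\partial q_j}=\log\frac{q_j}{p_j}+1-\frac{p_j}{q_j}$.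 -/

import Mathlib

open MeasureTheory ProbabilityTheory Filter Topology
open scoped NNReal ENNReal Pointwise

noncomputable section

namespace ExtremeKL

/-- The state space `[0, ∞)^d`. Topological notions such as `frontier` refer to this space. -/
abbrev Orthant (d : ℕ) : Type := Fin d → ℝ≥0

/-- The maximum norm on `[0, ∞)^d`. -/
def supNorm {d : ℕ} (x : Orthant d) : ℝ≥0 := Finset.univ.sup x

/-- All margins of the law `μ` are standard Pareto: `P(X_j > t) = 1 / t` for `t ≥ 1`. -/
def HasParetoMargins {d : ℕ} (μ : Measure (Orthant d)) : Prop :=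
  ∀ (j : Fin d) (t : ℝ≥0), 1 ≤ t → μ.real {x | t < x j} = 1 / (t : ℝ)

/-- Multivariate regular variation of a random vector with law `μ`: `ν` is a probability measure on
`{x ≥ 0 : ‖x‖_∞ > 1}` and `P(X / u ∈ B | ‖X‖_∞ > u) → ν B` as `u → ∞` for all Borel
`B ⊆ {x ≥ 0 : ‖x‖_∞ > 1}` whose boundary is `ν`-null. -/
structure IsExceedanceDistribution {d : ℕ} (μ ν : Measure (Orthant d)) : Prop where
  isProbabilityMeasure : IsProbabilityMeasure ν
  support : ν {x | 1 < supNorm x}ᶜ = 0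
  tendsto : ∀ B : Set (Orthant d), MeasurableSet B → B ⊆ {x | 1 < supNorm x} →
    ν (frontier B) = 0 →
    Tendsto (fun u : ℝ≥0 => (cond μ {x | u < supNorm x}) {x | u⁻¹ • x ∈ B}) atTop (𝓝 (ν B))

/-- Extension of an exceedance distribution to sets bounded away from the origin (the exponent
measure): `ν(B) = ν(B / m) / m` with `m = inf {‖x‖_∞ : x ∈ B}`. -/
def exponentMeasure {d : ℕ} (ν : Measure (Orthant d)) (B : Set (Orthant d)) : ℝ≥0∞ :=
  ν ((sInf (supNorm '' B))⁻¹ • B) / ((sInf (supNorm '' B) : ℝ≥0) : ℝ≥0∞)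

/-- Second-order condition with scale function `a`: `a u → 0`, and for every `ε > 0` and every Borel
set `B ⊆ [0, ∞)^d \ [0, ε)^d` whose boundary is null for the exponent measure,
`P(X / u ∈ B) / P(‖X‖_∞ > u) - ν(B) = O(a u)` as `u → ∞`. -/
structure SecondOrderCondition {d : ℕ} (μ ν : Measure (Orthant d)) (a : ℝ≥0 → ℝ) : Prop where
  tendsto_zero : Tendsto a atTop (𝓝 0)
  isBigO : ∀ ε : ℝ≥0, 0 < ε → ∀ B : Set (Orthant d), MeasurableSet B →
    B ⊆ {x | ε ≤ supNorm x} → exponentMeasure ν (frontier B) = 0 →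
    Asymptotics.IsBigO atTop
      (fun u : ℝ≥0 => μ.real {x | u⁻¹ • x ∈ B} / μ.real {x | u < supNorm x}
        - (exponentMeasure ν B).toReal) a

/-- `Ω_r = {x ≥ 0 : r x > 1}`. -/
def exceedanceSet {d : ℕ} (r : Orthant d → ℝ≥0) : Set (Orthant d) := {x | 1 < r x}

/-- A measurable risk functional, homogeneous of degree one, for which `Ω_r` is bounded away from
the origin. -/
structure IsRiskFunctional {d : ℕ} (r : Orthant d → ℝ≥0) : Prop where
  measurable : Measurable r
  homogeneous : ∀ (t : ℝ≥0) (x : Orthant d), 0 < t → r (t • x) = t * r x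
  bounded_away : ∃ ε : ℝ≥0, 0 < ε ∧ ∀ x ∈ exceedanceSet r, ε ≤ supNorm x

/-- Borel subsets `B` of `Ω_r` with `t B ⊆ B` for all `t > 1`. -/
def stableSets {d : ℕ} (r : Orthant d → ℝ≥0) : Set (Set (Orthant d)) :=
  {B | MeasurableSet B ∧ B ⊆ exceedanceSet r ∧ ∀ t : ℝ≥0, 1 < t → t • B ⊆ B}

/-- `A_1, …, A_K` is a partition of `Ω_r`, each `A_j` being obtained from stable sets by finitely
many unions, intersections and complementations. -/
structure IsAdmissiblePartition {d K : ℕ} (r : Orthant d → ℝ≥0) (A : Fin K → Set (Orthant d)) :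
    Prop where
  mem_algebra : ∀ j, A j ∈ generateSetAlgebra (stableSets r)
  disjoint : Pairwise fun i j => Disjoint (A i) (A j)
  iUnion_eq : ⋃ j, A j = exceedanceSet r

/-- `P(X ∈ u A | r(X) > u)` for a random vector with law `μ`. -/
def condProb {d : ℕ} (μ : Measure (Orthant d)) (r : Orthant d → ℝ≥0) (A : Set (Orthant d))
    (u : ℝ≥0) : ℝ :=
  (cond μ {x | u < r x}).real (u • A)

/-- `lim_{u → ∞} P(X ∈ u A | r(X) > u)`. -/
def limProb {d : ℕ} (μ : Measure (Orthant d)) (r : Orthant d → ℝ≥0) (A : Set (Orthant d)) : ℝ :=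
  limUnder atTop (condProb μ r A)

/-- `U(t) = inf {u : P(‖X‖_∞ > u) ≤ 1 / t}`. -/
def tailQuantile {d : ℕ} (μ : Measure (Orthant d)) (t : ℝ) : ℝ≥0 :=
  sInf {u : ℝ≥0 | μ.real {x | u < supNorm x} ≤ 1 / t}

/-- The `m`-th smallest of the values `v 0, …, v (n - 1)`, for `1 ≤ m ≤ n`: the least `t` such that
at least `m` of them are `≤ t`. -/
def orderStat (v : ℕ → ℝ≥0) (n m : ℕ) : ℝ≥0 :=
  sInf {t : ℝ≥0 | m ≤ ((Finset.range n).filter fun i => v i ≤ t).card}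

open Classical in
/-- `k⁻¹ ∑_{i ≤ n} 1{x_i ∈ R_{n-k,n} A}`, with `R_{1,n} ≤ … ≤ R_{n,n}` the order statistics of
`r(x_1), …, r(x_n)`. -/
def estProb {d : ℕ} (r : Orthant d → ℝ≥0) (A : Set (Orthant d)) (n k : ℕ)
    (x : ℕ → Orthant d) : ℝ :=
  (1 / (k : ℝ)) * ∑ i ∈ Finset.range n,
    if x i ∈ orderStat (fun l => r (x l)) n (n - k) • A then (1 : ℝ) else 0

/-- `D_K = ∑_j (p_j - q_j) (log p_j - log q_j)`. -/
def klDivergence {K : ℕ} (p q : Fin K → ℝ) : ℝ :=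
  ∑ j, (p j - q j) * (Real.log (p j) - Real.log (q j))

/-- The test statistic computed from the first `n` observations of both samples and `k`
exceedances. -/
def klStat {d K : ℕ} (r : Orthant d → ℝ≥0) (A : Fin K → Set (Orthant d)) (n k : ℕ)
    (x y : ℕ → Orthant d) : ℝ :=
  klDivergence (fun j => estProb r (A j) n k x) (fun j => estProb r (A j) n k y)

/-- `∂D_K/∂p_j` as a function of `p_j, q_j`; by symmetry `∂D_K/∂q_j` is `klPartial q_j p_j`. -/
def klPartial (p q : ℝ) : ℝ := Real.log (p / q) + 1 - q / p

/-- The asymptotic variance under the alternative. -/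
def asympVar {K : ℕ} (p q : Fin K → ℝ) : ℝ :=
  (∑ j, (klPartial (p j) (q j) ^ 2 * (p j * (1 - p j))
      + klPartial (q j) (p j) ^ 2 * (q j * (1 - q j))))
    - 2 * ∑ i, ∑ j ∈ Finset.Ioi i,
      (klPartial (p i) (q i) * klPartial (p j) (q j) * (p i * p j)
        + klPartial (q i) (p i) * klPartial (q j) (p j) * (q i * q j))

/-- The chi-squared distribution with `m` degrees of freedom: the law of the sum of the squares of
`m` independent standard normal variables. -/
def chiSquared (m : ℕ) : Measure ℝ :=
  (Measure.pi fun _ : Fin m => gaussianReal 0 1).map fun z => ∑ i, z i ^ 2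

instance instIsProbabilityMeasureChiSquared (m : ℕ) : IsProbabilityMeasure (chiSquared m) :=
  Measure.isProbabilityMeasure_map
    (Finset.measurable_sum _ fun i _ => (measurable_pi_apply i).pow_const 2).aemeasurable

end ExtremeKL

end

/-! Let `R` be the threshold `R_{n-k,n}`. Given `R` and the observations that do not exceed it, the
exceedances are i.i.d. with the law of `X` conditioned on `r(X) > R` (`integral_topSet_eq`,
`integral_prod_topSet`). The cell counts are therefore conditionally multinomial with cell
probabilities `condProb` at `R`, and the number of trials is `k` up to ties. With `u = U(n/k)` and
`b = ν(Ω_r)`, Chebyshev's inequality gives `R / u → b` in probability. If `√k (condProb(A_j, u t) -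
p_j) → 0` uniformly for `t` near `b`, the randomness of `R` is harmless: the normalized frequencies
converge to a Gaussian vector with covariance `diag p - p pᵀ`
(`IntermediateRegime.tendsto_charFun`). The samples are independent, so a delta method finishes the
proof. Off the diagonal `D_K` is linear to first order. On the diagonal it vanishes to second order,
and its quadratic part, evaluated at the Gaussian limit, is the squared norm of a standard Gaussian
vector on a hyperplane of dimension `K - 1`.

The difficulty is uniformity in `t`, because the second-order condition is assumed one set at a
time, with constants that may depend on the set. Along a sequence `t_m → b` from one side,
membership of a fixed point in `t_m • A_j` stabilises; this is what the algebra generated by the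
monotone sets provides. Hence the sets `t_m • A_j` generate a countable partition, every union of
whose cells has null boundary (`frontier_rayCode_preimage_subset`). The condition thus holds for
every union of cells, and a Baire category argument on the Cantor space of all such unions makes it
uniform (`eventually_abs_le_of_setwise`). The result is `tendsto_bias`.

The same uniform bound shows that the law of `r(X)` has only small atoms near the threshold
(`tendsto_atom`), so ties cost `o(√k)` exceedances. Homogeneity of the exponent measure is not
assumed; it follows from regular variation of the tail of the norm (`measure_smul_eq`). -/

namespace ExtremeKL

/-! ### Uniformity from setwise convergence, by Baire category. -/

/-- The mass of the set coded by `s` depends continuously on `s` in the Cantor space. -/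
lemma continuous_real_setOf_eq_true {C : Type*} [Countable C] [MeasurableSpace C]
    [DiscreteMeasurableSpace C] (α : Measure C) [IsFiniteMeasure α] :
    Continuous fun s : C → Bool => α.real {c | s c = true} := by
  have h : (fun s : C → Bool => α.real {c | s c = true})
      = fun s => ∫ c, (if s c = true then (1 : ℝ) else 0) ∂α := by
    funext s
    have : (fun c => if s c = true then (1 : ℝ) else 0)
        = Set.indicator {c | s c = true} fun _ => 1 := by
      funext c; simp [Set.indicator]
    rw [this, integral_indicator_const _ (MeasurableSet.of_discrete)]
    simp
  rw [h]
  refine continuous_of_dominated (bound := fun _ => 1) (fun s => ?_) (fun s => ?_)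
    (integrable_const _) (ae_of_all _ fun c => ?_)
  · exact (measurable_of_countable _).aestronglyMeasurable
  · refine ae_of_all _ fun c => ?_
    split_ifs <;> simp
  · exact (continuous_of_discreteTopology (f := fun b : Bool => if b = true then (1 : ℝ) else 0)).comp
      (continuous_apply c)

/-- On a countable space, weighted differences of finite measures that tend to zero setwise tend to
zero uniformly over all sets. -/
theorem eventually_abs_le_of_setwise {C : Type*} [Countable C] [MeasurableSpace C]
    [DiscreteMeasurableSpace C] (α β : ℕ → Measure C) [∀ m, IsFiniteMeasure (α m)]
    [∀ m, IsFiniteMeasure (β m)] (w : ℕ → ℝ)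
    (h : ∀ S : Set C, Tendsto (fun m => w m * ((α m).real S - (β m).real S)) atTop (𝓝 0))
    {δ : ℝ} (hδ : 0 < δ) :
    ∀ᶠ m in atTop, ∀ S : Set C, |w m * ((α m).real S - (β m).real S)| ≤ 3 * δ := by
  classical
  set f : ℕ → Set C → ℝ := fun m S => w m * ((α m).real S - (β m).real S) with hf
  have hadd : ∀ m (S T : Set C), Disjoint S T → f m (S ∪ T) = f m S + f m T := by
    intro m S T hST
    simp only [hf]
    rw [measureReal_union hST MeasurableSet.of_discrete,
      measureReal_union hST MeasurableSet.of_discrete]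
    ring
  have hcont : ∀ m, Continuous fun s : C → Bool => f m {c | s c = true} := fun m =>
    continuous_const.mul ((continuous_real_setOf_eq_true (α m)).sub
      (continuous_real_setOf_eq_true (β m)))
  let K : ℕ → Set (C → Bool) := fun N => {s | ∀ m, N ≤ m → |f m {c | s c = true}| ≤ δ}
  have hK : ∀ N, IsClosed (K N) := by
    intro N
    simp only [K, Set.ofPred_forall]
    exact isClosed_iInter fun m => isClosed_iInter fun _ =>
      isClosed_le (hcont m).abs continuous_const
  have hU : ⋃ N, K N = Set.univ := by
    refine Set.eq_univ_of_forall fun s => ?_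
    have := (h {c | s c = true}).eventually (Metric.ball_mem_nhds 0 hδ)
    obtain ⟨N, hN⟩ := eventually_atTop.1 this
    refine Set.mem_iUnion.2 ⟨N, fun m hm => ?_⟩
    have := hN m hm
    rw [Real.dist_eq, sub_zero] at this
    exact this.le
  -- The Cantor space is a Baire space, so some `K N` contains a cylinder: coordinates in a finite
  -- set `I` are prescribed by `s₀` and all others are free.
  obtain ⟨N, s₀, hs₀⟩ := nonempty_interior_of_iUnion_of_closed hK hU
  obtain ⟨V, hV, hVK⟩ := mem_nhds_iff.1 (mem_interior_iff_mem_nhds.1 hs₀)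
  obtain ⟨I, u, hu, hIu⟩ := isOpen_pi_iff.1 hVK.1 s₀ hVK.2
  have key : ∀ s : C → Bool, (∀ c ∈ I, s c = s₀ c) → s ∈ K N := fun s hs =>
    hV (hIu fun c hc => by rw [hs c hc]; exact (hu c hc).2)
  have hfin : Tendsto (fun m => ∑ c ∈ I, |f m {c}|) atTop (𝓝 0) := by
    rw [show (0 : ℝ) = ∑ c ∈ I, |(0 : ℝ)| by simp]
    exact tendsto_finsetSum _ fun c _ => (h {c}).abs
  filter_upwards [hfin.eventually (gt_mem_nhds hδ), eventually_ge_atTop N] with m hm hmN S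
  -- The codes of `S₀` and of `(S \ I) ∪ S₀` both lie in the cylinder, so by additivity `S \ I`
  -- contributes at most `2 * δ`; the finite part `S ∩ I` contributes at most `δ`.
  set S₀ : Set C := {c | c ∈ I ∧ s₀ c = true}
  have h0 : |f m S₀| ≤ δ := by
    have := key (fun c => if c ∈ I then s₀ c else false) (fun c hc => by simp [hc]) m hmN
    convert this using 3
    ext c
    by_cases hc : c ∈ I <;> simp [S₀, hc]
  have h1 : |f m ((S \ I) ∪ S₀)| ≤ δ := by
    have := key (fun c => if c ∈ I then s₀ c else decide (c ∈ S)) (fun c hc => by simp [hc]) m hmN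
    convert this using 3
    ext c
    by_cases hc : c ∈ I <;> simp [S₀, hc]
  have hsub : ∀ J : Finset C, |f m (S ∩ J)| ≤ ∑ c ∈ J, |f m {c}| := by
    intro J
    induction J using Finset.induction_on with
    | empty => simp [hf]
    | insert c J hc ih =>
      rw [Finset.sum_insert hc]
      by_cases hcS : c ∈ S
      · have : S ∩ ((insert c J : Finset C) : Set C) = {c} ∪ (S ∩ J) := by
          ext x
          simp only [Finset.coe_insert, Set.mem_inter_iff, Set.mem_insert_iff, Set.mem_union,
            Set.mem_singleton_iff]
          constructor
          · rintro ⟨h1, h2 | h2⟩ <;> tauto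
          · rintro (h2 | h2)
            · subst h2; tauto
            · tauto
        rw [this, hadd _ _ _ (by simp [hc])]
        exact (abs_add_le _ _).trans (by linarith)
      · have : S ∩ ((insert c J : Finset C) : Set C) = S ∩ J := by
          ext x
          simp only [Finset.coe_insert, Set.mem_inter_iff, Set.mem_insert_iff]
          constructor
          · rintro ⟨h1, h2 | h2⟩
            · subst h2; contradiction
            · tauto
          · tauto
        rw [this]
        have := abs_nonneg (f m {c})
        linarith
  have h2 : f m ((S \ I) ∪ S₀) = f m (S \ I) + f m S₀ :=
    hadd _ _ _ (Set.disjoint_left.2 fun c hc hc' => hc.2 hc'.1)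
  have h3 : f m S = f m (S ∩ I) + f m (S \ I) := by
    rw [← hadd _ _ _ (Set.disjoint_left.2 fun c hc hc' => hc'.2 hc.2), Set.inter_union_sdiff]
  have h4 := hsub I
  rw [abs_le] at h0 h1 h4 ⊢
  rw [h2] at h1
  change -(3 * δ) ≤ f m S ∧ f m S ≤ 3 * δ
  rw [h3]
  constructor <;> linarith [h0.1, h0.2, h1.1, h1.2, h4.1, h4.2]

open Classical in
/-- The set of indices `m` with `x ∈ E m`, or `∅` if there are infinitely many. -/
noncomputable def membershipCode {X : Type*} (E : ℕ → Set X) (x : X) : Finset ℕ :=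
  if h : {m | x ∈ E m}.Finite then h.toFinset else ∅

lemma mem_membershipCode {X : Type*} {E : ℕ → Set X} (hE : ∀ x, ∀ᶠ m in atTop, x ∉ E m)
    (x : X) (m : ℕ) : m ∈ membershipCode E x ↔ x ∈ E m := by
  have : {m | x ∈ E m}.Finite := by
    obtain ⟨N, hN⟩ := eventually_atTop.1 (hE x)
    exact (Set.finite_Iio N).subset fun m hm => by
      by_contra h
      exact hN m (not_lt.1 h) hm
  simp [membershipCode, this]

instance : MeasurableSpace (Finset ℕ) := ⊤

instance : DiscreteMeasurableSpace (Finset ℕ) := ⟨fun _ => trivial⟩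

lemma measurable_membershipCode {X : Type*} [MeasurableSpace X] {E : ℕ → Set X}
    (hE : ∀ x, ∀ᶠ m in atTop, x ∉ E m) (hm : ∀ m, MeasurableSet (E m)) :
    Measurable (membershipCode E) := by
  refine measurable_to_countable' fun F => ?_
  have : membershipCode E ⁻¹' {F} = ⋂ m, {x | x ∈ E m ↔ m ∈ F} := by
    ext x
    simp only [Set.mem_preimage, Set.mem_singleton_iff, Set.mem_iInter, Set.mem_ofPred_eq,
      Finset.ext_iff, mem_membershipCode hE]
  rw [this]
  refine MeasurableSet.iInter fun m => ?_
  by_cases h : m ∈ F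
  · simpa [h] using hm m
  · simp only [h, iff_false]
    exact (hm m).compl

/-- If weighted differences of finite measures tend to zero on every set of the form `f ⁻¹' S`, `f`
with countably many values, then they tend to zero along every sequence of such sets. -/
theorem tendsto_zero_of_tendsto_on_coded_sets {X C : Type*} [MeasurableSpace X] [Countable C]
    [MeasurableSpace C] [DiscreteMeasurableSpace C]
    (α β : ℕ → Measure X) [∀ m, IsFiniteMeasure (α m)] [∀ m, IsFiniteMeasure (β m)] (w : ℕ → ℝ)
    {f : X → C} (hf : Measurable f)
    (h : ∀ S : Set C, Tendsto (fun m => w m *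
      ((α m).real (f ⁻¹' S) - (β m).real (f ⁻¹' S))) atTop (𝓝 0)) (S : ℕ → Set C) :
    Tendsto (fun m => w m * ((α m).real (f ⁻¹' S m) - (β m).real (f ⁻¹' S m))) atTop (𝓝 0) := by
  have hmap : ∀ (γ : Measure X) (S : Set C), (γ.map f).real S = γ.real (f ⁻¹' S) := fun γ S => by
    rw [measureReal_def, Measure.map_apply hf MeasurableSet.of_discrete, measureReal_def]
  rw [Metric.tendsto_nhds]
  intro δ hδ
  filter_upwards [eventually_abs_le_of_setwise (fun m => (α m).map f)
    (fun m => (β m).map f) w (fun S => by simpa only [hmap] using h S)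
    (δ := δ / 6) (by positivity)] with m hm'
  have h1 := hm' (S m)
  rw [hmap, hmap] at h1
  rw [Real.dist_eq, sub_zero]
  linarith

lemma eventually_mem_iff_of_notMem_frontier {X : Type*} [TopologicalSpace X] {A : Set X} {x : X}
    (hx : x ∉ frontier A) : ∀ᶠ y in 𝓝 x, (y ∈ A ↔ x ∈ A) := by
  by_cases h : x ∈ A
  · have : x ∈ interior A := by
      by_contra h'
      exact hx ⟨subset_closure h, h'⟩
    filter_upwards [mem_interior_iff_mem_nhds.1 this] with y hy
    simp [h, hy]
  · have : x ∉ closure A := fun h' => hx ⟨h', fun h'' => h (interior_subset h'')⟩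
    filter_upwards [isClosed_closure.isOpen_compl.mem_nhds this] with y hy
    simp only [h, iff_false]
    exact fun h' => hy (subset_closure h')

/-- Off `Z` the map is locally constant, so no preimage has a boundary point there. One set `Z` thus
controls the boundaries of all preimages at once. -/
lemma frontier_preimage_subset_of_eventually_eq {X C : Type*} [TopologicalSpace X] {f : X → C}
    {Z : Set X} (h : ∀ x ∉ Z, ∀ᶠ y in 𝓝 x, f y = f x) (S : Set C) :
    frontier (f ⁻¹' S) ⊆ Z := by
  intro x hx
  by_contra hxZ
  by_cases hS : f x ∈ S
  · refine hx.2 (mem_interior_iff_mem_nhds.2 ?_)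
    filter_upwards [h x hxZ] with y hy
    rw [Set.mem_preimage, hy]
    exact hS
  · have h1 : (f ⁻¹' S)ᶜ ∈ 𝓝 x := by
      filter_upwards [h x hxZ] with y hy
      rw [Set.mem_compl_iff, Set.mem_preimage, hy]
      exact hS
    have := mem_closure_iff_nhds.1 hx.1 _ h1
    simp at this

/-! ### Coding the scaled sets `t m • A` by a countable partition. -/

section Scaling

variable {d : ℕ}

/-- The set of limits of the scaled sets `t m • A` is reached by the set of points that are
eventually in all of them. -/
def eventuallyMem (A : Set (Orthant d)) (t : ℕ → ℝ≥0) : Set (Orthant d) :=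
  {x | ∀ᶠ m in atTop, (t m)⁻¹ • x ∈ A}

/-- The points on which `t m • A` differs from the limiting set. -/
def scalingDefect (A : Set (Orthant d)) (t : ℕ → ℝ≥0) (m : ℕ) : Set (Orthant d) :=
  {x | ¬ ((t m)⁻¹ • x ∈ A ↔ x ∈ eventuallyMem A t)}

/-- This is what makes the code countable: each point lies in finitely many defects, so its list of
defects belongs to `Finset ℕ`. -/
lemma eventually_notMem_scalingDefect {A : Set (Orthant d)} {t : ℕ → ℝ≥0}
    (hL : ∀ x : Orthant d, (∀ᶠ m in atTop, (t m)⁻¹ • x ∈ A) ∨ ∀ᶠ m in atTop, (t m)⁻¹ • x ∉ A)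
    (x : Orthant d) : ∀ᶠ m in atTop, x ∉ scalingDefect A t m := by
  rcases hL x with h | h
  · filter_upwards [h] with m hm
    simpa [scalingDefect, eventuallyMem, hm] using h
  · have hx : x ∉ eventuallyMem A t := fun h' => by
      obtain ⟨m, h1, h2⟩ := (h.and h').exists
      exact h1 h2
    filter_upwards [h] with m hm
    simp [scalingDefect, hm, hx]

lemma measurableSet_smul_mem {A : Set (Orthant d)} (hA : MeasurableSet A) (s : ℝ≥0) :
    MeasurableSet {x : Orthant d | s • x ∈ A} :=
  (measurable_const_smul s) hA

lemma measurableSet_eventuallyMem {A : Set (Orthant d)} (hA : MeasurableSet A) (t : ℕ → ℝ≥0) :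
    MeasurableSet (eventuallyMem A t) := by
  have : eventuallyMem A t = ⋃ N, ⋂ m, ⋂ (_ : N ≤ m), {x | (t m)⁻¹ • x ∈ A} := by
    ext x
    simp [eventuallyMem, eventually_atTop]
  rw [this]
  exact MeasurableSet.iUnion fun N => MeasurableSet.iInter fun m => MeasurableSet.iInter fun _ =>
    measurableSet_smul_mem hA _

lemma measurableSet_scalingDefect {A : Set (Orthant d)} (hA : MeasurableSet A) (t : ℕ → ℝ≥0)
    (m : ℕ) : MeasurableSet (scalingDefect A t m) := by
  have : scalingDefect A t m
      = ({x | (t m)⁻¹ • x ∈ A} \ eventuallyMem A t) ∪ (eventuallyMem A t \ {x | (t m)⁻¹ • x ∈ A}) := by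
    ext x
    simp only [scalingDefect, Set.mem_ofPred_eq, Set.mem_union, Set.mem_sdiff]
    tauto
  rw [this]
  have h1 := measurableSet_eventuallyMem hA t
  have h2 := measurableSet_smul_mem hA (t m)⁻¹
  exact (h2.diff h1).union (h1.diff h2)

open Classical in
/-- A countably valued map from which membership in each of the sets `t m • A` can be recovered. -/
noncomputable def rayCode (A : Set (Orthant d)) (t : ℕ → ℝ≥0) (x : Orthant d) : Finset ℕ × Bool :=
  (membershipCode (scalingDefect A t) x, decide (x ∈ eventuallyMem A t))

open Classical in
lemma measurable_rayCode {A : Set (Orthant d)} (hA : MeasurableSet A) {t : ℕ → ℝ≥0}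
    (hL : ∀ x : Orthant d, (∀ᶠ m in atTop, (t m)⁻¹ • x ∈ A) ∨ ∀ᶠ m in atTop, (t m)⁻¹ • x ∉ A) :
    Measurable (rayCode A t) := by
  refine (measurable_membershipCode (eventually_notMem_scalingDefect hL)
    (measurableSet_scalingDefect hA t)).prodMk (measurable_to_bool ?_)
  have : (fun x => decide (x ∈ eventuallyMem A t)) ⁻¹' {true} = eventuallyMem A t := by
    ext x; simp
  rw [this]
  exact measurableSet_eventuallyMem hA t

/-- Decoding: a point is in `t m • A` when either it is in the limiting set and not in the `m`-th
defect, or in the defect and not in the limiting set. -/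
lemma rayCode_preimage {A : Set (Orthant d)} {t : ℕ → ℝ≥0}
    (hL : ∀ x : Orthant d, (∀ᶠ m in atTop, (t m)⁻¹ • x ∈ A) ∨ ∀ᶠ m in atTop, (t m)⁻¹ • x ∉ A)
    (m : ℕ) : rayCode A t ⁻¹' {c | m ∉ c.1 ↔ c.2 = true} = {x | (t m)⁻¹ • x ∈ A} := by
  ext x
  simp only [rayCode, Set.mem_preimage, Set.mem_ofPred_eq,
    mem_membershipCode (eventually_notMem_scalingDefect hL), scalingDefect, decide_eq_true_eq]
  tauto

/-- Unions of cells generated by the defects of `t m • A`, `t m → b`, have their boundary in the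
boundaries of the sets `t m • A` and `b • A`. -/
lemma frontier_rayCode_preimage_subset {A : Set (Orthant d)} {t : ℕ → ℝ≥0} {b : ℝ≥0}
    (hb : 0 < b) (ht : Tendsto t atTop (𝓝 b))
    (hL : ∀ x : Orthant d, (∀ᶠ m in atTop, (t m)⁻¹ • x ∈ A) ∨ ∀ᶠ m in atTop, (t m)⁻¹ • x ∉ A)
    (S : Set (Finset ℕ × Bool)) :
    frontier (rayCode A t ⁻¹' S)
      ⊆ {x | b⁻¹ • x ∈ frontier A} ∪ ⋃ m, {x | (t m)⁻¹ • x ∈ frontier A} := by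
  refine frontier_preimage_subset_of_eventually_eq (fun x hx => ?_) S
  simp only [Set.mem_union, Set.mem_iUnion, not_or, not_exists] at hx
  have h1 : Tendsto (fun p : ℕ × Orthant d => (t p.1)⁻¹ • p.2) (atTop ×ˢ 𝓝 x) (𝓝 (b⁻¹ • x)) :=
    ((ht.inv₀ hb.ne').comp tendsto_fst).smul tendsto_snd
  have h2 := h1.eventually (eventually_mem_iff_of_notMem_frontier hx.1)
  -- Since `b⁻¹ • x` is off the boundary of `A`, one neighbourhood `V` serves all `m ≥ M`. The
  -- finitely many smaller indices are treated separately, each through the boundary of its own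
  -- scaled set.
  obtain ⟨V, hV, M, hM⟩ : ∃ V ∈ 𝓝 x, ∃ M : ℕ, ∀ m, M ≤ m → ∀ y ∈ V,
      ((t m)⁻¹ • y ∈ A ↔ b⁻¹ • x ∈ A) := by
    obtain ⟨pa, ha, pb, hb, hab⟩ := eventually_prod_iff.1 h2
    obtain ⟨M, hM⟩ := eventually_atTop.1 ha
    exact ⟨{y | pb y}, hb, M, fun m hm y hy => hab (hM m hm) hy⟩
  have hVL : ∀ y ∈ V, (y ∈ eventuallyMem A t ↔ b⁻¹ • x ∈ A) := by
    intro y hy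
    constructor
    · intro h
      obtain ⟨m, h3, h4⟩ := (h.and (eventually_ge_atTop M)).exists
      exact (hM m h4 y hy).1 h3
    · intro h
      filter_upwards [eventually_ge_atTop M] with m hm
      exact (hM m hm y hy).2 h
  have h3 : ∀ᶠ y in 𝓝 x, ∀ m ∈ Finset.range M, ((t m)⁻¹ • y ∈ A ↔ (t m)⁻¹ • x ∈ A) := by
    rw [eventually_all_finset]
    intro m _
    exact ((continuous_const_smul (t m)⁻¹).tendsto x).eventually
      (eventually_mem_iff_of_notMem_frontier (hx.2 m))
  filter_upwards [hV, h3] with y hy hy3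
  have hE := eventually_notMem_scalingDefect hL
  refine Prod.ext (Finset.ext fun m => ?_) (decide_eq_decide.2 ((hVL y hy).trans
    (hVL x (mem_of_mem_nhds hV)).symm))
  simp only [rayCode]
  rw [mem_membershipCode hE, mem_membershipCode hE]
  simp only [scalingDefect, Set.mem_ofPred_eq, hVL y hy, hVL x (mem_of_mem_nhds hV)]
  rcases lt_or_ge m M with hm | hm
  · rw [hy3 m (Finset.mem_range.2 hm)]
  · rw [hM m hm y hy, hM m hm x (mem_of_mem_nhds hV)]

/-- Along every ray, membership in `A` stabilises when a positive scale is approached from one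
side. -/
structure HasRayLimits (A : Set (Orthant d)) : Prop where
  right : ∀ (x : Orthant d) (b : ℝ≥0), 0 < b →
    (∀ᶠ t in 𝓝[>] b, t⁻¹ • x ∈ A) ∨ ∀ᶠ t in 𝓝[>] b, t⁻¹ • x ∉ A
  left : ∀ (x : Orthant d) (b : ℝ≥0), 0 < b →
    (∀ᶠ t in 𝓝[<] b, t⁻¹ • x ∈ A) ∨ ∀ᶠ t in 𝓝[<] b, t⁻¹ • x ∉ A

lemma eventually_or_eventually_not_union {X : Type*} {l : Filter X} {p q : X → Prop}
    (hp : (∀ᶠ x in l, p x) ∨ ∀ᶠ x in l, ¬ p x) (hq : (∀ᶠ x in l, q x) ∨ ∀ᶠ x in l, ¬ q x) :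
    (∀ᶠ x in l, p x ∨ q x) ∨ ∀ᶠ x in l, ¬ (p x ∨ q x) := by
  rcases hp with hp | hp
  · exact Or.inl (hp.mono fun x hx => Or.inl hx)
  · rcases hq with hq | hq
    · exact Or.inl (hq.mono fun x hx => Or.inr hx)
    · exact Or.inr ((hp.and hq).mono fun x hx => by tauto)

/-- If `t⁻¹ • x` is in `A`, so is `s⁻¹ • x` for every positive `s ≤ t`: membership is monotone in
the scale, and a monotone two-valued function has one-sided limits. -/
lemma hasRayLimits_of_mem_stableSets {r : Orthant d → ℝ≥0} {A : Set (Orthant d)}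
    (hA : A ∈ stableSets r) : HasRayLimits A := by
  have hmono : ∀ (x : Orthant d) (s t : ℝ≥0), 0 < s → s ≤ t → t⁻¹ • x ∈ A → s⁻¹ • x ∈ A := by
    intro x s t hs hst h
    rcases hst.eq_or_lt with rfl | hst
    · exact h
    have h1 : 1 < t / s := by rwa [one_lt_div hs]
    have h2 := hA.2.2 _ h1 (Set.smul_mem_smul_set h)
    rwa [smul_smul, div_mul_eq_mul_div, mul_inv_cancel₀ (hs.trans hst).ne', one_div] at h2
  constructor
  · intro x b hb
    by_cases h : ∃ t, b < t ∧ t⁻¹ • x ∈ A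
    · obtain ⟨t, hbt, ht⟩ := h
      left
      filter_upwards [Ioo_mem_nhdsGT hbt] with s hs
      exact hmono x s t (hb.trans hs.1) hs.2.le ht
    · right
      push Not at h
      filter_upwards [self_mem_nhdsWithin] with s hs
      exact h s hs
  · intro x b hb
    by_cases h : ∃ t, t < b ∧ 0 < t ∧ t⁻¹ • x ∉ A
    · obtain ⟨t, hbt, h0, ht⟩ := h
      right
      filter_upwards [Ioo_mem_nhdsLT hbt] with s hs hs'
      exact ht (hmono x t s h0 hs.1.le hs')
    · left
      push Not at h
      filter_upwards [Ioo_mem_nhdsLT hb] with s hs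
      exact h s hs.2 hs.1

/-- Boolean operations destroy monotonicity along rays but preserve one-sided limits. Apart from
measurability, this is all that is used of the algebra. -/
lemma hasRayLimits_of_mem_generateSetAlgebra {r : Orthant d → ℝ≥0} {A : Set (Orthant d)}
    (hA : A ∈ generateSetAlgebra (stableSets r)) : HasRayLimits A := by
  induction hA with
  | base s hs => exact hasRayLimits_of_mem_stableSets hs
  | empty => exact ⟨fun _ _ _ => by simp, fun _ _ _ => by simp⟩
  | compl s _ ih =>
    refine ⟨fun x b hb => ?_, fun x b hb => ?_⟩
    · simpa [or_comm] using ih.right x b hb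
    · simpa [or_comm] using ih.left x b hb
  | union s t _ _ ih1 ih2 =>
    exact ⟨fun x b hb => eventually_or_eventually_not_union (ih1.right x b hb) (ih2.right x b hb),
      fun x b hb => eventually_or_eventually_not_union (ih1.left x b hb) (ih2.left x b hb)⟩

lemma measurableSet_of_mem_generateSetAlgebra {r : Orthant d → ℝ≥0} {A : Set (Orthant d)}
    (hA : A ∈ generateSetAlgebra (stableSets r)) : MeasurableSet A := by
  induction hA with
  | base s hs => exact hs.1
  | empty => exact MeasurableSet.empty
  | compl s _ ih => exact ih.compl
  | union s t _ _ ih1 ih2 => exact ih1.union ih2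

end Scaling

/-! ### Scaling of the maximum norm and of `exponentMeasure`. -/

section SupNorm

variable {d : ℕ}

lemma continuous_supNorm : Continuous (supNorm : Orthant d → ℝ≥0) :=
  Continuous.finset_sup_apply fun i _ => continuous_apply i

lemma measurable_supNorm : Measurable (supNorm : Orthant d → ℝ≥0) :=
  continuous_supNorm.measurable

lemma supNorm_smul (t : ℝ≥0) (x : Orthant d) : supNorm (t • x) = t * supNorm x := by
  rw [supNorm, supNorm, NNReal.mul_finset_sup]
  rfl

lemma supNorm_const (hd : 0 < d) (t : ℝ≥0) : supNorm (fun _ : Fin d => t) = t := by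
  have : Nonempty (Fin d) := ⟨⟨0, hd⟩⟩
  exact Finset.sup_const Finset.univ_nonempty t

lemma frontier_supNorm_lt_subset (s : ℝ≥0) :
    frontier {x : Orthant d | s < supNorm x} ⊆ {x | supNorm x = s} := fun _ hx =>
  (frontier_lt_subset_eq continuous_const continuous_supNorm hx).symm

lemma frontier_le_supNorm_subset (s : ℝ≥0) :
    frontier {x : Orthant d | s ≤ supNorm x} ⊆ {x | supNorm x = s} := fun _ hx =>
  (frontier_le_subset_eq continuous_const continuous_supNorm hx).symm

lemma frontier_smul_set {t : ℝ≥0} (ht : 0 < t) (B : Set (Orthant d)) :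
    frontier (t • B) = t • frontier B := by
  have := (Homeomorph.smulOfNeZero t ht.ne' (α := Orthant d)).image_frontier B
  simpa [Set.image_smul] using this.symm

lemma measurableSet_smul_set {t : ℝ≥0} (ht : 0 < t) {B : Set (Orthant d)} (hB : MeasurableSet B) :
    MeasurableSet (t • B) := hB.const_smul_of_ne_zero ht.ne'

lemma sInf_supNorm_smul {t : ℝ≥0} (B : Set (Orthant d)) :
    sInf (supNorm '' (t • B)) = t * sInf (supNorm '' B) := by
  have : supNorm '' (t • B) = t • (supNorm '' B) := by
    ext s
    simp only [Set.mem_image, Set.mem_smul_set]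
    constructor
    · rintro ⟨_, ⟨x, hx, rfl⟩, rfl⟩
      exact ⟨_, ⟨x, hx, rfl⟩, (supNorm_smul t x).symm⟩
    · rintro ⟨_, ⟨x, hx, rfl⟩, rfl⟩
      exact ⟨_, ⟨x, hx, rfl⟩, supNorm_smul t x⟩
  rw [this]
  apply NNReal.coe_injective
  rw [NNReal.coe_sInf, NNReal.coe_mul, NNReal.coe_sInf]
  have : ((↑) : ℝ≥0 → ℝ) '' (t • (supNorm '' B)) = (t : ℝ) • (((↑) : ℝ≥0 → ℝ) '' (supNorm '' B)) := by
    simp only [← Set.image_smul, Set.image_image]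
    rfl
  rw [this, Real.sInf_smul_of_nonneg (show (0 : ℝ) ≤ t from t.2), smul_eq_mul]

/-- Homogeneity is built into the definition, because the infimum of the norms scales with the set.
What is not built in is additivity, since the normalisation depends on the set; see
`exponentMeasure_eq_tailMeasure`. -/
lemma exponentMeasure_smul (ν : Measure (Orthant d)) {t : ℝ≥0} (ht : 0 < t) (B : Set (Orthant d)) :
    exponentMeasure ν (t • B) = exponentMeasure ν B / t := by
  rw [exponentMeasure, exponentMeasure, sInf_supNorm_smul, smul_smul, mul_inv_rev, mul_assoc,
    inv_mul_cancel₀ ht.ne', mul_one, mul_comm t, ENNReal.coe_mul, div_eq_mul_inv, div_eq_mul_inv,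
    div_eq_mul_inv, ENNReal.mul_inv (Or.inr ENNReal.coe_ne_top) (Or.inr (by simpa using ht.ne')),
    mul_assoc]

end SupNorm

/-! ### Exponent measure of norm sets and regular variation of the tail. -/

section Exponent

variable {d : ℕ} {μ ν : Measure (Orthant d)} {a : ℝ≥0 → ℝ}

lemma IsExceedanceDistribution.dim_pos (hν : IsExceedanceDistribution μ ν) : 0 < d := by
  by_contra h
  obtain rfl : d = 0 := by omega
  have h1 := hν.isProbabilityMeasure
  have h2 := hν.support
  have : {x : Orthant 0 | 1 < supNorm x}ᶜ = Set.univ := by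
    ext x
    simp [supNorm]
  rw [this, measure_univ] at h2
  exact one_ne_zero h2

lemma IsExceedanceDistribution.measure_sphere_of_le (hν : IsExceedanceDistribution μ ν) {s : ℝ≥0}
    (hs : s ≤ 1) : ν {x | supNorm x = s} = 0 :=
  measure_mono_null (fun x hx => by
    simp only [Set.mem_compl_iff, Set.mem_ofPred_eq, not_lt] at hx ⊢
    exact hx.le.trans hs) hν.support

/-- The normalisation moves a nonempty `Z` into the unit sphere, which `ν`, being carried by `‖x‖ >
1`, does not charge. The second-order condition is thereby available for `{x | s < supNorm x}`
before it is known that `ν` itself charges no sphere. -/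
lemma exponentMeasure_eq_zero_of_subset_sphere (hν : IsExceedanceDistribution μ ν) {s : ℝ≥0}
    (hs : 0 < s) {Z : Set (Orthant d)} (hZ : Z ⊆ {x | supNorm x = s}) :
    exponentMeasure ν Z = 0 := by
  rcases Z.eq_empty_or_nonempty with rfl | hne
  · simp [exponentMeasure]
  have h1 : supNorm '' Z = {s} := by
    refine (hne.image _).subset_singleton_iff.1 ?_
    rintro _ ⟨x, hx, rfl⟩
    exact hZ hx
  rw [exponentMeasure, h1, csInf_singleton]
  rw [measure_mono_null ?_ (hν.measure_sphere_of_le le_rfl), ENNReal.zero_div]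
  rintro _ ⟨x, hx, rfl⟩
  have := hZ hx
  simp only [Set.mem_ofPred_eq] at this ⊢
  rw [supNorm_smul, this, inv_mul_cancel₀ hs.ne']

lemma smul_setOf_lt_supNorm {t : ℝ≥0} (ht : 0 < t) (s : ℝ≥0) :
    t • {x : Orthant d | s < supNorm x} = {x | t * s < supNorm x} := by
  ext x
  rw [Set.mem_smul_set_iff_inv_smul_mem₀ ht.ne']
  simp only [Set.mem_ofPred_eq, supNorm_smul]
  rw [← div_eq_inv_mul, lt_div_iff₀ ht, mul_comm]

lemma exponentMeasure_lt_supNorm (hν : IsExceedanceDistribution μ ν) {s : ℝ≥0} (hs : 0 < s) :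
    exponentMeasure ν {x | s < supNorm x} = (s : ℝ≥0∞)⁻¹ := by
  have := hν.isProbabilityMeasure
  have h1 : ν {x | 1 < supNorm x} = 1 := by
    exact (prob_compl_eq_zero_iff (measurableSet_lt measurable_const measurable_supNorm)).1
      hν.support
  have h2 : supNorm '' {x : Orthant d | s < supNorm x} = Set.Ioi s := by
    ext t
    constructor
    · rintro ⟨x, hx, rfl⟩
      exact hx
    · intro ht
      exact ⟨fun _ => t, by simpa [supNorm_const hν.dim_pos] using ht, supNorm_const hν.dim_pos t⟩
  rw [exponentMeasure, h2, csInf_Ioi, smul_setOf_lt_supNorm (inv_pos.2 hs), inv_mul_cancel₀ hs.ne',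
    h1, one_div]

/-- Membership of the rescaled point, for a positive scale. -/
lemma setOf_inv_smul_mem {u : ℝ≥0} (hu : 0 < u) (B : Set (Orthant d)) :
    {x | u⁻¹ • x ∈ B} = u • B := by
  ext x
  rw [Set.mem_smul_set_iff_inv_smul_mem₀ hu.ne']
  rfl

lemma SecondOrderCondition.tendsto (ha : SecondOrderCondition μ ν a) {ε : ℝ≥0} (hε : 0 < ε)
    {B : Set (Orthant d)} (hB : MeasurableSet B) (hBε : B ⊆ {x | ε ≤ supNorm x})
    (hB0 : exponentMeasure ν (frontier B) = 0) :
    Tendsto (fun u : ℝ≥0 => μ.real (u • B) / μ.real {x | u < supNorm x}) atTop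
      (𝓝 (exponentMeasure ν B).toReal) := by
  have := (ha.isBigO ε hε B hB hBε hB0).trans_tendsto ha.tendsto_zero
  have h2 := this.add_const (exponentMeasure ν B).toReal
  rw [zero_add] at h2
  refine h2.congr' ?_
  filter_upwards [eventually_gt_atTop 0] with u hu
  rw [sub_add_cancel, setOf_inv_smul_mem hu]

/-- The tail of the maximum norm is regularly varying with index `-1`. -/
lemma tendsto_tail_ratio (hν : IsExceedanceDistribution μ ν) (ha : SecondOrderCondition μ ν a)
    {s : ℝ≥0} (hs : 0 < s) :
    Tendsto (fun u : ℝ≥0 => μ.real {x | u * s < supNorm x} / μ.real {x | u < supNorm x}) atTop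
      (𝓝 (s : ℝ)⁻¹) := by
  have := ha.tendsto hs (B := {x | s < supNorm x}) (measurableSet_lt measurable_const
    measurable_supNorm) (fun x hx => (show s < supNorm x from hx).le)
    (exponentMeasure_eq_zero_of_subset_sphere hν hs (frontier_supNorm_lt_subset s))
  rw [exponentMeasure_lt_supNorm hν hs] at this
  simp only [ENNReal.toReal_inv, ENNReal.coe_toReal] at this
  refine this.congr' ?_
  filter_upwards [eventually_gt_atTop 0] with u hu
  rw [smul_setOf_lt_supNorm hu]

lemma IsExceedanceDistribution.tendsto_real [IsProbabilityMeasure μ]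
    (hν : IsExceedanceDistribution μ ν)
    {B : Set (Orthant d)} (hB : MeasurableSet B) (hB1 : B ⊆ {x | 1 < supNorm x})
    (hB0 : ν (frontier B) = 0) :
    Tendsto (fun u : ℝ≥0 => μ.real (u • B) / μ.real {x | u < supNorm x}) atTop
      (𝓝 (ν.real B)) := by
  have := hν.isProbabilityMeasure
  have h := (ENNReal.tendsto_toReal (measure_ne_top ν B)).comp (hν.tendsto B hB hB1 hB0)
  refine h.congr' ?_
  filter_upwards [eventually_gt_atTop 0] with u hu
  rw [Function.comp_apply, setOf_inv_smul_mem hu, cond_apply (measurableSet_lt measurable_const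
    measurable_supNorm), ENNReal.toReal_mul, ENNReal.toReal_inv, Set.inter_eq_right.2]
  · rw [measureReal_def, measureReal_def, div_eq_inv_mul]
  · have := Set.smul_set_mono (a := u) hB1
    rwa [smul_setOf_lt_supNorm hu, mul_one] at this

end Exponent

/-! ### Homogeneity of the exceedance distribution, and the exponent measure as a measure. -/

section Homogeneity

variable {d : ℕ} {μ ν : Measure (Orthant d)} {a : ℝ≥0 → ℝ}

lemma measurableSet_lt_supNorm (s : ℝ≥0) : MeasurableSet {x : Orthant d | s < supNorm x} :=
  measurableSet_lt measurable_const measurable_supNorm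

lemma measurableSet_le_supNorm (s : ℝ≥0) : MeasurableSet {x : Orthant d | s ≤ supNorm x} :=
  measurableSet_le measurable_const measurable_supNorm

/-- Spheres are null sets of an exceedance distribution. -/
lemma measure_sphere_eq_zero [IsProbabilityMeasure μ] (hν : IsExceedanceDistribution μ ν)
    (ha : SecondOrderCondition μ ν a) (s : ℝ≥0) : ν {x | supNorm x = s} = 0 := by
  have hνp := hν.isProbabilityMeasure
  rcases le_or_gt s 1 with hs | hs
  · exact hν.measure_sphere_of_le hs
  have hs0 : (0 : ℝ) < s := by exact_mod_cast zero_lt_one.trans hs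
  have hs1 : (1 : ℝ) < s := by exact_mod_cast hs
  rw [← measureReal_eq_zero_iff]
  refine le_antisymm (le_of_forall_pos_le_add fun δ hδ => ?_) measureReal_nonneg
  have hcont : ContinuousAt (fun x : ℝ => x⁻¹) s := continuousAt_inv₀ hs0.ne'
  obtain ⟨η, hη, hη'⟩ := Metric.continuousAt_iff.1 hcont (δ / 2) (half_pos hδ)
  -- Only countably many spheres carry mass, so a shell `s₁ < ‖x‖ < s₂` around the sphere with
  -- `ν`-null boundary can be made as thin as desired.
  have hdense := (Measure.countable_meas_level_set_pos (μ := ν)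
    (g := fun x : Orthant d => (supNorm x : ℝ)) measurable_supNorm.coe_nnreal_real).dense_compl ℝ
  obtain ⟨s₁, hs₁, h1, h1'⟩ := hdense.exists_between
    (show max 1 ((s : ℝ) - η) < s from max_lt hs1 (by linarith))
  obtain ⟨s₂, hs₂, h2, h2'⟩ := hdense.exists_between
    (show (s : ℝ) < s + η by linarith)
  have h11 : 1 < s₁ := (le_max_left _ _).trans_lt h1
  have h12 : (s : ℝ) - η < s₁ := (le_max_right _ _).trans_lt h1
  lift s₁ to ℝ≥0 using by linarith
  lift s₂ to ℝ≥0 using by linarith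
  simp only [Set.mem_compl_iff, Set.mem_ofPred_eq, not_lt, nonpos_iff_eq_zero, NNReal.coe_inj]
    at hs₁ hs₂
  norm_cast at h11 h1' h2
  set B : Set (Orthant d) := {x | s₁ < supNorm x} ∩ {x | s₂ ≤ supNorm x}ᶜ with hB
  have hBf : ν (frontier B) = 0 := by
    refine measure_mono_null (t := {x | supNorm x = s₁} ∪ {x | supNorm x = s₂}) ?_
      (measure_union_null hs₁ hs₂)
    refine (frontier_inter_subset _ _).trans (Set.union_subset_union
      (Set.inter_subset_left.trans (frontier_supNorm_lt_subset s₁))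
      (Set.inter_subset_right.trans ?_))
    rw [frontier_compl]
    exact frontier_le_supNorm_subset s₂
  have hBm : MeasurableSet B := (measurableSet_lt_supNorm s₁).inter (measurableSet_le_supNorm s₂).compl
  have hlim := hν.tendsto_real hBm (fun x hx => h11.trans hx.1) hBf
  have hlim2 := (tendsto_tail_ratio hν ha (zero_lt_one.trans h11)).sub
    (tendsto_tail_ratio hν ha ((zero_lt_one.trans hs).trans h2))
  -- Regular variation of the tail bounds the mass of the shell by `1 / s₁ - 1 / s₂`, and each
  -- reciprocal is within `δ / 2` of `1 / s`.
  have hle : ν.real B ≤ (s₁ : ℝ)⁻¹ - (s₂ : ℝ)⁻¹ := by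
    refine le_of_tendsto_of_tendsto hlim hlim2 ?_
    filter_upwards [eventually_gt_atTop 0] with u hu
    rw [← sub_div]
    refine div_le_div_of_nonneg_right ?_ measureReal_nonneg
    have hsub : u • B ⊆ {x | u * s₁ < supNorm x} \ {x | u * s₂ < supNorm x} := by
      intro x hx
      rw [Set.mem_smul_set_iff_inv_smul_mem₀ hu.ne'] at hx
      obtain ⟨hx1, hx2⟩ := hx
      simp only [Set.mem_ofPred_eq, supNorm_smul, Set.mem_compl_iff, not_le] at hx1 hx2
      rw [← div_eq_inv_mul, lt_div_iff₀ hu, mul_comm] at hx1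
      rw [← div_eq_inv_mul, div_lt_iff₀ hu, mul_comm] at hx2
      exact ⟨hx1, by simpa using hx2.le⟩
    refine (measureReal_mono hsub).trans ?_
    rw [measureReal_sdiff _ (measurableSet_lt_supNorm _)]
    intro x hx
    exact (mul_le_mul_right (h1'.trans h2).le u).trans_lt hx
  have hmono : ν.real {x | supNorm x = s} ≤ ν.real B :=
    measureReal_mono fun x hx => by
      simp only [Set.mem_ofPred_eq] at hx
      simp [hB, hx, h1', h2]
  have d1 := hη' (x := (s₁ : ℝ)) (by
    rw [Real.dist_eq, abs_lt]
    have : (s₁ : ℝ) < s := by exact_mod_cast h1'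
    constructor <;> linarith)
  have d2 := hη' (x := (s₂ : ℝ)) (by
    rw [Real.dist_eq, abs_lt]
    have : (s : ℝ) < s₂ := by exact_mod_cast h2
    constructor <;> linarith)
  rw [Real.dist_eq, abs_lt] at d1 d2
  linarith [d1.1, d1.2, d2.1, d2.2]

lemma tendsto_mul_const_atTop_nnreal {s : ℝ≥0} (hs : 0 < s) :
    Tendsto (fun u : ℝ≥0 => u * s) atTop atTop := by
  refine tendsto_atTop.2 fun c => ?_
  filter_upwards [eventually_ge_atTop (c / s)] with u hu
  rwa [div_le_iff₀ hs] at hu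

/-- With `V` the tail of the norm, write `μ(u s B) / V(u)` as `V(u s) / V(u)` times `μ(u s B) / V(u
s)` and let `u → ∞`; the first factor tends to `1 / s`. -/
lemma measureReal_smul_of_null_frontier [IsProbabilityMeasure μ]
    (hν : IsExceedanceDistribution μ ν) (ha : SecondOrderCondition μ ν a) {s : ℝ≥0} (hs : 1 ≤ s)
    {B : Set (Orthant d)} (hB : MeasurableSet B) (hB1 : B ⊆ {x | 1 < supNorm x})
    (hB0 : ν (frontier B) = 0) (hB2 : ν (s • frontier B) = 0) :
    ν.real (s • B) = (s : ℝ)⁻¹ * ν.real B := by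
  have hs0 : 0 < s := zero_lt_one.trans_le hs
  have h1 : Tendsto (fun u : ℝ≥0 => μ.real (u • s • B) / μ.real {x | u < supNorm x}) atTop
      (𝓝 (ν.real (s • B))) := by
    refine hν.tendsto_real (measurableSet_smul_set hs0 hB) ?_ (by rwa [frontier_smul_set hs0])
    have := Set.smul_set_mono (a := s) hB1
    rw [smul_setOf_lt_supNorm hs0, mul_one] at this
    exact this.trans fun x hx => hs.trans_lt hx
  have h2 := (hν.tendsto_real hB hB1 hB0).comp (tendsto_mul_const_atTop_nnreal hs0)
  have h3 := (tendsto_tail_ratio hν ha hs0).mul h2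
  refine tendsto_nhds_unique h1 (h3.congr fun u => ?_)
  simp only [Function.comp_apply]
  rw [smul_smul]
  by_cases h : μ.real {x | u * s < supNorm x} = 0
  · have h4 : μ.real ((u * s) • B) = 0 := by
      -- At scale zero a nonempty `B` collapses to the origin, outside every tail set. A null tail
      -- at level zero is impossible, however: all tail ratios would be `0 / 0 = 0`, whereas they
      -- tend to `1` for `s = 1`.
      rcases eq_or_ne (u * s) 0 with h0 | h0
      · rw [h0] at h ⊢
        refine le_antisymm ?_ measureReal_nonneg
        rcases B.eq_empty_or_nonempty with rfl | hne
        · simp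
        exfalso
        have hu : u = 0 := by simpa [hs0.ne'] using h0
        have hlim := tendsto_tail_ratio hν ha zero_lt_one
        have hz : ∀ v : ℝ≥0, μ.real {x | v < supNorm x} = 0 := fun v =>
          le_antisymm (h ▸ measureReal_mono fun x hx =>
            (zero_le (a := v)).trans_lt hx) measureReal_nonneg
        simp only [hz, div_zero] at hlim
        have := tendsto_nhds_unique hlim tendsto_const_nhds
        simp at this
      · refine le_antisymm (h ▸ measureReal_mono ?_) measureReal_nonneg
        have := Set.smul_set_mono (a := u * s) hB1
        rwa [smul_setOf_lt_supNorm (pos_of_ne_zero h0), mul_one] at this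
    rw [h, h4]
    simp
  · rw [div_mul_div_comm, mul_comm (μ.real {x | u * s < supNorm x}), mul_div_mul_right _ _ h]

/-- Homogeneity of order `-1` of an exceedance distribution. -/
theorem measure_smul_eq [IsProbabilityMeasure μ]
    (hν : IsExceedanceDistribution μ ν) (ha : SecondOrderCondition μ ν a) {s : ℝ≥0} (hs : 1 ≤ s)
    {B : Set (Orthant d)} (hB : MeasurableSet B) (hB1 : B ⊆ {x | 1 < supNorm x}) :
    ν (s • B) = (s : ℝ≥0∞)⁻¹ * ν B := by
  have hνp := hν.isProbabilityMeasure
  have hs0 : 0 < s := zero_lt_one.trans_le hs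
  set U : Set (Orthant d) := {x | 1 < supNorm x} with hU
  have hUm : MeasurableSet U := measurableSet_lt_supNorm 1
  have hmeas : Measurable fun x : Orthant d => s⁻¹ • x := measurable_const_smul _
  have hpre : ∀ C : Set (Orthant d), (fun x : Orthant d => s⁻¹ • x) ⁻¹' C = s • C := fun C =>
    setOf_inv_smul_mem hs0 C
  set ν₁ : Measure (Orthant d) := ν.map (fun x => s⁻¹ • x) with hν₁
  have hν₁a : ∀ C, MeasurableSet C → ν₁ C = ν (s • C) := fun C hC => by
    rw [hν₁, Measure.map_apply hmeas hC, hpre]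
  have hfin : IsFiniteMeasure ν₁ := by rw [hν₁]; infer_instance
  suffices h : ν₁.restrict U = (s : ℝ≥0∞)⁻¹ • ν.restrict U by
    have := congrArg (fun γ : Measure (Orthant d) => γ B) h
    simpa [Measure.restrict_apply hB, Set.inter_eq_left.2 hB1, hν₁a B hB] using this
  have hUf : ∀ C : Set (Orthant d), frontier (C ∩ U) ⊆ frontier C ∪ {x | supNorm x = 1} :=
    fun C => (frontier_inter_subset _ _).trans (Set.union_subset_union Set.inter_subset_left
      (Set.inter_subset_right.trans (frontier_supNorm_lt_subset 1)))
  have hsph : s • {x : Orthant d | supNorm x = 1} = {x | supNorm x = s} := by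
    ext x
    rw [Set.mem_smul_set_iff_inv_smul_mem₀ hs0.ne']
    simp only [Set.mem_ofPred_eq, supNorm_smul]
    rw [← div_eq_inv_mul, div_eq_one_iff_eq hs0.ne']
  have hclosed : ∀ F : Set (Orthant d), IsClosed F →
      ν₁.restrict U F = ((s : ℝ≥0∞)⁻¹ • ν.restrict U) F := by
    intro F hF
    -- Closed sets are decreasing limits of thickenings whose boundaries are null for both `ν` and
    -- `ν₁`; there the null-boundary case applies. Closed sets form a generating π-system.
    obtain ⟨rs, hrs, hrs0⟩ := exists_null_frontiers_thickening (ν + ν₁) F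
    have key : ∀ n, ν₁.restrict U (Metric.thickening (rs n) F)
        = (s : ℝ≥0∞)⁻¹ * ν.restrict U (Metric.thickening (rs n) F) := by
      intro n
      set T := Metric.thickening (rs n) F
      have hT : MeasurableSet T := Metric.isOpen_thickening.measurableSet
      have hT0 := (hrs0 n).2
      simp only [Measure.coe_add, Pi.add_apply, add_eq_zero] at hT0
      have h1 : ν (frontier (T ∩ U)) = 0 :=
        measure_mono_null (hUf T) (measure_union_null hT0.1 (measure_sphere_eq_zero hν ha 1))
      have h2 : ν (s • frontier (T ∩ U)) = 0 := by
        refine measure_mono_null (Set.smul_set_mono (hUf T)) ?_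
        rw [Set.smul_set_union, hsph]
        refine measure_union_null ?_ (measure_sphere_eq_zero hν ha s)
        rw [← hν₁a (frontier T) isClosed_frontier.measurableSet]
        exact hT0.2
      have h3 := measureReal_smul_of_null_frontier hν ha hs (hT.inter hUm)
        Set.inter_subset_right h1 h2
      rw [Measure.restrict_apply hT, Measure.restrict_apply hT, hν₁a _ (hT.inter hUm)]
      rw [← ENNReal.toReal_eq_toReal_iff' (measure_ne_top _ _) (ENNReal.mul_ne_top
        (by simpa using hs0.ne') (measure_ne_top _ _)), ENNReal.toReal_mul, ENNReal.toReal_inv,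
        ENNReal.coe_toReal]
      exact h3
    have hrs' : Tendsto rs atTop (𝓝[>] 0) :=
      tendsto_nhdsWithin_iff.2 ⟨hrs, Eventually.of_forall fun n => (hrs0 n).1⟩
    have l1 := (tendsto_measure_thickening_of_isClosed (μ := ν₁.restrict U)
      ⟨1, one_pos, measure_ne_top _ _⟩ hF).comp hrs'
    have l2 := ENNReal.Tendsto.const_mul (a := (s : ℝ≥0∞)⁻¹)
      ((tendsto_measure_thickening_of_isClosed (μ := ν.restrict U)
      ⟨1, one_pos, measure_ne_top _ _⟩ hF).comp hrs') (Or.inr (by simpa using hs0.ne'))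
    exact tendsto_nhds_unique l1 (l2.congr fun n => (key n).symm)
  refine ext_of_generate_finite {F | IsClosed F}
    (BorelSpace.measurable_eq.trans borel_eq_generateFrom_isClosed) isPiSystem_isClosed (fun F hF => hclosed F hF)
    (hclosed _ isClosed_univ)

/-- The exponent measure restricted to the complement of `[0, ε)^d`, as a measure. -/
noncomputable def tailMeasure (ν : Measure (Orthant d)) (ε : ℝ≥0) : Measure (Orthant d) :=
  (ε⁻¹ : ℝ≥0) • ν.map (fun x => ε • x)

instance (ν : Measure (Orthant d)) [IsFiniteMeasure ν] (ε : ℝ≥0) :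
    IsFiniteMeasure (tailMeasure ν ε) := by
  unfold tailMeasure; infer_instance

/-- Homogeneity of `ν` replaces the set-dependent normalising scale by the common scale `ε`. On sets
with norms at least `ε`, `exponentMeasure` is therefore a finite measure. -/
lemma exponentMeasure_eq_tailMeasure [IsProbabilityMeasure μ]
    (hν : IsExceedanceDistribution μ ν) (ha : SecondOrderCondition μ ν a) {ε : ℝ≥0} (hε : 0 < ε)
    {B : Set (Orthant d)} (hB : MeasurableSet B) (hBε : B ⊆ {x | ε ≤ supNorm x}) :
    exponentMeasure ν B = tailMeasure ν ε B := by
  rcases B.eq_empty_or_nonempty with rfl | hne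
  · simp [exponentMeasure]
  have hm : ε ≤ sInf (supNorm '' B) := le_csInf (hne.image _) (by
    rintro _ ⟨x, hx, rfl⟩
    exact hBε hx)
  have hmB : ∀ x ∈ B, sInf (supNorm '' B) ≤ supNorm x := fun x hx =>
    csInf_le (OrderBot.bddBelow _) (Set.mem_image_of_mem _ hx)
  have h1 : tailMeasure ν ε B = (ε : ℝ≥0∞)⁻¹ * ν (ε⁻¹ • B) := by
    rw [tailMeasure, Measure.smul_apply, Measure.map_apply (measurable_const_smul ε) hB]
    have := setOf_inv_smul_mem (inv_pos.2 hε) B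
    rw [inv_inv] at this
    rw [Set.preimage, this, ENNReal.smul_def, ENNReal.coe_inv hε.ne', smul_eq_mul]
  rw [exponentMeasure, h1]
  set m := sInf (supNorm '' B)
  have hm0 : 0 < m := hε.trans_le hm
  set s : ℝ≥0 := m / ε with hs
  have hs1 : 1 ≤ s := (one_le_div hε).2 hm
  have hs0 : 0 < s := zero_lt_one.trans_le hs1
  set C : Set (Orthant d) := m⁻¹ • B with hC
  have hCm : MeasurableSet C := measurableSet_smul_set (inv_pos.2 hm0) hB
  have hC1 : C ⊆ {x | 1 ≤ supNorm x} := by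
    rintro _ ⟨x, hx, rfl⟩
    have := hmB x hx
    simp only [Set.mem_ofPred_eq, supNorm_smul]
    rwa [← div_eq_inv_mul, one_le_div hm0]
  have hBC : ε⁻¹ • B = s • C := by
    rw [hC, smul_smul, hs, div_mul_eq_mul_div, mul_inv_cancel₀ hm0.ne', one_div]
  have hUm : MeasurableSet {x : Orthant d | 1 < supNorm x} := measurableSet_lt_supNorm 1
  -- The normalised set `C` may touch the unit sphere, whereas `measure_smul_eq` needs norms above
  -- one; the part on the sphere is null at every positive scale.
  have hnull : ∀ t : ℝ≥0, 0 < t → ν (t • (C \ {x | 1 < supNorm x})) = 0 := by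
    intro t ht
    refine measure_mono_null ?_ (measure_sphere_eq_zero hν ha t)
    rintro _ ⟨x, ⟨hx1, hx2⟩, rfl⟩
    have : supNorm x = 1 := le_antisymm (not_lt.1 hx2) (hC1 hx1)
    simp [supNorm_smul, this]
  have hinter : ∀ t : ℝ≥0, 0 < t → ν (t • C) = ν (t • (C ∩ {x | 1 < supNorm x})) := by
    intro t ht
    refine le_antisymm ?_ (measure_mono (Set.smul_set_mono Set.inter_subset_left))
    conv_lhs => rw [← Set.inter_union_sdiff C {x | 1 < supNorm x}, Set.smul_set_union]
    refine (measure_union_le _ _).trans ?_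
    rw [hnull t ht, add_zero]
  have hone := hinter 1 one_pos
  rw [one_smul, one_smul] at hone
  rw [hBC, hinter s hs0, measure_smul_eq hν ha hs1 (hCm.inter hUm) Set.inter_subset_right, hone,
    ← mul_assoc, ← ENNReal.coe_inv hε.ne', ← ENNReal.coe_inv hs0.ne', ← ENNReal.coe_mul,
    div_eq_mul_inv, ← ENNReal.coe_inv hm0.ne', mul_comm]
  congr 2
  rw [hs, inv_div]
  field_simp

end Homogeneity

/-! ### The second-order condition, uniformly over scales near `b`. -/

section Bias

variable {d : ℕ} {μ ν : Measure (Orthant d)} {a : ℝ≥0 → ℝ}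

/-- The law of `X / u` on `{x | ε ≤ ‖x‖}`, divided by the probability of `‖X‖ > u`. -/
noncomputable def scaledLaw (μ : Measure (Orthant d)) (u ε : ℝ≥0) : Measure (Orthant d) :=
  (μ.real {x | u < supNorm x})⁻¹.toNNReal •
    (μ.map fun x => u⁻¹ • x).restrict {x | ε ≤ supNorm x}

instance [IsFiniteMeasure μ] (u ε : ℝ≥0) : IsFiniteMeasure (scaledLaw μ u ε) := by
  unfold scaledLaw; infer_instance

lemma scaledLaw_real (u ε : ℝ≥0) {B : Set (Orthant d)} (hB : MeasurableSet B) :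
    (scaledLaw μ u ε).real B = μ.real {x | u⁻¹ • x ∈ B ∩ {x | ε ≤ supNorm x}}
      / μ.real {x | u < supNorm x} := by
  rw [measureReal_def, scaledLaw, Measure.smul_apply, Measure.restrict_apply hB,
    Measure.map_apply (measurable_const_smul _) (hB.inter (measurableSet_le_supNorm ε)),
    ENNReal.smul_def, smul_eq_mul, ENNReal.toReal_mul, ENNReal.coe_toReal,
    Real.coe_toNNReal _ (inv_nonneg.2 measureReal_nonneg), ← div_eq_inv_mul]
  rfl

lemma isClosed_le_supNorm (ε : ℝ≥0) : IsClosed {x : Orthant d | ε ≤ supNorm x} :=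
  isClosed_le continuous_const continuous_supNorm

lemma frontier_subset_of_subset_le {ε : ℝ≥0} {B : Set (Orthant d)} (hB : B ⊆ {x | ε ≤ supNorm x}) :
    frontier B ⊆ {x | ε ≤ supNorm x} :=
  frontier_subset_closure.trans (closure_minimal hB (isClosed_le_supNorm ε))

/-- The condition for one set, recast as a difference of finite measures. Truncation to `ε ≤ ‖x‖`
adds only a piece of a sphere to the boundary, which is null. -/
lemma tendsto_bias_of_null_frontier [IsProbabilityMeasure μ] (hν : IsExceedanceDistribution μ ν)
    (ha : SecondOrderCondition μ ν a) {u : ℕ → ℝ≥0} (hu : Tendsto u atTop atTop) {w : ℕ → ℝ}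
    (hw : Tendsto (fun m => w m * a (u m)) atTop (𝓝 0)) {ε : ℝ≥0} (hε : 0 < ε)
    {B : Set (Orthant d)} (hB : MeasurableSet B) (hB0 : tailMeasure ν ε (frontier B) = 0) :
    Tendsto (fun m => w m * ((scaledLaw μ (u m) ε).real B
      - ((tailMeasure ν ε).restrict {x | ε ≤ supNorm x}).real B)) atTop (𝓝 0) := by
  set Q : Set (Orthant d) := {x | ε ≤ supNorm x} with hQ
  have hBQ : MeasurableSet (B ∩ Q) := hB.inter (measurableSet_le_supNorm ε)
  have hfr : frontier (B ∩ Q) ⊆ Q := frontier_subset_of_subset_le Set.inter_subset_right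
  have hs : tailMeasure ν ε {x | supNorm x = ε} = 0 := by
    rw [← exponentMeasure_eq_tailMeasure hν ha hε
      (measurableSet_eq_fun measurable_supNorm measurable_const) fun x hx => hx.ge]
    exact exponentMeasure_eq_zero_of_subset_sphere hν hε subset_rfl
  have h0 : exponentMeasure ν (frontier (B ∩ Q)) = 0 := by
    rw [exponentMeasure_eq_tailMeasure hν ha hε isClosed_frontier.measurableSet hfr]
    refine measure_mono_null (frontier_inter_subset _ _) (measure_union_null
      (measure_mono_null Set.inter_subset_left hB0) (measure_mono_null ?_ hs))
    exact Set.inter_subset_right.trans (frontier_le_supNorm_subset ε)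
  have h1 := (ha.isBigO ε hε _ hBQ Set.inter_subset_right h0).comp_tendsto hu
  have h2 := ((Asymptotics.isBigO_refl w atTop).mul h1).trans_tendsto hw
  refine h2.congr fun m => ?_
  rw [scaledLaw_real _ _ hB, exponentMeasure_eq_tailMeasure hν ha hε hBQ Set.inter_subset_right,
    measureReal_def (μ := (tailMeasure ν ε).restrict Q), Measure.restrict_apply hB]
  rfl

lemma smul_subset_le_supNorm {ε s t : ℝ≥0} (hst : s ≤ t) {B : Set (Orthant d)}
    (hB : B ⊆ {x | ε ≤ supNorm x}) : t • B ⊆ {x | ε * s ≤ supNorm x} := by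
  rintro _ ⟨x, hx, rfl⟩
  simp only [Set.mem_ofPred_eq, supNorm_smul]
  rw [mul_comm]
  exact mul_le_mul' hst (hB hx)

/-- Every union of code cells has null boundary, so the bias vanishes on each of them, hence
uniformly, hence along the moving unions `t m • A`. The bound `b / 2 ≤ t m` keeps all of these sets
outside a common neighbourhood of the origin. -/
lemma tendsto_bias_of_seq [IsProbabilityMeasure μ] (hν : IsExceedanceDistribution μ ν)
    (ha : SecondOrderCondition μ ν a) {u : ℕ → ℝ≥0} (hu : Tendsto u atTop atTop) {w : ℕ → ℝ}
    (hw : Tendsto (fun m => w m * a (u m)) atTop (𝓝 0)) {ε : ℝ≥0} (hε : 0 < ε)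
    {A : Set (Orthant d)} (hA : MeasurableSet A) (hAε : A ⊆ {x | ε ≤ supNorm x})
    (hA0 : exponentMeasure ν (frontier A) = 0) {b : ℝ≥0} (hb : 0 < b) {t : ℕ → ℝ≥0}
    (ht : Tendsto t atTop (𝓝 b)) (htb : ∀ m, b / 2 ≤ t m)
    (hL : ∀ x : Orthant d, (∀ᶠ m in atTop, (t m)⁻¹ • x ∈ A) ∨ ∀ᶠ m in atTop, (t m)⁻¹ • x ∉ A) :
    Tendsto (fun m => w m * (μ.real (u m • t m • A) / μ.real {x | u m < supNorm x}
      - (exponentMeasure ν A).toReal / t m)) atTop (𝓝 0) := by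
  have hνp := hν.isProbabilityMeasure
  have hb2 : 0 < b / 2 := half_pos hb
  set η : ℝ≥0 := ε * (b / 2) with hη
  have hη0 : 0 < η := mul_pos hε hb2
  have hnull : ∀ s : ℝ≥0, b / 2 ≤ s → tailMeasure ν η {x | s⁻¹ • x ∈ frontier A} = 0 := by
    intro s hs
    have hs0 : 0 < s := hb2.trans_le hs
    rw [setOf_inv_smul_mem hs0, ← exponentMeasure_eq_tailMeasure hν ha hη0
      (measurableSet_smul_set hs0 isClosed_frontier.measurableSet)
      (smul_subset_le_supNorm hs (frontier_subset_of_subset_le hAε)), exponentMeasure_smul ν hs0,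
      hA0, ENNReal.zero_div]
  have hcode : ∀ S, Tendsto (fun m => w m * ((scaledLaw μ (u m) η).real (rayCode A t ⁻¹' S)
      - ((tailMeasure ν η).restrict {x | η ≤ supNorm x}).real (rayCode A t ⁻¹' S)))
      atTop (𝓝 0) := by
    intro S
    refine tendsto_bias_of_null_frontier hν ha hu hw hη0
      (measurable_rayCode hA hL MeasurableSet.of_discrete) ?_
    refine measure_mono_null (frontier_rayCode_preimage_subset hb ht hL S) (measure_union_null
      (hnull b (half_le_self hb.le)) (measure_iUnion_null fun m => hnull (t m) (htb m)))
  have := tendsto_zero_of_tendsto_on_coded_sets (fun m => scaledLaw μ (u m) η)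
    (fun _ => (tailMeasure ν η).restrict {x | η ≤ supNorm x}) w (measurable_rayCode hA hL) hcode
    (fun m => {c | m ∉ c.1 ↔ c.2 = true})
  refine this.congr' ?_
  filter_upwards [hu.eventually (eventually_gt_atTop 0)] with m hm
  have htm : 0 < t m := hb2.trans_le (htb m)
  have hsub : t m • A ⊆ {x | η ≤ supNorm x} := smul_subset_le_supNorm (htb m) hAε
  have hmeas : MeasurableSet (t m • A) := measurableSet_smul_set htm hA
  rw [rayCode_preimage hL, setOf_inv_smul_mem htm, scaledLaw_real _ _ hmeas,
    measureReal_def (μ := (tailMeasure ν η).restrict _), Measure.restrict_apply hmeas,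
    Set.inter_eq_left.2 hsub, ← exponentMeasure_eq_tailMeasure hν ha hη0 hmeas hsub,
    exponentMeasure_smul ν htm, setOf_inv_smul_mem hm, ENNReal.toReal_div, ENNReal.coe_toReal]

/-- The second-order condition holds uniformly over the sets `t • A`, `t` close to `b`. -/
theorem tendsto_bias [IsProbabilityMeasure μ] (hν : IsExceedanceDistribution μ ν)
    (ha : SecondOrderCondition μ ν a) {u : ℕ → ℝ≥0} (hu : Tendsto u atTop atTop) {w : ℕ → ℝ}
    (hw : Tendsto (fun m => w m * a (u m)) atTop (𝓝 0)) {ε : ℝ≥0} (hε : 0 < ε)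
    {A : Set (Orthant d)} (hA : MeasurableSet A) (hAε : A ⊆ {x | ε ≤ supNorm x})
    (hAL : HasRayLimits A) (hA0 : exponentMeasure ν (frontier A) = 0) {b : ℝ≥0} (hb : 0 < b) :
    Tendsto (fun z : ℕ × ℝ≥0 => w z.1 * (μ.real (u z.1 • z.2 • A) / μ.real {x | u z.1 < supNorm x}
      - (exponentMeasure ν A).toReal / z.2)) (atTop ×ˢ 𝓝 b) (𝓝 0) := by
  -- Applied to `𝓝[<] b`, `pure b` and `𝓝[>] b`, which together make up `𝓝 b`. Each is countably
  -- generated, so sequences suffice, and along each the ray memberships stabilise.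
  have key : ∀ l : Filter ℝ≥0, l ≤ 𝓝 b → l.IsCountablyGenerated →
      (∀ x : Orthant d, (∀ᶠ t in l, t⁻¹ • x ∈ A) ∨ ∀ᶠ t in l, t⁻¹ • x ∉ A) →
      Tendsto (fun z : ℕ × ℝ≥0 => w z.1 * (μ.real (u z.1 • z.2 • A) /
        μ.real {x | u z.1 < supNorm x} - (exponentMeasure ν A).toReal / z.2)) (atTop ×ˢ l) (𝓝 0) := by
    intro l hl _ hlL
    refine tendsto_of_seq_tendsto fun z hz => ?_
    have hz1 : Tendsto (fun m => (z m).1) atTop atTop := tendsto_fst.comp hz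
    have hz2 : Tendsto (fun m => (z m).2) atTop l := tendsto_snd.comp hz
    obtain ⟨M, hM⟩ := eventually_atTop.1 ((hz2.mono_right hl).eventually
      (lt_mem_nhds (half_lt_self hb)))
    rw [← tendsto_add_atTop_iff_nat M]
    have hs := tendsto_add_atTop_nat M
    refine tendsto_bias_of_seq hν ha (u := fun m => u (z (m + M)).1) (w := fun m => w (z (m + M)).1)
      (t := fun m => (z (m + M)).2)
      (hu.comp (hz1.comp hs)) (hw.comp (hz1.comp hs)) hε hA hAε hA0 hb
      ((hz2.mono_right hl).comp hs) (fun m => (hM _ (Nat.le_add_left _ _)).le) fun x => ?_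
    exact (hlL x).imp (fun h => (hz2.comp hs).eventually h) fun h => (hz2.comp hs).eventually h
  have h1 := key (𝓝[<] b) nhdsWithin_le_nhds inferInstance fun x => hAL.left x b hb
  have h2 := key (𝓝[>] b) nhdsWithin_le_nhds inferInstance fun x => hAL.right x b hb
  have h3 := key (pure b) (pure_le_nhds b) inferInstance fun x => by
    simpa using em _
  have : 𝓝 b = 𝓝[<] b ⊔ pure b ⊔ 𝓝[>] b := by
    rw [sup_assoc, sup_comm, sup_assoc, ← nhdsNE_sup_pure b, ← nhdsLT_sup_nhdsGT, sup_comm (𝓝[<] b)]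
    ac_rfl
  rw [this, prod_sup, prod_sup]
  exact (h1.sup h3).sup h2

end Bias

/-! ### Limiting cell probabilities. -/

section Partition

variable {d K : ℕ} {μ ν : Measure (Orthant d)} {a : ℝ≥0 → ℝ} {r : Orthant d → ℝ≥0}
  {A : Fin K → Set (Orthant d)}

lemma smul_exceedanceSet (hr : IsRiskFunctional r) {u : ℝ≥0} (hu : 0 < u) :
    u • exceedanceSet r = {x | u < r x} := by
  ext x
  rw [Set.mem_smul_set_iff_inv_smul_mem₀ hu.ne']
  simp only [exceedanceSet, Set.mem_ofPred_eq, hr.homogeneous _ _ (inv_pos.2 hu)]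
  rw [← div_eq_inv_mul, one_lt_div hu]

lemma measurableSet_exceedance (hr : IsRiskFunctional r) (u : ℝ≥0) :
    MeasurableSet {x | u < r x} := measurableSet_lt measurable_const hr.measurable

lemma IsAdmissiblePartition.measurableSet (hA : IsAdmissiblePartition r A) (j : Fin K) :
    MeasurableSet (A j) := measurableSet_of_mem_generateSetAlgebra (hA.mem_algebra j)

lemma IsAdmissiblePartition.subset (hA : IsAdmissiblePartition r A) (j : Fin K) :
    A j ⊆ exceedanceSet r := hA.iUnion_eq ▸ Set.subset_iUnion A j

lemma IsAdmissiblePartition.smul_subset (hr : IsRiskFunctional r) (hA : IsAdmissiblePartition r A)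
    (j : Fin K) {u : ℝ≥0} (hu : 0 < u) : u • A j ⊆ {x | u < r x} :=
  smul_exceedanceSet hr hu ▸ Set.smul_set_mono (hA.subset j)

lemma IsAdmissiblePartition.sum_real_smul [IsFiniteMeasure μ] (hr : IsRiskFunctional r)
    (hA : IsAdmissiblePartition r A) {u : ℝ≥0} (hu : 0 < u) :
    ∑ j, μ.real (u • A j) = μ.real {x | u < r x} := by
  rw [← smul_exceedanceSet hr hu, ← hA.iUnion_eq, Set.smul_set_iUnion,
    measureReal_iUnion_fintype _ fun j => measurableSet_smul_set hu (hA.measurableSet j)]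
  intro i j hij
  refine Set.disjoint_left.2 fun x hx hx' => ?_
  rw [Set.mem_smul_set_iff_inv_smul_mem₀ hu.ne'] at hx hx'
  exact Set.disjoint_left.1 (hA.disjoint hij) hx hx'

lemma condProb_eq (hr : IsRiskFunctional r) (hA : IsAdmissiblePartition r A) (j : Fin K)
    {u : ℝ≥0} (hu : 0 < u) :
    condProb μ r (A j) u = μ.real (u • A j) / μ.real {x | u < r x} := by
  rw [condProb, measureReal_def, cond_apply (measurableSet_exceedance hr u), ENNReal.toReal_mul,
    ENNReal.toReal_inv, Set.inter_eq_right.2 (hA.smul_subset hr j hu), ← div_eq_inv_mul]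
  rfl

lemma sum_exponentMeasure [IsProbabilityMeasure μ] (hν : IsExceedanceDistribution μ ν)
    (ha : SecondOrderCondition μ ν a) (hr : IsRiskFunctional r) (hA : IsAdmissiblePartition r A) :
    exponentMeasure ν (exceedanceSet r) = ∑ j, exponentMeasure ν (A j) ∧
      ∀ j, exponentMeasure ν (A j) ≠ ∞ := by
  have := hν.isProbabilityMeasure
  obtain ⟨ε, hε, hε'⟩ := hr.bounded_away
  have h1 : ∀ j, exponentMeasure ν (A j) = tailMeasure ν ε (A j) := fun j =>
    exponentMeasure_eq_tailMeasure hν ha hε (hA.measurableSet j)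
      fun x hx => hε' x (hA.subset j hx)
  constructor
  · rw [exponentMeasure_eq_tailMeasure hν ha hε (B := exceedanceSet r)
      (measurableSet_exceedance hr 1) fun x hx => hε' x hx, ← hA.iUnion_eq,
      measure_iUnion hA.disjoint hA.measurableSet, tsum_fintype]
    exact Finset.sum_congr rfl fun j _ => (h1 j).symm
  · intro j
    rw [h1]
    exact measure_ne_top _ _

/-- The exponent measure of `Ω_r`. -/
noncomputable def exceedanceMass (ν : Measure (Orthant d)) (r : Orthant d → ℝ≥0) : ℝ≥0 :=
  (exponentMeasure ν (exceedanceSet r)).toNNReal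

lemma sum_exponentMeasure_toReal [IsProbabilityMeasure μ] (hν : IsExceedanceDistribution μ ν)
    (ha : SecondOrderCondition μ ν a) (hr : IsRiskFunctional r) (hA : IsAdmissiblePartition r A) :
    ∑ j, (exponentMeasure ν (A j)).toReal = exceedanceMass ν r := by
  obtain ⟨h1, h2⟩ := sum_exponentMeasure hν ha hr hA
  rw [exceedanceMass, h1, ENNReal.coe_toNNReal_eq_toReal, ENNReal.toReal_sum fun j _ => h2 j]

lemma exceedanceMass_pos [IsProbabilityMeasure μ] (hν : IsExceedanceDistribution μ ν)
    (ha : SecondOrderCondition μ ν a) (hr : IsRiskFunctional r) (hA : IsAdmissiblePartition r A)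
    (hpos : 0 < exponentMeasure ν (exceedanceSet r)) : 0 < exceedanceMass ν r := by
  obtain ⟨h1, h2⟩ := sum_exponentMeasure hν ha hr hA
  refine ENNReal.toNNReal_pos hpos.ne' ?_
  rw [h1]
  exact (ENNReal.sum_lt_top.2 fun j _ => (h2 j).lt_top).ne

/-- A single Pareto margin is unbounded, so the tail never vanishes. The Pareto form of the margins
enters nowhere else. -/
lemma tail_pos (hpar : HasParetoMargins μ) [IsFiniteMeasure μ] (hd : 0 < d) (u : ℝ≥0) :
    0 < μ.real {x | u < supNorm x} := by
  have h1 := hpar ⟨0, hd⟩ (max u 1) (le_max_right _ _)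
  have h2 : μ.real {x | max u 1 < x ⟨0, hd⟩} ≤ μ.real {x | u < supNorm x} :=
    measureReal_mono fun x hx => (le_max_left _ _).trans_lt
      (lt_of_lt_of_le (show max u 1 < x ⟨0, hd⟩ from hx) (Finset.le_sup (Finset.mem_univ _)))
  refine lt_of_lt_of_le ?_ h2
  rw [h1]
  have : (0 : ℝ) < (max u 1 : ℝ≥0) := by
    exact_mod_cast zero_lt_one.trans_le (le_max_right u 1)
  positivity

/-- The limiting conditional cell probabilities. -/
theorem tendsto_condProb [IsProbabilityMeasure μ] (hpar : HasParetoMargins μ)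
    (hν : IsExceedanceDistribution μ ν)
    (ha : SecondOrderCondition μ ν a) (hr : IsRiskFunctional r) (hA : IsAdmissiblePartition r A)
    (hbd : ∀ j, exponentMeasure ν (frontier (A j)) = 0)
    (hpos : 0 < exponentMeasure ν (exceedanceSet r)) (j : Fin K) :
    Tendsto (condProb μ r (A j)) atTop
      (𝓝 ((exponentMeasure ν (A j)).toReal / exceedanceMass ν r)) := by
  obtain ⟨ε, hε, hε'⟩ := hr.bounded_away
  have h1 : ∀ i, Tendsto (fun u : ℝ≥0 => μ.real (u • A i) / μ.real {x | u < supNorm x}) atTop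
      (𝓝 (exponentMeasure ν (A i)).toReal) := fun i =>
    ha.tendsto hε (hA.measurableSet i) (fun x hx => hε' x (hA.subset i hx)) (hbd i)
  have h2 := tendsto_finsetSum Finset.univ fun i _ => h1 i
  rw [sum_exponentMeasure_toReal hν ha hr hA] at h2
  have hb := exceedanceMass_pos hν ha hr hA hpos
  refine ((h1 j).div h2 (by exact_mod_cast hb.ne')).congr' ?_
  filter_upwards [eventually_gt_atTop 0] with u hu
  rw [Pi.div_apply, condProb_eq hr hA j hu, ← Finset.sum_div, hA.sum_real_smul hr hu, div_div_div_cancel_right₀]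
  exact (tail_pos hpar hν.dim_pos u).ne'

end Partition

/-! ### The tail quantile `U(t)`. -/

section Threshold

variable {d : ℕ} {μ ν : Measure (Orthant d)} {a : ℝ≥0 → ℝ}

lemma tendsto_tail_zero [IsFiniteMeasure μ] :
    Tendsto (fun n : ℕ => μ.real {x : Orthant d | (n : ℝ≥0) < supNorm x}) atTop (𝓝 0) := by
  have h := tendsto_measure_iInter_atTop (μ := μ) (s := fun n : ℕ => {x : Orthant d | (n : ℝ≥0) < supNorm x})
    (fun n => (measurableSet_lt_supNorm _).nullMeasurableSet)
    (fun m n hmn x (hx : (n : ℝ≥0) < supNorm x) =>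
      show (m : ℝ≥0) < supNorm x from lt_of_le_of_lt (by exact_mod_cast hmn) hx) ⟨0, measure_ne_top _ _⟩
  have h0 : ⋂ n : ℕ, {x : Orthant d | (n : ℝ≥0) < supNorm x} = ∅ := by
    ext x
    simp only [Set.mem_iInter, Set.mem_ofPred_eq, Set.mem_empty_iff_false, iff_false, not_forall,
      not_lt]
    exact exists_nat_ge _
  rw [h0, measure_empty] at h
  have h2 := (ENNReal.tendsto_toReal ENNReal.zero_ne_top).comp h
  rw [ENNReal.toReal_zero] at h2
  exact h2

lemma tail_antitone [IsFiniteMeasure μ] :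
    Antitone fun u : ℝ≥0 => μ.real {x : Orthant d | u < supNorm x} := fun _ _ h =>
  measureReal_mono fun _ hx => h.trans_lt hx

lemma tailQuantile_set_nonempty [IsFiniteMeasure μ] {t : ℝ} (ht : 0 < t) :
    {u : ℝ≥0 | μ.real {x : Orthant d | u < supNorm x} ≤ 1 / t}.Nonempty := by
  obtain ⟨n, hn⟩ := ((tendsto_tail_zero (μ := μ)).eventually
    (gt_mem_nhds (one_div_pos.2 ht))).exists
  exact ⟨n, hn.le⟩

/-- The tail function is right-continuous, so the infimum defining the quantile is attained. -/
lemma tail_tailQuantile_le [IsFiniteMeasure μ] {t : ℝ} (ht : 0 < t) :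
    μ.real {x | tailQuantile μ t < supNorm x} ≤ 1 / t := by
  set u := tailQuantile μ t with hu
  have hmeas : Tendsto (fun n : ℕ => μ {x : Orthant d | u + ((n : ℝ≥0) + 1)⁻¹ < supNorm x}) atTop
      (𝓝 (μ (⋃ n : ℕ, {x : Orthant d | u + ((n : ℝ≥0) + 1)⁻¹ < supNorm x}))) := by
    refine tendsto_measure_iUnion_atTop fun m n hmn x hx => ?_
    simp only [Set.mem_ofPred_eq] at hx ⊢
    refine lt_of_le_of_lt ?_ hx
    gcongr
  have hun : ⋃ n : ℕ, {x : Orthant d | u + ((n : ℝ≥0) + 1)⁻¹ < supNorm x} = {x | u < supNorm x} := by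
    ext x
    simp only [Set.mem_iUnion, Set.mem_ofPred_eq]
    constructor
    · rintro ⟨n, hn⟩
      exact lt_of_le_of_lt le_self_add hn
    · intro hx
      obtain ⟨n, hn⟩ := exists_nat_gt (supNorm x - u)⁻¹
      refine ⟨n, ?_⟩
      have h1 : 0 < supNorm x - u := tsub_pos_of_lt hx
      have h2 : ((n : ℝ≥0) + 1)⁻¹ < supNorm x - u := by
        rw [inv_lt_comm₀ (by positivity) h1]
        exact hn.trans (lt_add_one _)
      rw [add_comm]
      exact lt_tsub_iff_right.1 h2
  rw [hun] at hmeas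
  refine le_of_tendsto ((ENNReal.tendsto_toReal (measure_ne_top _ _)).comp hmeas)
    (Eventually.of_forall fun n => ?_)
  have h1 : sInf {u : ℝ≥0 | μ.real {x : Orthant d | u < supNorm x} ≤ 1 / t} < u + ((n : ℝ≥0) + 1)⁻¹ :=
    lt_add_of_pos_right _ (by positivity)
  obtain ⟨v, hv, hvu⟩ := exists_lt_of_csInf_lt (tailQuantile_set_nonempty ht) h1
  exact (tail_antitone hvu.le).trans hv

lemma lt_tail_of_lt_tailQuantile {t : ℝ} {u : ℝ≥0} (h : u < tailQuantile μ t) :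
    1 / t < μ.real {x | u < supNorm x} := by
  by_contra h'
  have h1 : u ∈ {u : ℝ≥0 | μ.real {x | u < supNorm x} ≤ 1 / t} := not_lt.1 h'
  exact absurd (csInf_le (OrderBot.bddBelow _) h1) (not_le.2 h)

lemma tendsto_tailQuantile_atTop [IsFiniteMeasure μ] (hpos : ∀ u, 0 < μ.real {x | u < supNorm x})
    {T : ℕ → ℝ} (hT : Tendsto T atTop atTop) :
    Tendsto (fun n => tailQuantile μ (T n)) atTop atTop := by
  refine tendsto_atTop.2 fun c => ?_
  filter_upwards [hT.eventually_gt_atTop (μ.real {x | c < supNorm x})⁻¹,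
    hT.eventually_gt_atTop 0] with n hn hn0
  refine le_csInf (tailQuantile_set_nonempty hn0) fun v hv => ?_
  by_contra hvc
  have h1 := (tail_antitone (not_le.1 hvc).le).trans hv
  rw [inv_lt_comm₀ (hpos c) hn0, ← one_div] at hn
  exact absurd (show μ.real {x | c < supNorm x} ≤ 1 / T n from h1) (not_le.2 hn)

/-- `P(‖X‖ > U(t)) ∼ 1 / t`. -/
lemma tendsto_mul_tail_tailQuantile [IsFiniteMeasure μ] (hν : IsExceedanceDistribution μ ν)
    (ha : SecondOrderCondition μ ν a) (hpos : ∀ u, 0 < μ.real {x | u < supNorm x})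
    {T : ℕ → ℝ} (hT : Tendsto T atTop atTop) :
    Tendsto (fun n => T n * μ.real {x | tailQuantile μ (T n) < supNorm x}) atTop (𝓝 1) := by
  have hu := tendsto_tailQuantile_atTop hpos hT
  rw [tendsto_order]
  constructor
  · intro c hc
    rcases le_or_gt c 0 with hc0 | hc0
    · filter_upwards [hT.eventually_gt_atTop 0] with n hn
      exact hc0.trans_lt (mul_pos hn (hpos _))
    -- The tail may jump at the quantile `U`, but at `s * U` it is still above `1 / T`. Regular
    -- variation returns to `U` at the cost of a factor close to `1 / s < 1 / c`.
    obtain ⟨s, hcs, hs⟩ := exists_between hc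
    have hs0 := hc0.trans hcs
    lift s to ℝ≥0 using hs0.le
    have hlim := (tendsto_tail_ratio hν ha (s := s) (by exact_mod_cast hs0)).comp hu
    have hlt : (s : ℝ)⁻¹ < c⁻¹ := (inv_lt_inv₀ hs0 hc0).2 hcs
    filter_upwards [hT.eventually_gt_atTop 0, hlim.eventually (gt_mem_nhds hlt),
      hu.eventually (eventually_gt_atTop 0)] with n hn h1 h2
    have h3 : tailQuantile μ (T n) * s < tailQuantile μ (T n) :=
      mul_lt_of_lt_one_right h2 (by exact_mod_cast hs)
    have h4 := lt_tail_of_lt_tailQuantile h3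
    simp only [Function.comp_apply] at h1
    rw [div_lt_iff₀ (hpos _)] at h1
    have h5 := h4.trans h1
    rw [div_lt_iff₀ hn, inv_mul_eq_div, div_mul_eq_mul_div, lt_div_iff₀ hc0] at h5
    linarith
  · intro c hc
    filter_upwards [hT.eventually_gt_atTop 0] with n hn
    have := tail_tailQuantile_le (μ := μ) hn
    rw [le_div_iff₀ hn] at this
    linarith

end Threshold

/-! ### Uniform bias and atom bounds near the intermediate threshold. -/

section Uniform

variable {d K : ℕ} {μ ν : Measure (Orthant d)} {a : ℝ≥0 → ℝ} {r : Orthant d → ℝ≥0}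
  {A : Fin K → Set (Orthant d)}

lemma eventually_pos_of_nhds {b : ℝ≥0} (hb : 0 < b) {u : ℕ → ℝ≥0} (hu : Tendsto u atTop atTop) :
    ∀ᶠ z : ℕ × ℝ≥0 in atTop ×ˢ 𝓝 b, 0 < u z.1 ∧ 0 < z.2 :=
  (hu.eventually (eventually_gt_atTop 0)).prod_mk (lt_mem_nhds hb)

/-- Uniform second-order bound for the cells `A j`. -/
lemma tendsto_cell_bias [IsProbabilityMeasure μ] (hν : IsExceedanceDistribution μ ν)
    (ha : SecondOrderCondition μ ν a) (hr : IsRiskFunctional r) (hA : IsAdmissiblePartition r A)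
    (hbd : ∀ j, exponentMeasure ν (frontier (A j)) = 0)
    {u : ℕ → ℝ≥0} (hu : Tendsto u atTop atTop) {w : ℕ → ℝ}
    (hw : Tendsto (fun m => w m * a (u m)) atTop (𝓝 0)) {b : ℝ≥0} (hb : 0 < b) (j : Fin K) :
    Tendsto (fun z : ℕ × ℝ≥0 => w z.1 * (μ.real ((u z.1 * z.2) • A j) /
      μ.real {x | u z.1 < supNorm x} - (exponentMeasure ν (A j)).toReal / z.2))
      (atTop ×ˢ 𝓝 b) (𝓝 0) := by
  obtain ⟨ε, hε, hε'⟩ := hr.bounded_away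
  simp_rw [← smul_smul]
  exact tendsto_bias hν ha hu hw hε (hA.measurableSet j) (fun x hx => hε' x (hA.subset j hx))
    (hasRayLimits_of_mem_generateSetAlgebra (hA.mem_algebra j)) (hbd j) hb

lemma tendsto_exceedance_bias [IsProbabilityMeasure μ] (hν : IsExceedanceDistribution μ ν)
    (ha : SecondOrderCondition μ ν a) (hr : IsRiskFunctional r) (hA : IsAdmissiblePartition r A)
    (hbd : ∀ j, exponentMeasure ν (frontier (A j)) = 0)
    {u : ℕ → ℝ≥0} (hu : Tendsto u atTop atTop) {w : ℕ → ℝ}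
    (hw : Tendsto (fun m => w m * a (u m)) atTop (𝓝 0)) {b : ℝ≥0} (hb : 0 < b) :
    Tendsto (fun z : ℕ × ℝ≥0 => w z.1 * (μ.real {x | u z.1 * z.2 < r x} /
      μ.real {x | u z.1 < supNorm x} - exceedanceMass ν r / z.2))
      (atTop ×ˢ 𝓝 b) (𝓝 0) := by
  have h := tendsto_finsetSum Finset.univ fun j _ => tendsto_cell_bias hν ha hr hA hbd hu hw hb j
  simp only [Finset.sum_const_zero] at h
  refine h.congr' ?_
  filter_upwards [eventually_pos_of_nhds hb hu] with z hz
  rw [← Finset.mul_sum, Finset.sum_sub_distrib, ← Finset.sum_div, ← Finset.sum_div,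
    hA.sum_real_smul hr (mul_pos hz.1 hz.2), sum_exponentMeasure_toReal hν ha hr hA]

/-- Conditional cell probabilities given an exceedance of a threshold close to `b u_n` converge
faster than the weights. -/
theorem tendsto_condProb_bias [IsProbabilityMeasure μ] (hpar : HasParetoMargins μ)
    (hν : IsExceedanceDistribution μ ν)
    (ha : SecondOrderCondition μ ν a) (hr : IsRiskFunctional r) (hA : IsAdmissiblePartition r A)
    (hbd : ∀ j, exponentMeasure ν (frontier (A j)) = 0)
    (hpos : 0 < exponentMeasure ν (exceedanceSet r))
    {u : ℕ → ℝ≥0} (hu : Tendsto u atTop atTop) {w : ℕ → ℝ}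
    (hw : Tendsto (fun m => w m * a (u m)) atTop (𝓝 0)) (j : Fin K) :
    Tendsto (fun z : ℕ × ℝ≥0 => w z.1 * (condProb μ r (A j) (u z.1 * z.2)
      - (exponentMeasure ν (A j)).toReal / exceedanceMass ν r))
      (atTop ×ˢ 𝓝 (exceedanceMass ν r)) (𝓝 0) := by
  set b := exceedanceMass ν r with hb'
  set e := (exponentMeasure ν (A j)).toReal with he
  have hb : 0 < b := exceedanceMass_pos hν ha hr hA hpos
  have hbR : (b : ℝ) ≠ 0 := by exact_mod_cast hb.ne'
  have h1 := tendsto_cell_bias hν ha hr hA hbd hu hw hb j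
  have h2 := tendsto_exceedance_bias hν ha hr hA hbd hu hw hb
  have h3 := tendsto_exceedance_bias hν ha hr hA hbd hu (w := fun _ => 1)
    (by simpa using (show Tendsto (fun m => a (u m)) atTop (𝓝 0) from ha.tendsto_zero.comp hu)) hb
  have hz2 : Tendsto (fun z : ℕ × ℝ≥0 => (b : ℝ) / z.2) (atTop ×ˢ 𝓝 b) (𝓝 1) := by
    have : Tendsto (fun z : ℕ × ℝ≥0 => (z.2 : ℝ)) (atTop ×ˢ 𝓝 b) (𝓝 b) :=
      (NNReal.continuous_coe.tendsto b).comp tendsto_snd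
    simpa [hbR, Pi.div_def] using (tendsto_const_nhds (x := (b : ℝ))).div this hbR
  have h4 : Tendsto (fun z : ℕ × ℝ≥0 => μ.real {x | u z.1 * z.2 < r x} /
      μ.real {x | u z.1 < supNorm x}) (atTop ×ˢ 𝓝 b) (𝓝 1) := by
    refine (h3.add hz2).congr (fun z => ?_) |>.trans (by simp)
    ring
  -- The main terms are `e / z` for the cell and `b / z` for all exceedances. In the numerator of
  -- `condProb - e / b` they cancel for every `z`, leaving a combination of the two biases, so no
  -- convergence rate for the threshold is needed.
  have h5 := (h1.sub (h2.mul_const (e / b))).div h4 one_ne_zero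
  simp only [zero_mul, sub_zero, zero_div] at h5
  refine h5.congr' ?_
  filter_upwards [eventually_pos_of_nhds hb hu, h4.eventually (lt_mem_nhds one_pos)] with z hz hz4
  have hV := tail_pos hpar hν.dim_pos (u z.1)
  have hS : μ.real {x | u z.1 * z.2 < r x} ≠ 0 := by
    intro h
    rw [h] at hz4
    simp at hz4
  have hz20 : (z.2 : ℝ) ≠ 0 := by exact_mod_cast hz.2.ne'
  rw [Pi.div_apply, condProb_eq hr hA j (mul_pos hz.1 hz.2), ← hb', ← he]
  field_simp
  ring

/-- The law of `r(X)` has asymptotically negligible atoms close to `b u_n`. -/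
theorem tendsto_atom [IsProbabilityMeasure μ] (hν : IsExceedanceDistribution μ ν)
    (ha : SecondOrderCondition μ ν a) (hr : IsRiskFunctional r) (hA : IsAdmissiblePartition r A)
    (hbd : ∀ j, exponentMeasure ν (frontier (A j)) = 0)
    {u : ℕ → ℝ≥0} (hu : Tendsto u atTop atTop) {w : ℕ → ℝ}
    (hw0 : ∀ n, 0 ≤ w n)
    (hw : Tendsto (fun m => w m * a (u m)) atTop (𝓝 0)) {b : ℝ≥0} (hb : 0 < b) :
    Tendsto (fun z : ℕ × ℝ≥0 => w z.1 * (μ.real {x | r x = u z.1 * z.2} /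
      μ.real {x | u z.1 < supNorm x})) (atTop ×ˢ 𝓝 b) (𝓝 0) := by
  have h := tendsto_exceedance_bias hν ha hr hA hbd hu hw hb
  rw [Metric.tendsto_nhds] at h ⊢
  intro δ hδ
  obtain ⟨pa, hpa, pb, hpb, hab⟩ := eventually_prod_iff.1 (h (δ / 4) (by positivity))
  have hpb' : ∀ᶠ t in 𝓝 b, (∀ᶠ s in 𝓝 t, pb s) ∧ 0 < t := hpb.eventually_nhds.and (lt_mem_nhds hb)
  filter_upwards [(hpa.and (hu.eventually (eventually_gt_atTop 0))).prod_mk hpb'] with ⟨n, t⟩ ⟨⟨hn, hun⟩, ht, ht0⟩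
  simp only at hn hun ht ht0 ⊢
  -- An atom at level `t` is at most the difference of the exceedance probabilities at `s < t` and
  -- at `t`. Each is approximated to within `δ / 4`, and the difference of the main terms vanishes
  -- as `s` increases to `t`.
  have hbound : ∀ᶠ s : ℝ≥0 in 𝓝[<] t, w n * (μ.real {x | r x = u n * t} / μ.real {x | u n < supNorm x})
      ≤ w n * (exceedanceMass ν r / (s : ℝ) - exceedanceMass ν r / (t : ℝ)) + δ / 2 := by
    filter_upwards [nhdsWithin_le_nhds ht, self_mem_nhdsWithin] with s hs hst
    have h1 := hab hn hs
    have h2 := hab hn ht.self_of_nhds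
    simp only [Real.dist_eq, sub_zero] at h1 h2
    have h3 : μ.real {x | r x = u n * t} ≤ μ.real {x | u n * s < r x} - μ.real {x | u n * t < r x} := by
      have hsub : {x | u n * t < r x} ⊆ {x | u n * s < r x} := fun x hx =>
        (mul_le_mul_right (le_of_lt hst) (u n)).trans_lt hx
      rw [← measureReal_sdiff hsub (measurableSet_exceedance hr _)]
      refine measureReal_mono fun x hx => ?_
      simp only [Set.mem_ofPred_eq, Set.mem_sdiff] at hx ⊢
      rw [hx]
      exact ⟨mul_lt_mul_of_pos_left hst hun, lt_irrefl _⟩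
    have h4 : μ.real {x | r x = u n * t} / μ.real {x | u n < supNorm x}
        ≤ μ.real {x | u n * s < r x} / μ.real {x | u n < supNorm x}
          - μ.real {x | u n * t < r x} / μ.real {x | u n < supNorm x} := by
      rw [← sub_div]
      exact div_le_div_of_nonneg_right h3 measureReal_nonneg
    have h5 := mul_le_mul_of_nonneg_left h4 (hw0 n)
    rw [abs_lt] at h1 h2
    have h1' := h1.2
    have h2' := h2.1
    nlinarith
  have hlim : Tendsto (fun s : ℝ≥0 => w n * (exceedanceMass ν r / (s : ℝ)
      - exceedanceMass ν r / (t : ℝ)) + δ / 2) (𝓝[<] t) (𝓝 (δ / 2)) := by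
    have h1 : Tendsto (fun s : ℝ≥0 => (s : ℝ)) (𝓝[<] t) (𝓝 t) :=
      (NNReal.continuous_coe.tendsto t).mono_left nhdsWithin_le_nhds
    have h2 := (((tendsto_const_nhds (x := (exceedanceMass ν r : ℝ))).div h1
      (by exact_mod_cast ht0.ne')).sub_const (exceedanceMass ν r / (t : ℝ))).const_mul (w n)
    simpa [Pi.div_def] using h2.add_const (δ / 2)
  have hne : (𝓝[<] t).NeBot := nhdsLT_neBot_of_exists_lt ⟨0, ht0⟩
  have h6 := ge_of_tendsto hlim hbound
  rw [Real.dist_eq, sub_zero, abs_of_nonneg (mul_nonneg (hw0 n)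
    (div_nonneg measureReal_nonneg measureReal_nonneg))]
  linarith

/-- Expected numbers of exceedances of multiples of `u_n`. -/
lemma tendsto_exceedance_ratio [IsProbabilityMeasure μ] (hν : IsExceedanceDistribution μ ν)
    (ha : SecondOrderCondition μ ν a) (hr : IsRiskFunctional r) (hA : IsAdmissiblePartition r A)
    (hbd : ∀ j, exponentMeasure ν (frontier (A j)) = 0)
    {u : ℕ → ℝ≥0} (hu : Tendsto u atTop atTop) {t : ℝ≥0} (ht : 0 < t) :
    Tendsto (fun n => μ.real {x | u n * t < r x} / μ.real {x | u n < supNorm x}) atTop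
      (𝓝 (exceedanceMass ν r / t)) := by
  have h := tendsto_exceedance_bias hν ha hr hA hbd hu (w := fun _ => 1)
    (by simpa using (show Tendsto (fun m => a (u m)) atTop (𝓝 0) from ha.tendsto_zero.comp hu)) ht
  have h2 := (h.comp (tendsto_id.prodMk (tendsto_const_nhds (x := t)))).add_const
    ((exceedanceMass ν r : ℝ) / t)
  simpa using h2

end Uniform

/-! ### Order statistics in the presence of ties. -/

section OrderStatistics

variable {ι : Type*} [Fintype ι]

/-- The `(k + 1)`-st largest of finitely many values: the least `t` exceeded by at most `k` of
them. -/
noncomputable def topStat (v : ι → ℝ≥0) (k : ℕ) : ℝ≥0 :=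
  sInf {t : ℝ≥0 | (Finset.univ.filter fun i => t < v i).card ≤ k}

/-- The indices of the values exceeding `topStat`. -/
noncomputable def topSet (v : ι → ℝ≥0) (k : ℕ) : Finset ι :=
  Finset.univ.filter fun i => topStat v k < v i

lemma card_filter_lt_antitone (v : ι → ℝ≥0) :
    Antitone fun t => (Finset.univ.filter fun i => t < v i).card := fun _ _ h =>
  Finset.card_le_card fun i hi => by
    simp only [Finset.mem_filter, Finset.mem_univ, true_and] at hi ⊢
    exact h.trans_lt hi

/-- The infimum defining `topStat` is attained, because the count is constant between it and the
next larger value. Ties at the threshold can make the count strictly smaller than `k`. -/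
lemma card_topSet_le (v : ι → ℝ≥0) (k : ℕ) : (topSet v k).card ≤ k := by
  by_contra h
  have hne : (topSet v k).Nonempty := Finset.card_pos.1 (by omega)
  obtain ⟨i, hi, hmin⟩ := Finset.exists_min_image (topSet v k) v hne
  have hlt : topStat v k < v i := (Finset.mem_filter.1 hi).2
  have hnon : {t : ℝ≥0 | (Finset.univ.filter fun i => t < v i).card ≤ k}.Nonempty := by
    refine ⟨Finset.univ.sup v, ?_⟩
    rw [Set.mem_ofPred_eq, Finset.filter_eq_empty_iff.2 fun i _ => not_lt.2
      (Finset.le_sup (Finset.mem_univ i))]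
    simp
  obtain ⟨t, ht, hti⟩ := exists_lt_of_csInf_lt hnon hlt
  have : (topSet v k).card ≤ (Finset.univ.filter fun i => t < v i).card :=
    Finset.card_le_card fun l hl => by
      simp only [Finset.mem_filter, Finset.mem_univ, true_and]
      exact hti.trans_le (hmin l hl)
  exact h (this.trans ht)

lemma topStat_le_iff {v : ι → ℝ≥0} {k : ℕ} {t : ℝ≥0} :
    topStat v k ≤ t ↔ (Finset.univ.filter fun i => t < v i).card ≤ k := by
  constructor
  · intro h
    exact (card_filter_lt_antitone v h).trans (card_topSet_le v k)
  · intro h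
    exact csInf_le (OrderBot.bddBelow _) h

lemma lt_topStat_iff {v : ι → ℝ≥0} {k : ℕ} {t : ℝ≥0} :
    t < topStat v k ↔ k < (Finset.univ.filter fun i => t < v i).card := by
  rw [← not_le, topStat_le_iff, not_le]

lemma measurable_topStat (k : ℕ) : Measurable fun v : ι → ℝ≥0 => topStat v k := by
  refine measurable_of_Iic fun t => ?_
  have : (fun v : ι → ℝ≥0 => topStat v k) ⁻¹' Set.Iic t
      = {v | ∑ i, (if t < v i then 1 else 0) ≤ k} := by
    ext v
    rw [Set.mem_preimage, Set.mem_Iic, topStat_le_iff, Finset.card_filter]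
    rfl
  rw [this]
  refine measurableSet_le (Finset.measurable_sum _ fun i _ => ?_) measurable_const
  exact Measurable.ite (measurableSet_lt measurable_const (measurable_pi_apply i))
    measurable_const measurable_const

lemma card_filter_subtype_notMem [DecidableEq ι] (S : Finset ι) (q : ι → Prop) [DecidablePred q] :
    (Finset.univ.filter fun i : {i // i ∉ S} => q i).card
      = (Finset.univ.filter fun i => i ∉ S ∧ q i).card := by
  classical
  refine Finset.card_bij (fun i _ => (i : ι)) ?_ ?_ ?_
  · intro i hi
    simpa [i.2] using hi
  · intro i _ j _ h
    exact Subtype.ext h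
  · intro i hi
    simp only [Finset.mem_filter, Finset.mem_univ, true_and] at hi
    exact ⟨⟨i, hi.1⟩, by simpa using hi.2, rfl⟩

lemma card_filter_split [DecidableEq ι] (S : Finset ι) (q : ι → Prop) [DecidablePred q] (hS : ∀ i ∈ S, q i) :
    (Finset.univ.filter q).card = S.card + (Finset.univ.filter fun i => i ∉ S ∧ q i).card := by
  classical
  rw [← Finset.card_union_of_disjoint]
  · congr 1
    ext i
    simp only [Finset.mem_filter, Finset.mem_univ, true_and, Finset.mem_union]
    by_cases h : i ∈ S
    · simp [h, hS i h]
    · simp [h]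
  · exact Finset.disjoint_left.2 fun i hi hi' => (Finset.mem_filter.1 hi').2.1 hi

/-- The threshold is determined by the values off the exceedance set. -/
lemma topStat_compl_topSet [DecidableEq ι] {v : ι → ℝ≥0} {k : ℕ} {S : Finset ι}
    (h : topSet v k = S) :
    topStat (fun i : {i // i ∉ S} => v i) (k - S.card) = topStat v k := by
  have hS : S.card ≤ k := h ▸ card_topSet_le v k
  have hmem : ∀ i, i ∈ S ↔ topStat v k < v i := fun i => by rw [← h]; simp [topSet]
  refine eq_of_forall_ge_iff fun t => ?_
  rw [topStat_le_iff, card_filter_subtype_notMem S fun i => t < v i]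
  constructor
  · intro ht
    refine topStat_le_iff.2 (le_trans ?_ ((Nat.le_sub_iff_add_le' hS).1 ht))
    refine le_trans (Finset.card_le_card ?_) (Finset.card_union_le S _)
    intro i hi
    simp only [Finset.mem_filter, Finset.mem_univ, true_and, Finset.mem_union] at hi ⊢
    by_cases his : i ∈ S
    · exact Or.inl his
    · exact Or.inr ⟨his, hi⟩
  · intro ht
    rw [Finset.filter_eq_empty_iff.2, Finset.card_empty]
    · exact Nat.zero_le _
    · rintro i - ⟨h1, h2⟩
      exact h1 ((hmem i).2 (ht.trans_lt h2))

/-- This form suits Fubini: the threshold on the right depends only on the values off `S`, and given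
these the conditions on the values in `S` are separate from one another. -/
lemma topSet_eq_iff [DecidableEq ι] {v : ι → ℝ≥0} {k : ℕ} {S : Finset ι} :
    topSet v k = S ↔ S.card ≤ k ∧
      (∀ i ∈ S, topStat (fun i : {i // i ∉ S} => v i) (k - S.card) < v i) ∧
      ∀ i : {i // i ∉ S}, v i ≤ topStat (fun i : {i // i ∉ S} => v i) (k - S.card) := by
  classical
  have hle : ∀ t, S.card ≤ k → (topStat (fun i : {i // i ∉ S} => v i) (k - S.card) ≤ t ↔
      S.card + (Finset.univ.filter fun i => i ∉ S ∧ t < v i).card ≤ k) := by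
    intro t hS
    rw [topStat_le_iff, card_filter_subtype_notMem S fun i => t < v i]
    omega
  constructor
  · intro h
    have hS : S.card ≤ k := h ▸ card_topSet_le v k
    have hmem : ∀ i, i ∈ S ↔ topStat v k < v i := fun i => by rw [← h]; simp [topSet]
    rw [topStat_compl_topSet h]
    exact ⟨hS, fun i hi => (hmem i).1 hi, fun i => not_lt.1 fun hi => i.2 ((hmem i).2 hi)⟩
  · rintro ⟨hS, h1, h2⟩
    set R := topStat (fun i : {i // i ∉ S} => v i) (k - S.card) with hRdef
    have hR : topStat v k = R := by
      apply le_antisymm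
      · rw [topStat_le_iff]
        refine (Finset.card_le_card ?_).trans hS
        intro i hi
        by_contra his
        exact not_lt.2 (h2 ⟨i, his⟩) (Finset.mem_filter.1 hi).2
      · refine (hle _ hS).2 ?_
        by_contra hlt
        have hlt2 := lt_of_not_ge hlt
        have h3 : ¬ R ≤ topStat v k := fun h => hlt ((hle _ hS).1 h)
        rw [← card_filter_split S (fun i => topStat v k < v i)
          fun i hi => (not_le.1 h3).trans (h1 i hi)] at hlt2
        exact absurd (card_topSet_le v k) (not_le.2 hlt2)
    ext i
    simp only [topSet, Finset.mem_filter, Finset.mem_univ, true_and, hR]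
    refine ⟨fun hi => ?_, fun hi => h1 i hi⟩
    by_contra his
    exact not_lt.2 (h2 ⟨i, his⟩) hi

/-- If fewer than `k` values exceed the threshold, every value equal to it is the corresponding
order statistic of the other values; there are at least `k + 1` values that are not smaller. -/
lemma sub_card_topSet_le [DecidableEq ι] {v : ι → ℝ≥0} {k : ℕ} (hk : 0 < topStat v k) :
    k - (topSet v k).card ≤ (Finset.univ.filter fun i =>
      v i = topStat v k ∧ topStat (fun l : {l // l ∉ ({i} : Finset ι)} => v l) (k - 1)
        = topStat v k).card := by
  set R := topStat v k with hR
  rcases Nat.eq_zero_or_pos (k - (topSet v k).card) with h0 | h0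
  · rw [h0]; exact Nat.zero_le _
  -- Otherwise the largest value `L` below the threshold would be exceeded by at most `k` values,
  -- contradicting minimality. If no value lies below, `L` is the empty supremum `0`, which is why
  -- the threshold must be positive.
  have hge : k < (Finset.univ.filter fun i => R ≤ v i).card := by
    by_contra h
    set L := (Finset.univ.filter fun i => v i < R).sup v with hL
    have hLR : L < R := (Finset.sup_lt_iff hk).2 fun i hi => (Finset.mem_filter.1 hi).2
    have : k < (Finset.univ.filter fun i => L < v i).card := lt_topStat_iff.1 hLR
    refine h (this.trans_le (Finset.card_le_card fun i hi => ?_))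
    simp only [Finset.mem_filter, Finset.mem_univ, true_and] at hi ⊢
    by_contra hi'
    exact not_le.2 hi (Finset.le_sup (f := v) (by simpa using hi'))
  have hsplit : (Finset.univ.filter fun i => R ≤ v i).card
      = (topSet v k).card + (Finset.univ.filter fun i => v i = R).card := by
    rw [← Finset.card_union_of_disjoint]
    · congr 1
      ext i
      simp only [topSet, Finset.mem_filter, Finset.mem_univ, true_and, Finset.mem_union, ← hR,
        le_iff_lt_or_eq, eq_comm]
    · refine Finset.disjoint_left.2 fun i hi hi' => ?_
      simp only [topSet, Finset.mem_filter, Finset.mem_univ, true_and] at hi hi'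
      exact absurd hi' hi.ne'
  -- Deleting one tied value and lowering `k` by one leaves the threshold in place: at least `k` of
  -- the other values are `≥ R` and at most `k - 1` exceed it.
  have hfil : (Finset.univ.filter fun i => v i = R) ⊆ (Finset.univ.filter fun i =>
      v i = R ∧ topStat (fun l : {l // l ∉ ({i} : Finset ι)} => v l) (k - 1) = R) := by
    intro i hi
    simp only [Finset.mem_filter, Finset.mem_univ, true_and] at hi ⊢
    refine ⟨hi, eq_of_forall_ge_iff fun t => ?_⟩
    rw [topStat_le_iff, card_filter_subtype_notMem {i} fun l => t < v l]
    constructor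
    · intro ht
      by_contra hlt
      have h1 := card_filter_split {i} (fun l => t < v l) (by
        simp only [Finset.mem_singleton, forall_eq]
        rw [hi]
        exact not_le.1 hlt)
      have h2 : (Finset.univ.filter fun i => R ≤ v i).card
          ≤ (Finset.univ.filter fun l => t < v l).card := Finset.card_le_card fun l hl => by
        simp only [Finset.mem_filter, Finset.mem_univ, true_and] at hl ⊢
        exact (not_le.1 hlt).trans_le hl
      rw [Finset.card_singleton] at h1
      omega
    · intro ht
      have : (Finset.univ.filter fun l => l ∉ ({i} : Finset ι) ∧ t < v l).card
          ≤ (topSet v k).card := Finset.card_le_card fun l hl => by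
        simp only [topSet, Finset.mem_filter, Finset.mem_univ, true_and] at hl ⊢
        exact ht.trans_lt hl.2
      omega
  have := Finset.card_le_card hfil
  omega

lemma orderStat_eq_topStat (v : ℕ → ℝ≥0) {n k : ℕ} (hk : k ≤ n) :
    orderStat v n (n - k) = topStat (fun i : Fin n => v i) k := by
  rw [orderStat, topStat]
  congr 1
  ext t
  simp only [Set.mem_ofPred_eq]
  have h1 : (Finset.univ.filter fun i : Fin n => t < v i).card
      = ((Finset.range n).filter fun i => t < v i).card := by
    rw [Finset.card_filter, Finset.card_filter, Finset.sum_range]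
  have h2 := Finset.card_filter_add_card_filter_not (s := Finset.range n) (fun i => v i ≤ t)
  simp only [not_le, Finset.card_range] at h2
  rw [h1]
  omega

end OrderStatistics

/-! ### Conditional independence of the exceedances. -/

section Exceedances

variable {ι E : Type*} [Fintype ι] [MeasurableSpace E]

lemma measurable_topStat_comp {r : E → ℝ≥0} (hr : Measurable r) (k : ℕ) :
    Measurable fun x : ι → E => topStat (fun i => r (x i)) k :=
  (measurable_topStat k).comp (measurable_pi_lambda _ fun i => hr.comp (measurable_pi_apply i))

lemma measurableSet_topSet_eq {r : E → ℝ≥0} (hr : Measurable r) (k : ℕ) (S : Finset ι) :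
    MeasurableSet {x : ι → E | topSet (fun i => r (x i)) k = S} := by
  have : {x : ι → E | topSet (fun i => r (x i)) k = S}
      = ⋂ i, {x | topStat (fun i => r (x i)) k < r (x i) ↔ i ∈ S} := by
    ext x
    simp [Finset.ext_iff, topSet]
  rw [this]
  refine MeasurableSet.iInter fun i => ?_
  have h := measurableSet_lt (measurable_topStat_comp (ι := ι) hr k) (hr.comp (measurable_pi_apply i))
  by_cases hi : i ∈ S
  · simpa [hi] using h
  · simp only [hi, iff_false]
    exact h.compl

/-- On the event that `S` is the exceedance set, the exceedances are conditionally i.i.d. given the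
remaining variables. -/
lemma integral_topSet_eq [DecidableEq ι] (μ : Measure E) [IsProbabilityMeasure μ]
    {r : E → ℝ≥0} (hr : Measurable r)
    (k : ℕ) (S : Finset ι) {g : ℝ≥0 → E → ℂ} (hg : Measurable (Function.uncurry g))
    {C : ℝ} (hC : ∀ u x, ‖g u x‖ ≤ C) :
    ∫ x : ι → E, (if topSet (fun i => r (x i)) k = S then
        ∏ i ∈ S, g (topStat (fun i => r (x i)) k) (x i) else 0) ∂(Measure.pi fun _ => μ)
      = ∫ z : {i // i ∉ S} → E, (if S.card ≤ k ∧
          ∀ i, r (z i) ≤ topStat (fun i => r (z i)) (k - S.card) then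
          (∫ y, (if topStat (fun i => r (z i)) (k - S.card) < r y then
            g (topStat (fun i => r (z i)) (k - S.card)) y else 0) ∂μ) ^ S.card else 0)
        ∂(Measure.pi fun _ => μ) := by
  have hC0 : 0 ≤ C := by
    obtain ⟨x⟩ : Nonempty E := nonempty_of_isProbabilityMeasure μ
    exact (norm_nonneg _).trans (hC 0 x)
  let ρ : ({i // i ∉ S} → E) → ℝ≥0 := fun z => topStat (fun i => r (z i)) (k - S.card)
  have hρ : Measurable ρ := measurable_topStat_comp hr _
  -- By `topSet_eq_iff`, the integrand in the split coordinates: the threshold `ρ` sees only the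
  -- second block, so for a fixed second block the product over the first block integrates to a
  -- power.
  let G : ({i // i ∈ S} → E) × ({i // i ∉ S} → E) → ℂ := fun p =>
    if S.card ≤ k ∧ ∀ i, r (p.2 i) ≤ ρ p.2 then
      ∏ i, (if ρ p.2 < r (p.1 i) then g (ρ p.2) (p.1 i) else 0) else 0
  have hH : MeasurableSet {z : {i // i ∉ S} → E | S.card ≤ k ∧ ∀ i, r (z i) ≤ ρ z} := by
    have : {z : {i // i ∉ S} → E | S.card ≤ k ∧ ∀ i, r (z i) ≤ ρ z}
        = {_z | S.card ≤ k} ∩ ⋂ i, {z | r (z i) ≤ ρ z} := by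
      ext z; simp
    rw [this]
    exact (MeasurableSet.const _).inter (MeasurableSet.iInter fun i =>
      measurableSet_le (hr.comp (measurable_pi_apply i)) hρ)
  have hGm : Measurable G := by
    refine Measurable.ite (measurable_snd hH) (Finset.measurable_prod _ fun i _ => ?_)
      measurable_const
    have hy : Measurable fun p : ({i // i ∈ S} → E) × ({i // i ∉ S} → E) => p.1 i :=
      (measurable_pi_apply i).comp measurable_fst
    refine Measurable.ite (measurableSet_lt (hρ.comp measurable_snd) (hr.comp hy)) ?_
      measurable_const
    exact hg.comp ((hρ.comp measurable_snd).prodMk hy)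
  have hGb : ∀ p, ‖G p‖ ≤ C ^ (Fintype.card {i // i ∈ S}) := by
    intro p
    simp only [G]
    split_ifs with h
    · rw [norm_prod]
      refine (Finset.prod_le_prod (fun _ _ => norm_nonneg _) (g := fun _ => C)
        fun i _ => ?_).trans_eq (by simp)
      split_ifs
      · exact hC _ _
      · simpa using hC0
    · simpa using pow_nonneg hC0 _
  have hFG : ∀ x : ι → E, (if topSet (fun i => r (x i)) k = S then
        ∏ i ∈ S, g (topStat (fun i => r (x i)) k) (x i) else 0)
      = G (MeasurableEquiv.piEquivPiSubtypeProd (fun _ => E) (fun i => i ∈ S) x) := by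
    intro x
    have hG : G (MeasurableEquiv.piEquivPiSubtypeProd (fun _ => E) (fun i => i ∈ S) x)
      = if S.card ≤ k ∧ ∀ i : {i // i ∉ S}, r (x i) ≤ ρ (fun i => x i) then
      ∏ i : {i // i ∈ S}, (if ρ (fun i => x i) < r (x i) then g (ρ fun i => x i) (x i) else 0)
        else 0 := rfl
    rw [hG]
    by_cases h : topSet (fun i => r (x i)) k = S
    · have h' := topSet_eq_iff.1 h
      have hmem : ∀ i, i ∈ S ↔ topStat (fun i => r (x i)) k < r (x i) := fun i => by
        rw [← h]; simp [topSet]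
      have hR : ρ (fun i => x i) = topStat (fun i => r (x i)) k :=
        topStat_compl_topSet h
      rw [if_pos h, if_pos ⟨h'.1, h'.2.2⟩, Finset.prod_coe_sort S
        (fun i => if ρ (fun i => x i) < r (x i) then g (ρ fun i => x i) (x i) else 0), hR]
      exact Finset.prod_congr rfl fun i hi => by rw [if_pos ((hmem i).1 hi)]
    · rw [if_neg h]
      split_ifs with h1
      · have h2 : ∃ i ∈ S, ¬ ρ (fun i => x i) < r (x i) := by
          by_contra h2
          push Not at h2
          exact h (topSet_eq_iff.2 ⟨h1.1, h2, h1.2⟩)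
        obtain ⟨i, hi, h3⟩ := h2
        exact (Finset.prod_eq_zero (Finset.mem_univ (⟨i, hi⟩ : {i // i ∈ S})) (if_neg h3)).symm
      · rfl
  simp_rw [hFG]
  rw [(measurePreserving_piEquivPiSubtypeProd (fun _ : ι => μ) (fun i => i ∈ S)).integral_comp' G,
    integral_prod_symm G (Integrable.of_bound hGm.aestronglyMeasurable _ (ae_of_all _ hGb))]
  refine integral_congr_ae (ae_of_all _ fun z => ?_)
  simp only [G]
  split_ifs with h
  · have := integral_fintype_prod_eq_pow (ι := {i // i ∈ S}) (μ := μ)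
      (fun y => if ρ z < r y then g (ρ z) y else 0)
    rw [Fintype.card_coe] at this
    convert! this
  · simp

end Exceedances

/-! ### Averaging over exceedances, and bounds for their number. -/

section Conditioning

variable {ι E : Type*} [Fintype ι] [MeasurableSpace E]

/-- The conditional expectation of `g u` given `r > u`. -/
noncomputable def condMean (μ : Measure E) (r : E → ℝ≥0) (g : ℝ≥0 → E → ℂ) (u : ℝ≥0) : ℂ :=
  (∫ y, (if u < r y then g u y else 0) ∂μ) / μ.real {y | u < r y}

lemma norm_condMean_le {μ : Measure E} [IsProbabilityMeasure μ] {r : E → ℝ≥0} (hr : Measurable r)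
    {g : ℝ≥0 → E → ℂ} (hg1 : ∀ u x, ‖g u x‖ ≤ 1) (u : ℝ≥0) :
    ‖condMean μ r g u‖ ≤ 1 := by
  have hm : MeasurableSet {y | u < r y} := measurableSet_lt measurable_const hr
  have h : ‖∫ y, (if u < r y then g u y else 0) ∂μ‖ ≤ μ.real {y | u < r y} := by
    refine (norm_integral_le_of_norm_le (g := Set.indicator {y | u < r y} fun _ => (1 : ℝ))
      ((integrable_const _).indicator hm) (ae_of_all _ fun y => ?_)).trans_eq ?_
    · by_cases h : u < r y
      · simpa [h] using hg1 u y
      · simp [h]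
    · rw [integral_indicator_const _ hm, smul_eq_mul, mul_one]
  rw [condMean, norm_div, Complex.norm_real, Real.norm_of_nonneg measureReal_nonneg]
  exact div_le_one_of_le₀ h measureReal_nonneg

lemma measurable_condMean {μ : Measure E} [IsProbabilityMeasure μ] {r : E → ℝ≥0}
    (hr : Measurable r) {g : ℝ≥0 → E → ℂ} (hg : Measurable (Function.uncurry g)) :
    Measurable (condMean μ r g) := by
  have h1 : MeasurableSet {p : ℝ≥0 × E | p.1 < r p.2} :=
    measurableSet_lt measurable_fst (hr.comp measurable_snd)
  have h2 : Measurable fun u : ℝ≥0 => μ.real {y | u < r y} :=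
    (measurable_measure_prodMk_left h1).ennreal_toReal
  refine Measurable.div ?_ (Complex.measurable_ofReal.comp h2)
  have h3 : Measurable fun p : ℝ≥0 × E => if p.1 < r p.2 then g p.1 p.2 else 0 :=
    Measurable.ite h1 hg measurable_const
  exact h3.stronglyMeasurable.integral_prod_right'.measurable

/-- This allows `integral_topSet_eq` to be applied a second time, with `g` replaced by its
conditional mean and an unchanged right-hand side. If the tail is null, both integrals vanish. -/
lemma integral_condMean {μ : Measure E} [IsProbabilityMeasure μ] {r : E → ℝ≥0}
    (hr : Measurable r) (g : ℝ≥0 → E → ℂ) (u : ℝ≥0) :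
    ∫ y, (if u < r y then condMean μ r g u else 0) ∂μ = ∫ y, (if u < r y then g u y else 0) ∂μ := by
  have hm : MeasurableSet {y | u < r y} := measurableSet_lt measurable_const hr
  have h1 : (fun y => if u < r y then condMean μ r g u else 0)
      = Set.indicator {y | u < r y} fun _ => condMean μ r g u := by
    funext y; simp [Set.indicator]
  rw [h1, integral_indicator_const _ hm, condMean]
  by_cases h0 : μ.real {y | u < r y} = 0
  · rw [h0, zero_smul]
    symm
    refine integral_eq_zero_of_ae ?_
    rw [measureReal_eq_zero_iff] at h0
    have : ∀ᵐ y ∂μ, ¬ u < r y := by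
      rw [ae_iff]
      simpa using h0
    filter_upwards [this] with y hy
    simp [hy]
  · rw [Complex.real_smul, mul_div_cancel₀]
    exact_mod_cast h0

lemma measurable_topSet_comp {r : E → ℝ≥0} (hr : Measurable r) (k : ℕ) {β : Type*}
    [MeasurableSpace β] {F : Finset ι → (ι → E) → β} (hF : ∀ S, Measurable (F S)) :
    Measurable fun x : ι → E => F (topSet (fun i => r (x i)) k) x := by
  intro B hB
  have : (fun x : ι → E => F (topSet (fun i => r (x i)) k) x) ⁻¹' B
      = ⋃ S : Finset ι, {x | topSet (fun i => r (x i)) k = S} ∩ F S ⁻¹' B := by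
    ext x; simp
  rw [this]
  exact MeasurableSet.iUnion fun S => (measurableSet_topSet_eq hr k S).inter (hF S hB)

lemma measurable_prod_topStat {r : E → ℝ≥0} (hr : Measurable r) (k : ℕ) (S : Finset ι)
    {g : ℝ≥0 → E → ℂ} (hg : Measurable (Function.uncurry g)) :
    Measurable fun x : ι → E => ∏ i ∈ S, g (topStat (fun i => r (x i)) k) (x i) :=
  Finset.measurable_prod _ fun i _ =>
    hg.comp ((measurable_topStat_comp hr k).prodMk (measurable_pi_apply i))

/-- Averaging a product over the exceedances, conditionally on the threshold and on the number of
exceedances. -/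
theorem integral_prod_topSet [DecidableEq ι] (μ : Measure E) [IsProbabilityMeasure μ]
    {r : E → ℝ≥0} (hr : Measurable r)
    (k : ℕ) {g : ℝ≥0 → E → ℂ} (hg : Measurable (Function.uncurry g))
    (hg1 : ∀ u x, ‖g u x‖ ≤ 1) :
    ∫ x : ι → E, ∏ i ∈ topSet (fun i => r (x i)) k, g (topStat (fun i => r (x i)) k) (x i)
        ∂(Measure.pi fun _ => μ)
      = ∫ x : ι → E, condMean μ r g (topStat (fun i => r (x i)) k) ^
        (topSet (fun i => r (x i)) k).card ∂(Measure.pi fun _ => μ) := by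
  have key : ∀ f : ℝ≥0 → E → ℂ, Measurable (Function.uncurry f) → (∀ u x, ‖f u x‖ ≤ 1) →
      ∫ x : ι → E, ∏ i ∈ topSet (fun i => r (x i)) k, f (topStat (fun i => r (x i)) k) (x i)
        ∂(Measure.pi fun _ => μ) = ∑ S : Finset ι, ∫ x : ι → E,
        (if topSet (fun i => r (x i)) k = S then
        ∏ i ∈ S, f (topStat (fun i => r (x i)) k) (x i) else 0) ∂(Measure.pi fun _ => μ) := by
    intro f hf hf1
    rw [← integral_finsetSum]
    · refine integral_congr_ae (ae_of_all _ fun x => ?_)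
      simp
    · intro S _
      refine Integrable.of_bound (C := 1) (Measurable.aestronglyMeasurable (Measurable.ite
        (measurableSet_topSet_eq hr k S) (measurable_prod_topStat hr k S hf) measurable_const))
        (ae_of_all _ fun x => ?_)
      split_ifs
      · rw [norm_prod]
        exact Finset.prod_le_one (fun _ _ => norm_nonneg _) fun _ _ => hf1 _ _
      · simp
  have h2 := key (fun u _ => condMean μ r g u) ((measurable_condMean hr hg).comp measurable_fst)
    fun u _ => norm_condMean_le hr hg1 u
  simp only [Finset.prod_const] at h2
  rw [h2, key g hg hg1]
  refine Finset.sum_congr rfl fun S _ => ?_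
  rw [integral_topSet_eq μ hr k S hg hg1]
  have h3 := integral_topSet_eq μ hr k S (g := fun u _ => condMean μ r g u)
    ((measurable_condMean hr hg).comp measurable_fst) fun u _ => norm_condMean_le hr hg1 u
  simp only [Finset.prod_const, integral_condMean hr] at h3
  exact h3.symm

/-- Ties with an independent order statistic are unlikely when the law has small atoms. -/
lemma measure_tie_le [DecidableEq ι] (μ : Measure E) [IsProbabilityMeasure μ]
    {r : E → ℝ≥0} (hr : Measurable r) (k : ℕ) (i : ι) {J : Set ℝ≥0} (hJ : MeasurableSet J)
    {c : ℝ≥0∞} (hc : ∀ t ∈ J, μ {y | r y = t} ≤ c) :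
    (Measure.pi fun _ : ι => μ) {x | r (x i) = topStat (fun l : {l // l ∉ ({i} : Finset ι)} =>
      r (x l)) k ∧ topStat (fun l : {l // l ∉ ({i} : Finset ι)} => r (x l)) k ∈ J} ≤ c := by
  let i₀ : {l // l ∈ ({i} : Finset ι)} := ⟨i, Finset.mem_singleton_self i⟩
  let ρ : ({l // l ∉ ({i} : Finset ι)} → E) → ℝ≥0 := fun z => topStat (fun l => r (z l)) k
  have hρ : Measurable ρ := measurable_topStat_comp hr _
  let D : Set (({l // l ∈ ({i} : Finset ι)} → E) × ({l // l ∉ ({i} : Finset ι)} → E)) :=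
    {p | r (p.1 i₀) = ρ p.2 ∧ ρ p.2 ∈ J}
  have hD : MeasurableSet D := by
    refine MeasurableSet.inter (measurableSet_eq_fun
      (hr.comp ((measurable_pi_apply i₀).comp measurable_fst)) (hρ.comp measurable_snd)) ?_
    exact (hρ.comp measurable_snd) hJ
  have hpre := (measurePreserving_piEquivPiSubtypeProd (fun _ : ι => μ)
    (fun l => l ∈ ({i} : Finset ι))).measure_preimage hD.nullMeasurableSet
  refine (le_of_eq hpre).trans ?_
  rw [Measure.prod_apply_symm hD]
  refine (lintegral_mono (g := fun _ => c) fun z => ?_).trans (by simp)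
  by_cases hz : ρ z ∈ J
  · have h1 : (fun y => (y, z)) ⁻¹' D = Function.eval i₀ ⁻¹' {y | r y = ρ z} := by
      ext y
      simp [D, hz]
    have h2 := (measurePreserving_eval (fun _ : {l // l ∈ ({i} : Finset ι)} => μ)
      i₀).measure_preimage (s := {y | r y = ρ z})
      (measurableSet_eq_fun hr measurable_const).nullMeasurableSet
    rw [h1]
    refine (le_of_eq ?_).trans (hc _ hz)
    convert! h2
  · have h1 : (fun y => (y, z)) ⁻¹' D = ∅ := by
      ext y
      simp [D, hz]
    rw [h1, measure_empty]
    exact zero_le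

/-- A bound for the probability that markedly fewer than `k` values exceed the threshold. -/
theorem measure_card_topSet_le [DecidableEq ι] (μ : Measure E) [IsProbabilityMeasure μ]
    {r : E → ℝ≥0} (hr : Measurable r) (k : ℕ) {J : Set ℝ≥0} (hJ : MeasurableSet J)
    (hJ0 : ∀ t ∈ J, 0 < t) {c : ℝ} (hc0 : 0 ≤ c) (hc : ∀ t ∈ J, μ.real {y | r y = t} ≤ c)
    {m : ℝ} (hm : 0 < m) :
    (Measure.pi fun _ : ι => μ).real {x | topStat (fun i => r (x i)) k ∈ J ∧
      m ≤ (k : ℝ) - (topSet (fun i => r (x i)) k).card} ≤ Fintype.card ι * c / m := by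
  set π := Measure.pi fun _ : ι => μ
  -- The deficit of exceedances is at most the number of indices `i` for which `T i` occurs. Each `T
  -- i` has probability at most `c`, the tied order statistic being independent of `x i`; Markov's
  -- inequality concludes.
  let T : ι → Set (ι → E) := fun i => {x | r (x i) = topStat (fun l : {l // l ∉ ({i} : Finset ι)} =>
      r (x l)) (k - 1) ∧ topStat (fun l : {l // l ∉ ({i} : Finset ι)} => r (x l)) (k - 1) ∈ J}
  have hT : ∀ i, MeasurableSet (T i) := by
    intro i
    have hρ : Measurable fun x : ι → E =>
        topStat (fun l : {l // l ∉ ({i} : Finset ι)} => r (x l)) (k - 1) :=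
      (measurable_topStat (k - 1)).comp (measurable_pi_lambda _ fun l =>
        hr.comp (measurable_pi_apply _))
    exact (measurableSet_eq_fun (hr.comp (measurable_pi_apply i)) hρ).inter (hρ hJ)
  have hTle : ∀ i, π.real (T i) ≤ c := by
    intro i
    have := measure_tie_le μ hr (k - 1) i hJ (c := ENNReal.ofReal c) fun t ht => by
      rw [← ofReal_measureReal]
      exact ENNReal.ofReal_le_ofReal (hc t ht)
    exact ENNReal.toReal_le_of_le_ofReal hc0 this
  have hint : Integrable (fun x => ∑ i, (T i).indicator (fun _ => (1 : ℝ)) x) π :=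
    integrable_finsetSum _ fun i _ => (integrable_const _).indicator (hT i)
  have hmark := mul_meas_ge_le_integral_of_nonneg (μ := π) (ae_of_all _ fun x =>
    Finset.sum_nonneg fun i _ => Set.indicator_nonneg (fun _ _ => zero_le_one) x) hint m
  rw [integral_finsetSum _ fun i _ => (integrable_const _).indicator (hT i)] at hmark
  simp only [integral_indicator_const _ (hT _), smul_eq_mul, mul_one] at hmark
  have hsum : ∑ i, π.real (T i) ≤ Fintype.card ι * c := by
    refine (Finset.sum_le_sum fun i _ => hTle i).trans_eq ?_
    simp
  rw [le_div_iff₀ hm, mul_comm]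
  refine le_trans (mul_le_mul_of_nonneg_left (measureReal_mono fun x hx => ?_) hm.le)
    (hmark.trans hsum)
  obtain ⟨hx1, hx2⟩ := hx
  refine hx2.trans ?_
  have h1 := sub_card_topSet_le (v := fun i => r (x i)) (hJ0 _ hx1)
  have h2 : (k : ℝ) - (topSet (fun i => r (x i)) k).card
      ≤ ((k - (topSet (fun i => r (x i)) k).card : ℕ) : ℝ) := by
    rw [Nat.cast_sub (card_topSet_le _ _)]
  refine h2.trans ((Nat.cast_le.2 h1).trans ?_)
  rw [Finset.card_filter, Nat.cast_sum]
  refine Finset.sum_le_sum fun i _ => ?_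
  split_ifs with h
  · have : x ∈ T i := ⟨by rw [h.2, h.1], by rw [h.2]; exact hx1⟩
    simp [this]
  · simpa using Set.indicator_nonneg (fun _ _ => zero_le_one) x

/-- Chebyshev's inequality for the number of exceedances of a fixed level. -/
lemma measure_card_exceedance_dev_le (μ : Measure E) [IsProbabilityMeasure μ]
    {r : E → ℝ≥0} (hr : Measurable r) (u : ℝ≥0) {c : ℝ} (hc : 0 < c) :
    (Measure.pi fun _ : ι => μ).real {x | c ≤ |((Finset.univ.filter fun i => u < r (x i)).card : ℝ)
      - Fintype.card ι * μ.real {y | u < r y}|} ≤ Fintype.card ι * μ.real {y | u < r y} / c ^ 2 := by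
  set π := Measure.pi fun _ : ι => μ
  set m := μ.real {y | u < r y}
  have hU : MeasurableSet {y | u < r y} := measurableSet_lt measurable_const hr
  let f : E → ℝ := Set.indicator {y | u < r y} fun _ => 1
  have hf2 : MemLp f 2 μ := (memLp_const 1).indicator hU
  have hsum : ∀ x : ι → E, (∑ i, fun x : ι → E => f (x i)) x
      = ((Finset.univ.filter fun i => u < r (x i)).card : ℝ) := by
    intro x
    rw [Finset.sum_apply, Finset.card_filter, Nat.cast_sum]
    refine Finset.sum_congr rfl fun i _ => ?_
    by_cases h : u < r (x i) <;> simp [f, h]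
  have hvar : variance (∑ i, fun x : ι → E => f (x i)) π ≤ Fintype.card ι * m := by
    rw [variance_sum_pi (X := fun _ : ι => f) fun _ => hf2]
    simp only [Finset.sum_const, Finset.card_univ, nsmul_eq_mul]
    refine mul_le_mul_of_nonneg_left ?_ (Nat.cast_nonneg _)
    refine (variance_le_expectation_sq hf2.aestronglyMeasurable).trans_eq ?_
    have : f ^ 2 = f := by
      funext y
      by_cases h : u < r y <;> simp [f, h]
    rw [this, integral_indicator_const _ hU, smul_eq_mul, mul_one]
  have hcomp : ∀ i, MemLp (fun x : ι → E => f (x i)) 2 π := fun i =>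
    hf2.comp_measurePreserving (measurePreserving_eval (fun _ : ι => μ) i)
  have hmean : π[∑ i, fun x : ι → E => f (x i)] = Fintype.card ι * m := by
    simp only [Finset.sum_apply]
    rw [integral_finsetSum _ fun i _ => (hcomp i).integrable one_le_two]
    have : ∀ i : ι, ∫ x : ι → E, f (x i) ∂π = m := fun i => by
      rw [integral_comp_eval (μ := fun _ : ι => μ) hf2.aestronglyMeasurable,
        integral_indicator_const _ hU, smul_eq_mul, mul_one]
    simp [this]
  have hch := meas_ge_le_variance_div_sq (memLp_finsetSum' Finset.univ fun i _ => hcomp i) hc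
  rw [hmean] at hch
  simp only [hsum] at hch
  refine (ENNReal.toReal_le_of_le_ofReal (div_nonneg (variance_nonneg _ _) (sq_nonneg _)) hch).trans ?_
  exact div_le_div_of_nonneg_right hvar (sq_nonneg c)

end Conditioning

/-! ### Elementary estimates for characteristic functions. -/

section Analysis

/-- Bounded functions that are close to `c` on events of probability close to one have integrals
close to `c`. -/
lemma tendsto_integral_of_eventually_close {X : ℕ → Type*} [∀ n, MeasurableSpace (X n)]
    (π : ∀ n, Measure (X n)) [∀ n, IsProbabilityMeasure (π n)] (F : ∀ n, X n → ℂ) {c : ℂ} {M : ℝ}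
    (hF : ∀ n, Measurable (F n)) (hM : ∀ n x, ‖F n x‖ ≤ M)
    (h : ∀ δ > 0, ∃ B : ∀ n, Set (X n), Tendsto (fun n => (π n).real (B n)) atTop (𝓝 0) ∧
      ∀ᶠ n in atTop, ∀ x ∉ B n, ‖F n x - c‖ ≤ δ) :
    Tendsto (fun n => ∫ x, F n x ∂(π n)) atTop (𝓝 c) := by
  rw [tendsto_iff_norm_sub_tendsto_zero]
  refine squeeze_zero' (Eventually.of_forall fun n => norm_nonneg _) (Eventually.of_forall fun n =>
    le_refl _) ?_
  rw [Metric.tendsto_nhds]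
  intro ε hε
  obtain ⟨B, hB, hBF⟩ := h (ε / 2) (half_pos hε)
  have hM' : 0 < |M| + ‖c‖ + 1 := by positivity
  filter_upwards [hBF, hB.eventually (gt_mem_nhds (show 0 < ε / 2 / (|M| + ‖c‖ + 1) by positivity))]
    with n hn hn2
  rw [Real.dist_eq, sub_zero, abs_of_nonneg (norm_nonneg _)]
  have hint : Integrable (F n) (π n) :=
    Integrable.of_bound (hF n).aestronglyMeasurable M (ae_of_all _ (hM n))
  have h1 : ∫ x, F n x ∂(π n) - c = ∫ x, (F n x - c) ∂(π n) := by
    rw [integral_sub hint (integrable_const _)]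
    simp
  -- The exceptional sets need not be measurable; a measurable hull has the same mass.
  set D := toMeasurable (π n) (B n) with hD
  have hDm : MeasurableSet D := measurableSet_toMeasurable _ _
  have hDr : (π n).real D = (π n).real (B n) := by
    rw [measureReal_def, hD, measure_toMeasurable, measureReal_def]
  have hb : ∀ x, ‖F n x - c‖ ≤ ε / 2 + D.indicator (fun _ => |M| + ‖c‖) x := by
    intro x
    by_cases hx : x ∈ D
    · rw [Set.indicator_of_mem hx]
      have := (norm_sub_le (F n x) c).trans (add_le_add_left ((hM n x).trans (le_abs_self M)) _)
      linarith
    · rw [Set.indicator_of_notMem hx, add_zero]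
      exact hn x fun hx' => hx (subset_toMeasurable _ _ hx')
  have hi2 : Integrable (fun x => ε / 2 + D.indicator (fun _ => |M| + ‖c‖) x) (π n) :=
    (integrable_const _).add ((integrable_const _).indicator hDm)
  have h2 : ‖∫ x, (F n x - c) ∂(π n)‖ ≤ ε / 2 + (π n).real D * (|M| + ‖c‖) := by
    refine (norm_integral_le_of_norm_le hi2 (ae_of_all _ hb)).trans_eq ?_
    rw [integral_add (integrable_const _) ((integrable_const _).indicator hDm),
      integral_indicator_const _ hDm]
    simp
  rw [h1]
  refine h2.trans_lt ?_
  rw [hDr]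
  rw [lt_div_iff₀ hM'] at hn2
  have := (measureReal_nonneg : 0 ≤ (π n).real (B n))
  nlinarith

lemma norm_pow_sub_pow_le_mul {v w : ℂ} (hv : ‖v‖ ≤ 1) (hw : ‖w‖ ≤ 1) (N : ℕ) :
    ‖v ^ N - w ^ N‖ ≤ N * ‖v - w‖ := by
  induction N with
  | zero => simp
  | succ N ih =>
    have : v ^ (N + 1) - w ^ (N + 1) = v ^ N * (v - w) + (v ^ N - w ^ N) * w := by ring
    rw [this]
    refine (norm_add_le _ _).trans ?_
    rw [norm_mul, norm_mul, norm_pow]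
    have h1 : ‖v‖ ^ N ≤ 1 := pow_le_one₀ (norm_nonneg _) hv
    have h2 : ‖v‖ ^ N * ‖v - w‖ ≤ ‖v - w‖ := mul_le_of_le_one_left (norm_nonneg _) h1
    have h3 : ‖v ^ N - w ^ N‖ * ‖w‖ ≤ ‖v ^ N - w ^ N‖ := mul_le_of_le_one_right (norm_nonneg _) hw
    push_cast
    linarith

lemma abs_exp_sub_exp_le_of_nonpos {a b : ℝ} (ha : a ≤ 0) (hb : b ≤ 0) :
    |Real.exp a - Real.exp b| ≤ |a - b| := by
  wlog hab : b ≤ a generalizing a b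
  · rw [abs_sub_comm, abs_sub_comm a]
    exact this hb ha (not_le.1 hab).le
  rw [abs_of_nonneg (sub_nonneg.2 (Real.exp_le_exp.2 hab)), abs_of_nonneg (sub_nonneg.2 hab)]
  have h1 : Real.exp b = Real.exp a * Real.exp (b - a) := by rw [← Real.exp_add]; congr 1; ring
  have h2 := Real.add_one_le_exp (b - a)
  have h3 : Real.exp a ≤ 1 := Real.exp_le_one_iff.2 ha
  have h4 := Real.exp_pos a
  rw [h1]
  nlinarith

/-- Quantitative form of `(1 + ζ / k) ^ N ≈ exp ζ` for `N ≤ k` close to `k`. -/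
lemma norm_pow_sub_exp_le {w : ℂ} (hw : ‖w‖ ≤ 1) {ζ : ℝ} (hζ : ζ ≤ 0) {N k : ℕ} (hN : N ≤ k)
    (hk : 0 < k) (hζk : |ζ| ≤ k) :
    ‖w ^ N - Real.exp ζ‖ ≤ ‖(k : ℂ) * (w - 1) - ζ‖ + ζ ^ 2 / k + |ζ| * ((k - N) / k) := by
  have hk0 : (0 : ℝ) < k := Nat.cast_pos.2 hk
  have hkC : (k : ℂ) ≠ 0 := by exact_mod_cast hk.ne'
  -- The comparison goes through `v ^ N`, where `v ^ k = exp ζ`: replacing `w` by `v` costs the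
  -- first two error terms, replacing `N` by `k` the third.
  set v : ℂ := (Real.exp (ζ / k) : ℂ) with hv
  have hζk' : ζ / k ≤ 0 := div_nonpos_of_nonpos_of_nonneg hζ hk0.le
  have hv1 : ‖v‖ ≤ 1 := by
    rw [hv, Complex.norm_real, Real.norm_of_nonneg (Real.exp_pos _).le]
    exact Real.exp_le_one_iff.2 hζk'
  have h1 : ‖w ^ N - v ^ N‖ ≤ ‖(k : ℂ) * (w - 1) - ζ‖ + ζ ^ 2 / k := by
    refine (norm_pow_sub_pow_le_mul hw hv1 N).trans ?_
    refine (mul_le_mul_of_nonneg_right (Nat.cast_le.2 hN) (norm_nonneg _)).trans ?_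
    have h2 : (k : ℝ) * ‖w - v‖ = ‖((k : ℂ) * (w - 1) - ζ) - k * (v - 1 - ((ζ / k : ℝ) : ℂ))‖ := by
      have : ((k : ℂ) * (w - 1) - ζ) - k * (v - 1 - ((ζ / k : ℝ) : ℂ)) = k * (w - v) := by
        push_cast
        field_simp
        ring
      rw [this, norm_mul, Complex.norm_natCast]
    rw [h2]
    refine (norm_sub_le _ _).trans (add_le_add_right ?_ _)
    rw [norm_mul, Complex.norm_natCast]
    have h3 : ‖v - 1 - ((ζ / k : ℝ) : ℂ)‖ ≤ (ζ / k) ^ 2 := by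
      have h4 : v - 1 - ((ζ / k : ℝ) : ℂ) = ((Real.exp (ζ / k) - 1 - ζ / k : ℝ) : ℂ) := by
        rw [hv]; push_cast; ring
      rw [h4, Complex.norm_real]
      have h5 : ‖ζ / k‖ ≤ 1 := by
        rw [Real.norm_eq_abs, abs_div, abs_of_pos hk0]
        exact (div_le_one hk0).2 hζk
      refine (Real.norm_exp_sub_one_sub_id_le h5).trans_eq ?_
      rw [Real.norm_eq_abs, sq_abs]
    calc (k : ℝ) * ‖v - 1 - ((ζ / k : ℝ) : ℂ)‖ ≤ k * (ζ / k) ^ 2 := by gcongr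
      _ = ζ ^ 2 / k := by field_simp
  have h5 : ‖v ^ N - Real.exp ζ‖ ≤ |ζ| * ((k - N) / k) := by
    have h6 : v ^ N - Real.exp ζ = ((Real.exp (N * (ζ / k)) - Real.exp ζ : ℝ) : ℂ) := by
      rw [hv, Complex.ofReal_sub, Real.exp_nat_mul]
      push_cast
      ring
    rw [h6, Complex.norm_real, Real.norm_eq_abs]
    refine (abs_exp_sub_exp_le_of_nonpos (mul_nonpos_of_nonneg_of_nonpos (Nat.cast_nonneg _) hζk')
      hζ).trans_eq ?_
    have h7 : N * (ζ / k) - ζ = -(ζ * ((k - N) / k)) := by field_simp; ring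
    have h8 : (0 : ℝ) ≤ (k - N) / k := div_nonneg (sub_nonneg.2 (Nat.cast_le.2 hN)) hk0.le
    rw [h7, abs_neg, abs_mul, abs_of_nonneg h8]
  calc ‖w ^ N - Real.exp ζ‖ ≤ ‖w ^ N - v ^ N‖ + ‖v ^ N - Real.exp ζ‖ := norm_sub_le_norm_sub_add_norm_sub _ _ _
    _ ≤ _ := add_le_add h1 h5

lemma tendsto_sq_mul_exp_sub {α : Type*} {l : Filter α} {s : α → ℝ} (hs : Tendsto s l atTop)
    (β : ℝ) : Tendsto (fun n => (s n : ℂ) ^ 2 * (Complex.exp (Complex.I * (β / s n)) - 1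
      - Complex.I * (β / s n))) l (𝓝 (-(β : ℂ) ^ 2 / 2)) := by
  have h0 : Tendsto (fun n => |β| ^ 3 * (s n)⁻¹) l (𝓝 0) := by
    simpa using (tendsto_inv_atTop_zero.comp hs).const_mul (|β| ^ 3)
  rw [tendsto_iff_norm_sub_tendsto_zero]
  refine squeeze_zero' (Eventually.of_forall fun n => norm_nonneg _) ?_ h0
  filter_upwards [hs.eventually_ge_atTop (|β| + 1)] with n hn
  have hsn : 0 < s n := by linarith [abs_nonneg β]
  have hsC : (s n : ℂ) ≠ 0 := by exact_mod_cast hsn.ne'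
  set y : ℂ := Complex.I * (β / s n) with hy
  have hyn : ‖y‖ = |β| / s n := by
    rw [hy, norm_mul, Complex.norm_I, one_mul, ← Complex.ofReal_div, Complex.norm_real,
      Real.norm_eq_abs, abs_div, abs_of_pos hsn]
  have hy1 : ‖y‖ ≤ 1 := by rw [hyn]; exact div_le_one_of_le₀ (by linarith) hsn.le
  have hb := Complex.exp_bound hy1 (n := 3) (by norm_num)
  have hsum : ∑ m ∈ Finset.range 3, y ^ m / (m.factorial : ℂ) = 1 + y + y ^ 2 / 2 := by
    simp [Finset.sum_range_succ, Nat.factorial]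
  rw [hsum] at hb
  have heq : (s n : ℂ) ^ 2 * (Complex.exp y - 1 - y) - -(β : ℂ) ^ 2 / 2
      = (s n : ℂ) ^ 2 * (Complex.exp y - (1 + y + y ^ 2 / 2)) := by
    have : (s n : ℂ) ^ 2 * y ^ 2 = -(β : ℂ) ^ 2 := by
      rw [hy, mul_pow, Complex.I_sq]
      field_simp
    linear_combination this / 2
  rw [heq, norm_mul, norm_pow, Complex.norm_real, Real.norm_of_nonneg hsn.le]
  calc s n ^ 2 * ‖Complex.exp y - (1 + y + y ^ 2 / 2)‖
      ≤ s n ^ 2 * (‖y‖ ^ 3 * ((Nat.succ 3 : ℝ) * ((Nat.factorial 3 : ℝ) * (3 : ℕ))⁻¹)) := by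
        gcongr
    _ ≤ s n ^ 2 * (‖y‖ ^ 3 * 1) := by
        gcongr
        norm_num [Nat.factorial]
    _ = |β| ^ 3 * (s n)⁻¹ := by
        rw [hyn]
        field_simp

lemma tendsto_mul_exp_sub_one {α : Type*} {l : Filter α} {s : α → ℝ} (hs : Tendsto s l atTop)
    (β : ℝ) : Tendsto (fun n => (s n : ℂ) * (Complex.exp (Complex.I * (β / s n)) - 1))
      l (𝓝 (Complex.I * β)) := by
  have h1 : Tendsto (fun n => ((s n)⁻¹ : ℂ)) l (𝓝 0) := by
    have := (Complex.continuous_ofReal.tendsto 0).comp (tendsto_inv_atTop_zero.comp hs)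
    simpa [Function.comp_def] using this
  have h2 := (h1.mul (tendsto_sq_mul_exp_sub hs β)).add_const (Complex.I * (β : ℂ))
  rw [zero_mul, zero_add] at h2
  refine h2.congr' ?_
  filter_upwards [hs.eventually_gt_atTop 0] with n hn
  have hsC : (s n : ℂ) ≠ 0 := by exact_mod_cast hn.ne'
  field_simp
  ring

end Analysis

/-! ### The random threshold and the number of exceedances. -/

section OneSample

variable {d K : ℕ}

/-- The behaviour of the law `μ` of one observation at the intermediate thresholds `u n`: the
conditional cell probabilities converge to `p` without asymptotic bias, uniformly over thresholds
close to `b u n`; the expected numbers of exceedances are of the order `k n`; ties are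
negligible. -/
structure IntermediateRegime (μ : Measure (Orthant d)) (r : Orthant d → ℝ≥0)
    (A : Fin K → Set (Orthant d)) (p : Fin K → ℝ) (k : ℕ → ℕ) (u : ℕ → ℝ≥0) (b : ℝ≥0) : Prop where
  risk : IsRiskFunctional r
  partition : IsAdmissiblePartition r A
  sum_prob : ∑ j, p j = 1
  prob_nonneg : ∀ j, 0 ≤ p j
  tendsto_k : Tendsto k atTop atTop
  tendsto_u : Tendsto u atTop atTop
  b_pos : 0 < b
  bias : ∀ j, Tendsto (fun z : ℕ × ℝ≥0 => √(k z.1 : ℝ) * (condProb μ r (A j) (u z.1 * z.2) - p j))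
    (atTop ×ˢ 𝓝 b) (𝓝 0)
  exceedance : ∀ t : ℝ≥0, 0 < t → Tendsto (fun n : ℕ => (n : ℝ) / k n * μ.real {x | u n * t < r x})
    atTop (𝓝 (b / t))
  atom : Tendsto (fun z : ℕ × ℝ≥0 => (z.1 : ℝ) / √(k z.1 : ℝ) * μ.real {x | r x = u z.1 * z.2})
    (atTop ×ˢ 𝓝 b) (𝓝 0)

variable {μ : Measure (Orthant d)} [IsProbabilityMeasure μ] {r : Orthant d → ℝ≥0}
  {A : Fin K → Set (Orthant d)} {p : Fin K → ℝ} {k : ℕ → ℕ} {u : ℕ → ℝ≥0} {b : ℝ≥0}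

lemma tendsto_sqrt_natCast_atTop (hk : Tendsto k atTop atTop) :
    Tendsto (fun n => √(k n : ℝ)) atTop atTop :=
  Real.tendsto_sqrt_atTop.comp (tendsto_natCast_atTop_atTop.comp hk)

/-- This is the Chebyshev bound for a count of mean `m n` to end up on the other side of `k n`; it
is of order `1 / k n` when `m n / k n` has a limit other than `1`. -/
lemma tendsto_div_sub_sq (hk : Tendsto k atTop atTop) {m : ℕ → ℝ} {ρ : ℝ} (hρ : ρ ≠ 1)
    (hm : Tendsto (fun n => m n / k n) atTop (𝓝 ρ)) :
    Tendsto (fun n => m n / (m n - k n) ^ 2) atTop (𝓝 0) := by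
  have h1 : Tendsto (fun n => ((k n : ℝ))⁻¹) atTop (𝓝 0) :=
    tendsto_inv_atTop_zero.comp (tendsto_natCast_atTop_atTop.comp hk)
  have h2 := h1.mul (hm.div ((hm.sub_const 1).pow 2) (pow_ne_zero 2 (sub_ne_zero.2 hρ)))
  rw [zero_mul] at h2
  refine h2.congr' ?_
  filter_upwards [hk.eventually_gt_atTop 0, hm.eventually_ne hρ] with n hn hne
  have hk0 : (k n : ℝ) ≠ 0 := by exact_mod_cast hn.ne'
  have h3 : m n - k n ≠ 0 := fun h => hne (by rw [sub_eq_zero.1 h, div_self hk0])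
  have h4 : m n / k n - 1 ≠ 0 := sub_ne_zero.2 hne
  rw [Pi.div_apply]
  have h5 : m n / k n - 1 = (m n - k n) / k n := by field_simp
  rw [h5]
  field_simp

/-- The random threshold is asymptotically equal to `b u n` in probability. -/
lemma IntermediateRegime.tendsto_threshold (h : IntermediateRegime μ r A p k u b) {V : Set ℝ≥0}
    (hV : V ∈ 𝓝 b) :
    Tendsto (fun n => (Measure.pi fun _ : Fin n => μ).real
      {x | topStat (fun i => r (x i)) (k n) / u n ∉ V}) atTop (𝓝 0) := by
  obtain ⟨l, l', ⟨hl, hl'⟩, hsub⟩ := (mem_nhds_iff_exists_Ioo_subset' ⟨0, h.b_pos⟩ (exists_gt b)).1 hV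
  -- For `s < b < t`, the levels `u n * s` and `u n * t` have about `(b / s) * k n > k n` and `(b /
  -- t) * k n < k n` expected exceedances. A threshold outside this range forces one of the two
  -- counts to deviate from its mean by order `k n`.
  obtain ⟨s, hs, hsb⟩ := exists_between hl
  obtain ⟨t, hbt, ht⟩ := exists_between hl'
  have hs0 : 0 < s := zero_le.trans_lt hs
  have ht0 : 0 < t := h.b_pos.trans hbt
  have hm : ∀ c : ℝ≥0, 0 < c → c ≠ b → Tendsto (fun n : ℕ => (n * μ.real {x | u n * c < r x})
      / ((n * μ.real {x | u n * c < r x}) - k n) ^ 2) atTop (𝓝 0) := by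
    intro c hc hcb
    refine tendsto_div_sub_sq h.tendsto_k (ρ := b / c) ?_
      ((h.exceedance c hc).congr fun n => by ring)
    rw [Ne, div_eq_one_iff_eq (by exact_mod_cast hc.ne')]
    exact_mod_cast hcb.symm
  have h0 := (hm s hs0 hsb.ne).add (hm t ht0 hbt.ne')
  rw [add_zero] at h0
  have es := (h.exceedance s hs0).eventually (lt_mem_nhds (show (1 : ℝ) < b / s by
    rw [one_lt_div (by exact_mod_cast hs0)]; exact_mod_cast hsb))
  have et := (h.exceedance t ht0).eventually (gt_mem_nhds (show (b / t : ℝ) < 1 by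
    rw [div_lt_one (by exact_mod_cast ht0)]; exact_mod_cast hbt))
  refine squeeze_zero' (Eventually.of_forall fun n => measureReal_nonneg) ?_ h0
  filter_upwards [es, et, h.tendsto_u.eventually_gt_atTop 0, h.tendsto_k.eventually_gt_atTop 0]
    with n hes het hu hkn
  have hk0 : (0 : ℝ) < k n := Nat.cast_pos.2 hkn
  rw [div_mul_eq_mul_div, one_lt_div hk0] at hes
  rw [div_mul_eq_mul_div, div_lt_one hk0] at het
  refine le_trans (measureReal_mono (s₂ := {x : Fin n → Orthant d |
    n * μ.real {x | u n * s < r x} - k n ≤ |((Finset.univ.filter fun i => u n * s < r (x i)).card : ℝ)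
      - Fintype.card (Fin n) * μ.real {y | u n * s < r y}|} ∪ {x : Fin n → Orthant d |
    k n - n * μ.real {x | u n * t < r x} ≤ |((Finset.univ.filter fun i => u n * t < r (x i)).card : ℝ)
      - Fintype.card (Fin n) * μ.real {y | u n * t < r y}|}) ?_) ?_
  · intro x hx
    rw [Set.mem_ofPred_eq] at hx
    rw [Fintype.card_fin]
    by_cases h1 : topStat (fun i => r (x i)) (k n) ≤ u n * s
    · left
      have h2 : ((Finset.univ.filter fun i => u n * s < r (x i)).card : ℝ) ≤ k n :=
        Nat.cast_le.2 (topStat_le_iff.1 h1)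
      rw [Set.mem_ofPred_eq, abs_sub_comm]
      exact le_trans (by linarith) (le_abs_self _)
    · right
      have h2 : ¬ topStat (fun i => r (x i)) (k n) ≤ u n * t := fun h2 => hx (hsub
        ⟨hs.trans ((lt_div_iff₀ hu).2 (by rw [mul_comm]; exact not_le.1 h1)),
          ((div_le_iff₀ hu).2 (by rw [mul_comm]; exact h2)).trans_lt ht⟩)
      have h3 : (k n : ℝ) ≤ (Finset.univ.filter fun i => u n * t < r (x i)).card :=
        Nat.cast_le.2 (lt_topStat_iff.1 (not_le.1 h2)).le
      rw [Set.mem_ofPred_eq]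
      exact le_trans (by linarith) (le_abs_self _)
  · refine (measureReal_union_le _ _).trans (add_le_add ?_ ?_)
    · refine (measure_card_exceedance_dev_le μ h.risk.measurable _ (sub_pos.2 hes)).trans_eq ?_
      rw [Fintype.card_fin]
    · refine (measure_card_exceedance_dev_le μ h.risk.measurable _ (sub_pos.2 het)).trans_eq ?_
      rw [Fintype.card_fin, ← neg_sub, neg_sq]

/-- With probability tending to one, the threshold is close to `b u n` and the number of
exceedances is `k n - o(√k n)`. -/
theorem IntermediateRegime.tendsto_bad (h : IntermediateRegime μ r A p k u b) {V : Set ℝ≥0}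
    (hV : V ∈ 𝓝 b) {δ : ℝ} (hδ : 0 < δ) :
    Tendsto (fun n => (Measure.pi fun _ : Fin n => μ).real
      {x | ¬ (topStat (fun i => r (x i)) (k n) / u n ∈ V ∧
        (k n : ℝ) - (topSet (fun i => r (x i)) (k n)).card ≤ δ * √(k n : ℝ))}) atTop (𝓝 0) := by
  rw [Metric.tendsto_nhds]
  intro ε hε
  -- The constant is chosen so that the tie bound `n * c / (δ * √k)` becomes exactly `ε / 2`.
  have hat := h.atom.eventually (gt_mem_nhds (show 0 < ε / 2 * δ by positivity))
  obtain ⟨pa, hpa, pb, hpb, hab⟩ := eventually_prod_iff.1 hat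
  obtain ⟨W, hW, hWo, hbW⟩ := mem_nhds_iff.1 (inter_mem hV (inter_mem hpb (lt_mem_nhds h.b_pos)))
  filter_upwards [hpa, (h.tendsto_threshold (hWo.mem_nhds hbW)).eventually
    (gt_mem_nhds (half_pos hε)), h.tendsto_u.eventually_gt_atTop 0,
    h.tendsto_k.eventually_gt_atTop 0, eventually_gt_atTop 0] with n hn hth hu hkn hn0
  have hk0 : 0 < √(k n : ℝ) := Real.sqrt_pos.2 (Nat.cast_pos.2 hkn)
  have hn0' : (0 : ℝ) < n := Nat.cast_pos.2 hn0
  rw [Real.dist_eq, sub_zero, abs_of_nonneg measureReal_nonneg]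
  set J : Set ℝ≥0 := {s | s / u n ∈ W} with hJ
  have hJm : MeasurableSet J := (measurable_id.div_const (u n)) hWo.measurableSet
  have hJ0 : ∀ s ∈ J, 0 < s := fun s hs => by
    have h1 : 0 < s / u n := (hW hs).2.2
    exact (div_pos_iff_of_pos_right hu).1 h1
  have hJc : ∀ s ∈ J, μ.real {y | r y = s} ≤ ε / 2 * δ * √(k n : ℝ) / n := fun s hs => by
    have h1 := hab hn (hW hs).2.1
    simp only at h1
    rw [mul_div_cancel₀ _ hu.ne', div_mul_eq_mul_div, div_lt_iff₀ hk0] at h1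
    rw [le_div_iff₀ hn0', mul_comm]
    exact h1.le
  have htie := measure_card_topSet_le (ι := Fin n) μ h.risk.measurable (k n) hJm hJ0
    (by positivity) hJc (mul_pos hδ hk0)
  have hval : (Fintype.card (Fin n) : ℝ) * (ε / 2 * δ * √(k n : ℝ) / n) / (δ * √(k n : ℝ)) = ε / 2 := by
    rw [Fintype.card_fin]
    field_simp
  rw [hval] at htie
  refine lt_of_le_of_lt ((measureReal_mono ?_).trans (measureReal_union_le _ _))
    (lt_of_lt_of_le (add_lt_add_of_lt_of_le hth htie) (add_halves ε).le)
  intro x hx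
  rw [Set.mem_ofPred_eq] at hx
  by_cases hx1 : topStat (fun i => r (x i)) (k n) / u n ∈ W
  · right
    refine ⟨hx1, ?_⟩
    by_contra h2
    exact hx ⟨(hW hx1).1, (not_le.1 h2).le⟩
  · exact Or.inl hx1

end OneSample

/-! ### Characteristic function of the cell frequencies. -/

section CellCounts

variable {d K : ℕ} {μ : Measure (Orthant d)} [IsProbabilityMeasure μ] {r : Orthant d → ℝ≥0}
  {A : Fin K → Set (Orthant d)} {p : Fin K → ℝ} {k : ℕ → ℕ} {u : ℕ → ℝ≥0} {b : ℝ≥0}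

lemma IsAdmissiblePartition.eq_of_mem (hA : IsAdmissiblePartition r A) {i j : Fin K}
    {x : Orthant d} (hi : x ∈ A i) (hj : x ∈ A j) : i = j := by
  by_contra h
  exact Set.disjoint_left.1 (hA.disjoint h) hi hj

open Classical in
/-- The weight `β j` of the cell `A j` containing `x / u`. -/
noncomputable def cellWeight (A : Fin K → Set (Orthant d)) (β : Fin K → ℝ) (u : ℝ≥0)
    (x : Orthant d) : ℝ := ∑ j, β j * if u⁻¹ • x ∈ A j then 1 else 0

lemma cellWeight_of_mem (hA : IsAdmissiblePartition r A) (β : Fin K → ℝ) {u : ℝ≥0}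
    {x : Orthant d} {j : Fin K} (hx : u⁻¹ • x ∈ A j) : cellWeight A β u x = β j := by
  classical
  rw [cellWeight, Finset.sum_eq_single j]
  · simp [hx]
  · intro i _ hij
    rw [if_neg fun hi => hij (hA.eq_of_mem hi hx), mul_zero]
  · simp

lemma measurable_cellWeight (hA : IsAdmissiblePartition r A) (β : Fin K → ℝ) :
    Measurable (Function.uncurry (cellWeight A β)) := by
  classical
  have hm : Measurable fun q : ℝ≥0 × Orthant d => q.1⁻¹ • q.2 :=
    measurable_fst.inv.smul measurable_snd
  refine Finset.measurable_fun_sum Finset.univ fun j _ => Measurable.const_mul ?_ (β j)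
  exact Measurable.ite (hm (hA.measurableSet j)) measurable_const measurable_const

/-- The characteristic factor of one exceedance. -/
noncomputable def cellFactor (A : Fin K → Set (Orthant d)) (β : Fin K → ℝ) (s : ℝ) (u : ℝ≥0)
    (x : Orthant d) : ℂ := Complex.exp (Complex.I * (cellWeight A β u x / s))

lemma norm_cellFactor (β : Fin K → ℝ) (s : ℝ) (u : ℝ≥0) (x : Orthant d) :
    ‖cellFactor A β s u x‖ = 1 := by
  rw [cellFactor, ← Complex.ofReal_div, mul_comm, Complex.norm_exp_ofReal_mul_I]

lemma measurable_cellFactor (hA : IsAdmissiblePartition r A) (β : Fin K → ℝ) (s : ℝ) :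
    Measurable (Function.uncurry (cellFactor A β s)) :=
  Complex.measurable_exp.comp (measurable_const.mul
    ((Complex.measurable_ofReal.comp (measurable_cellWeight hA β)).div_const _))

lemma exists_mem_of_exceedance (hr : IsRiskFunctional r) (hA : IsAdmissiblePartition r A)
    {u : ℝ≥0} (hu : 0 < u) {x : Orthant d} (hx : u < r x) : ∃ j, u⁻¹ • x ∈ A j := by
  have : x ∈ u • exceedanceSet r := by rw [smul_exceedanceSet hr hu]; exact hx
  rw [Set.mem_smul_set_iff_inv_smul_mem₀ hu.ne', ← hA.iUnion_eq, Set.mem_iUnion] at this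
  exact this

lemma lt_of_inv_smul_mem (hr : IsRiskFunctional r) (hA : IsAdmissiblePartition r A)
    {u : ℝ≥0} (hu : 0 < u) {x : Orthant d} {j : Fin K} (hx : u⁻¹ • x ∈ A j) : u < r x := by
  rw [← Set.mem_smul_set_iff_inv_smul_mem₀ hu.ne'] at hx
  exact hA.smul_subset hr j hu hx

lemma condMean_cellFactor (hr : IsRiskFunctional r) (hA : IsAdmissiblePartition r A)
    (β : Fin K → ℝ) (s : ℝ) {u : ℝ≥0} (hu : 0 < u) :
    condMean μ r (cellFactor A β s) u
      = ∑ j, (condProb μ r (A j) u : ℂ) * Complex.exp (Complex.I * (β j / s)) := by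
  have hpt : (fun y => if u < r y then cellFactor A β s u y else 0) = fun y => ∑ j,
      Set.indicator (u • A j) (fun _ => Complex.exp (Complex.I * (β j / s))) y := by
    funext y
    by_cases hy : u < r y
    · obtain ⟨j, hj⟩ := exists_mem_of_exceedance hr hA hu hy
      rw [if_pos hy, cellFactor, cellWeight_of_mem hA β hj, Finset.sum_eq_single j]
      · rw [Set.indicator_of_mem]
        rwa [Set.mem_smul_set_iff_inv_smul_mem₀ hu.ne']
      · intro i _ hij
        rw [Set.indicator_of_notMem]
        rw [Set.mem_smul_set_iff_inv_smul_mem₀ hu.ne']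
        exact fun hi => hij (hA.eq_of_mem hi hj)
      · simp
    · rw [if_neg hy]
      refine (Finset.sum_eq_zero fun j _ => Set.indicator_of_notMem (fun hj => hy ?_) _).symm
      exact hA.smul_subset hr j hu hj
  have hm : ∀ j, MeasurableSet (u • A j) := fun j => measurableSet_smul_set hu (hA.measurableSet j)
  rw [condMean, hpt, integral_finsetSum _ fun j _ => (integrable_const _).indicator (hm j),
    Finset.sum_div]
  refine Finset.sum_congr rfl fun j _ => ?_
  rw [integral_indicator_const _ (hm j), condProb_eq hr hA j hu, Complex.real_smul]
  push_cast
  ring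

/-- Second-order expansion of the conditional characteristic function of one exceedance, for
centred weights. -/
lemma IntermediateRegime.tendsto_condMean (h : IntermediateRegime μ r A p k u b) {β : Fin K → ℝ}
    (hβ : ∑ j, β j * p j = 0) :
    Tendsto (fun z : ℕ × ℝ≥0 => (k z.1 : ℂ) *
      (condMean μ r (cellFactor A β √(k z.1 : ℝ)) (u z.1 * z.2) - 1)) (atTop ×ˢ 𝓝 b)
      (𝓝 ((-(∑ j, β j ^ 2 * p j) / 2 : ℝ) : ℂ)) := by
  have hs : Tendsto (fun z : ℕ × ℝ≥0 => √(k z.1 : ℝ)) (atTop ×ˢ 𝓝 b) atTop :=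
    (tendsto_sqrt_natCast_atTop h.tendsto_k).comp tendsto_fst
  have hinv : Tendsto (fun z : ℕ × ℝ≥0 => (√(k z.1 : ℝ))⁻¹) (atTop ×ˢ 𝓝 b) (𝓝 0) :=
    tendsto_inv_atTop_zero.comp hs
  have hcp : ∀ j, Tendsto (fun z : ℕ × ℝ≥0 => condProb μ r (A j) (u z.1 * z.2)) (atTop ×ˢ 𝓝 b)
      (𝓝 (p j)) := by
    intro j
    have h1 := (hinv.mul (h.bias j)).add_const (p j)
    rw [zero_mul, zero_add] at h1
    refine h1.congr' ?_
    filter_upwards [hs.eventually_gt_atTop 0] with z hz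
    field_simp
    ring
  have hsum := tendsto_finsetSum Finset.univ fun j _ => hcp j
  rw [h.sum_prob] at hsum
  have hpos := eventually_pos_of_nhds h.b_pos h.tendsto_u
  have hone : ∀ᶠ z : ℕ × ℝ≥0 in atTop ×ˢ 𝓝 b, ∑ j, condProb μ r (A j) (u z.1 * z.2) = 1 := by
    filter_upwards [hpos, hsum.eventually (lt_mem_nhds one_pos)] with z hz hz1
    have hu := mul_pos hz.1 hz.2
    simp only [condProb_eq h.risk h.partition _ hu, ← Finset.sum_div,
      h.partition.sum_real_smul h.risk hu] at hz1 ⊢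
    exact div_self fun h0 => by simp [h0] at hz1
  have hb : ∀ j, Tendsto (fun z : ℕ × ℝ≥0 =>
      ((√(k z.1 : ℝ) * (condProb μ r (A j) (u z.1 * z.2) - p j) : ℝ) : ℂ)) (atTop ×ˢ 𝓝 b) (𝓝 0) :=
    fun j => (Complex.continuous_ofReal.tendsto 0).comp (h.bias j)
  -- With `c_j` the conditional probabilities and `s = √k`, the summand `s² c_j (e^{iβ_j/s} - 1)`
  -- splits into `s (c_j - p_j) · s (e^{iβ_j/s} - 1)`, where the bias enters, plus `p_j s²
  -- (e^{iβ_j/s} - 1 - iβ_j/s)`, plus a term `i s β_j p_j` whose sum vanishes by centring.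
  have hmain := tendsto_finsetSum Finset.univ fun j _ =>
    ((hb j).mul (tendsto_mul_exp_sub_one hs (β j))).add
      ((tendsto_sq_mul_exp_sub hs (β j)).const_mul (p j : ℂ))
  have hlim : ∑ j, (0 * (Complex.I * β j) + (p j : ℂ) * (-(β j : ℂ) ^ 2 / 2))
      = ((-(∑ j, β j ^ 2 * p j) / 2 : ℝ) : ℂ) := by
    push_cast
    rw [← Finset.sum_neg_distrib, Finset.sum_div]
    exact Finset.sum_congr rfl fun j _ => by ring
  rw [hlim] at hmain
  refine hmain.congr' ?_
  filter_upwards [hpos, hone, hs.eventually_gt_atTop 0] with z hz hz1 hsz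
  set s := √(k z.1 : ℝ) with hsdef
  have hs2 : (k z.1 : ℂ) = (s : ℂ) ^ 2 := by
    rw [← Complex.ofReal_pow, hsdef, Real.sq_sqrt (Nat.cast_nonneg _)]
    simp
  have hsC : (s : ℂ) ≠ 0 := by exact_mod_cast hsz.ne'
  rw [condMean_cellFactor h.risk h.partition β s (mul_pos hz.1 hz.2), hs2]
  have h1 : (1 : ℂ) = ∑ j, (condProb μ r (A j) (u z.1 * z.2) : ℂ) := by
    rw [← Complex.ofReal_sum, hz1, Complex.ofReal_one]
  have hβC : ∑ j, (s : ℂ) * Complex.I * ((β j : ℂ) * p j) = 0 := by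
    rw [← Finset.mul_sum]
    have : ∑ j, (β j : ℂ) * p j = 0 := by exact_mod_cast congrArg (fun t : ℝ => (t : ℂ)) hβ
    rw [this, mul_zero]
  conv_rhs => rw [h1, ← Finset.sum_sub_distrib, Finset.mul_sum]
  rw [← sub_eq_zero, ← Finset.sum_sub_distrib, ← neg_eq_zero, ← Finset.sum_neg_distrib, ← hβC]
  refine Finset.sum_congr rfl fun j _ => ?_
  push_cast
  field_simp
  ring

/-- Limit of the characteristic function of the centred cell counts. -/
lemma IntermediateRegime.tendsto_integral_prod (h : IntermediateRegime μ r A p k u b)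
    {β : Fin K → ℝ} (hβ : ∑ j, β j * p j = 0) :
    Tendsto (fun n => ∫ x : Fin n → Orthant d, ∏ i ∈ topSet (fun i => r (x i)) (k n),
      cellFactor A β √(k n : ℝ) (topStat (fun i => r (x i)) (k n)) (x i) ∂(Measure.pi fun _ => μ))
      atTop (𝓝 (Real.exp (-(∑ j, β j ^ 2 * p j) / 2) : ℂ)) := by
  have hr := h.risk.measurable
  have hg := fun n => measurable_cellFactor h.partition β √(k n : ℝ)
  have hg1 : ∀ n u x, ‖cellFactor A β √(k n : ℝ) u x‖ ≤ 1 := fun n u x => (norm_cellFactor _ _ _ _).le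
  simp_rw [fun n => integral_prod_topSet (ι := Fin n) μ hr (k n) (hg n) (hg1 n)]
  set ζ : ℝ := -(∑ j, β j ^ 2 * p j) / 2 with hζdef
  have hζ : ζ ≤ 0 := by
    have : 0 ≤ ∑ j, β j ^ 2 * p j :=
      Finset.sum_nonneg fun j _ => mul_nonneg (sq_nonneg _) (h.prob_nonneg j)
    rw [hζdef]
    linarith
  refine tendsto_integral_of_eventually_close (M := 1) _ _ (fun n => ?_) (fun n x => ?_)
    fun δ hδ => ?_
  · exact measurable_topSet_comp (F := fun S x => condMean μ r (cellFactor A β √(k n : ℝ))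
      (topStat (fun i => r (x i)) (k n)) ^ S.card) hr (k n) fun S =>
      ((measurable_condMean hr (hg n)).comp (measurable_topStat_comp hr (k n))).pow_const _
  · rw [norm_pow]
    exact pow_le_one₀ (norm_nonneg _) (norm_condMean_le hr (hg1 n) _)
  · obtain ⟨pa, hpa, pb, hpb, hab⟩ := eventually_prod_iff.1
      ((h.tendsto_condMean hβ).eventually (Metric.ball_mem_nhds _ (show 0 < δ / 3 by positivity)))
    -- With centred weights a deficit of `√(k n)` exceedances is harmless, being small relative to
    -- `k n`.
    refine ⟨_, h.tendsto_bad hpb (show 0 < (1 : ℝ) from one_pos), ?_⟩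
    have hsq := tendsto_sqrt_natCast_atTop h.tendsto_k
    have e1 : Tendsto (fun n => ζ ^ 2 / (k n : ℝ)) atTop (𝓝 0) :=
      (tendsto_natCast_atTop_atTop.comp h.tendsto_k).const_div_atTop _
    have e2 : Tendsto (fun n => |ζ| / √(k n : ℝ)) atTop (𝓝 0) := hsq.const_div_atTop _
    filter_upwards [hpa, h.tendsto_u.eventually_gt_atTop 0, h.tendsto_k.eventually_gt_atTop 0,
      e1.eventually (gt_mem_nhds (show 0 < δ / 3 by positivity)),
      e2.eventually (gt_mem_nhds (show 0 < δ / 3 by positivity)),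
      (tendsto_natCast_atTop_atTop.comp h.tendsto_k).eventually_ge_atTop |ζ|]
      with n hn hu hk h1 h2 hζk x hx
    simp only [not_not] at hx
    obtain ⟨hx1, hx2⟩ := hx
    have hk0 : (0 : ℝ) < k n := Nat.cast_pos.2 hk
    have hz := hab hn hx1
    simp only [mul_div_cancel₀ _ hu.ne'] at hz
    rw [dist_eq_norm] at hz
    have hfin := norm_pow_sub_exp_le (norm_condMean_le (μ := μ) hr (hg1 n)
      (topStat (fun i => r (x i)) (k n))) hζ (card_topSet_le (fun i => r (x i)) (k n)) hk hζk
    refine hfin.trans ?_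
    have h3 : |ζ| * (((k n : ℝ) - (topSet (fun i => r (x i)) (k n)).card) / k n)
        ≤ |ζ| / √(k n : ℝ) := by
      have h4 : ((k n : ℝ) - (topSet (fun i => r (x i)) (k n)).card) / k n ≤ 1 / √(k n : ℝ) := by
        rw [one_mul] at hx2
        refine (div_le_div_of_nonneg_right hx2 hk0.le).trans_eq ?_
        rw [Real.sqrt_div_self, one_div]
      refine (mul_le_mul_of_nonneg_left h4 (abs_nonneg ζ)).trans_eq ?_
      rw [mul_one_div]
    linarith

open Classical in
/-- The cell frequencies above the threshold, for a finite sample. -/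
noncomputable def cellFreq {ι : Type*} [Fintype ι] (r : Orthant d → ℝ≥0) (B : Set (Orthant d))
    (k : ℕ) (x : ι → Orthant d) : ℝ :=
  (1 / (k : ℝ)) * ∑ i, if x i ∈ topStat (fun l => r (x l)) k • B then (1 : ℝ) else 0

lemma estProb_eq_cellFreq (r : Orthant d → ℝ≥0) (B : Set (Orthant d)) {n k : ℕ} (hk : k ≤ n)
    (x : ℕ → Orthant d) : estProb r B n k x = cellFreq r B k fun i : Fin n => x i := by
  classical
  rw [estProb, cellFreq, orderStat_eq_topStat _ hk, Finset.sum_range]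

lemma measurable_cellFreq {ι : Type*} [Fintype ι] (hr : Measurable r) {B : Set (Orthant d)}
    (hB : MeasurableSet B) (k : ℕ) : Measurable fun x : ι → Orthant d => cellFreq r B k x := by
  classical
  refine measurable_const.mul (Finset.measurable_sum _ fun i _ =>
    Measurable.ite ?_ measurable_const measurable_const)
  have hR := measurable_topStat_comp (ι := ι) hr k
  -- At threshold zero, scaling by the inverse does not describe membership in `0 • B`, so that case
  -- is split off.
  have hset : {x : ι → Orthant d | x i ∈ topStat (fun l => r (x l)) k • B}
      = ({x | topStat (fun l => r (x l)) k = 0} ∩ {x | x i ∈ (0 : ℝ≥0) • B}) ∪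
        ({x | topStat (fun l => r (x l)) k = 0}ᶜ ∩
          {x | (topStat (fun l => r (x l)) k)⁻¹ • x i ∈ B}) := by
    ext x
    simp only [Set.mem_ofPred_eq, Set.mem_union, Set.mem_inter_iff, Set.mem_compl_iff]
    by_cases h0 : topStat (fun l => r (x l)) k = 0
    · simp [h0]
    · simp [h0, Set.mem_smul_set_iff_inv_smul_mem₀]
  rw [hset]
  have h0 : MeasurableSet {x : ι → Orthant d | topStat (fun l => r (x l)) k = 0} :=
    measurableSet_eq_fun hR measurable_const
  have h1 : MeasurableSet ((0 : ℝ≥0) • B) := by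
    rcases B.eq_empty_or_nonempty with rfl | hne
    · simp
    · rw [Set.zero_smul_set hne]
      exact measurableSet_singleton _
  refine (h0.inter (measurable_pi_apply i h1)).union (h0.compl.inter ?_)
  exact (hR.inv.smul (measurable_pi_apply i)) hB

lemma sum_mul_cellFreq {ι : Type*} [Fintype ι] (hr : IsRiskFunctional r)
    (hA : IsAdmissiblePartition r A) (θ : Fin K → ℝ) (k : ℕ) {x : ι → Orthant d}
    (hx : 0 < topStat (fun i => r (x i)) k) :
    ∑ j, θ j * cellFreq r (A j) k x
      = (1 / (k : ℝ)) * ∑ i ∈ topSet (fun i => r (x i)) k,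
        cellWeight A θ (topStat (fun i => r (x i)) k) (x i) := by
  classical
  set R := topStat (fun i => r (x i)) k with hR
  have h1 : ∑ i ∈ topSet (fun i => r (x i)) k, cellWeight A θ R (x i)
      = ∑ i, cellWeight A θ R (x i) := by
    refine Finset.sum_subset (Finset.subset_univ _) fun i _ hi => ?_
    have hi' : ¬ R < r (x i) := fun h' => hi (by simpa [topSet] using h')
    rw [cellWeight]
    refine Finset.sum_eq_zero fun j _ => ?_
    rw [if_neg fun hj => hi' (lt_of_inv_smul_mem hr hA hx hj), mul_zero]
  rw [h1]
  simp only [cellWeight, cellFreq, ← hR, Set.mem_smul_set_iff_inv_smul_mem₀ hx.ne']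
  rw [Finset.sum_comm, Finset.mul_sum]
  refine Finset.sum_congr rfl fun j _ => ?_
  rw [← Finset.mul_sum]
  ring

lemma prod_cellFactor {ι : Type*} (β : Fin K → ℝ) (s : ℝ) (S : Finset ι)
    (R : ℝ≥0) (x : ι → Orthant d) :
    ∏ i ∈ S, cellFactor A β s R (x i)
      = Complex.exp (Complex.I * ((∑ i ∈ S, cellWeight A β R (x i) : ℝ) / s)) := by
  simp only [cellFactor]
  rw [← Complex.exp_sum, ← Finset.mul_sum, ← Finset.sum_div]
  push_cast
  rfl

/-- Asymptotic normality of the cell frequencies, in terms of characteristic functions. -/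
theorem IntermediateRegime.tendsto_charFun (h : IntermediateRegime μ r A p k u b)
    (θ : Fin K → ℝ) :
    Tendsto (fun n => ∫ x : Fin n → Orthant d, Complex.exp (Complex.I *
      ((∑ j, θ j * (√(k n : ℝ) * (cellFreq r (A j) (k n) x - p j)) : ℝ) : ℂ))
      ∂(Measure.pi fun _ => μ)) atTop
      (𝓝 (Real.exp (-(∑ j, θ j ^ 2 * p j - (∑ j, θ j * p j) ^ 2) / 2) : ℂ)) := by
  set m := ∑ j, θ j * p j with hm
  -- Centring the weights subtracts `m` per exceedance, hence `m * k` in total when there are no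
  -- ties; this matches the centring by `p j`.
  let β : Fin K → ℝ := fun j => θ j - m
  have hβ : ∑ j, β j * p j = 0 := by
    simp only [β, sub_mul, Finset.sum_sub_distrib, ← Finset.mul_sum, h.sum_prob]
    rw [← hm]; ring
  have hvar : ∑ j, β j ^ 2 * p j = ∑ j, θ j ^ 2 * p j - m ^ 2 := by
    have : ∀ j, β j ^ 2 * p j = θ j ^ 2 * p j - 2 * m * (θ j * p j) + m ^ 2 * p j := fun j => by
      simp only [β]; ring
    simp only [this, Finset.sum_add_distrib, Finset.sum_sub_distrib, ← Finset.mul_sum, h.sum_prob]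
    rw [← hm]; ring
  have hmain := h.tendsto_integral_prod hβ
  rw [hvar] at hmain
  have hr := h.risk.measurable
  let F : ∀ n, (Fin n → Orthant d) → ℂ := fun n x => Complex.exp (Complex.I *
      ((∑ j, θ j * (√(k n : ℝ) * (cellFreq r (A j) (k n) x - p j)) : ℝ) : ℂ))
  let G : ∀ n, (Fin n → Orthant d) → ℂ := fun n x => ∏ i ∈ topSet (fun i => r (x i)) (k n),
      cellFactor A β √(k n : ℝ) (topStat (fun i => r (x i)) (k n)) (x i)
  have hFm : ∀ n, Measurable (F n) := fun n => by
    refine Complex.measurable_exp.comp (measurable_const.mul (Complex.measurable_ofReal.comp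
      (Finset.measurable_sum _ fun j _ => measurable_const.mul (measurable_const.mul
        ((measurable_cellFreq hr (h.partition.measurableSet j) (k n)).sub_const _)))))
  have hGm : ∀ n, Measurable (G n) := fun n =>
    measurable_topSet_comp (F := fun S x => ∏ i ∈ S, cellFactor A β √(k n : ℝ)
      (topStat (fun i => r (x i)) (k n)) (x i)) hr (k n) fun S =>
      measurable_prod_topStat hr (k n) S (measurable_cellFactor h.partition β _)
  have hF1 : ∀ n x, ‖F n x‖ = 1 := fun n x => by
    simp only [F]
    rw [mul_comm, Complex.norm_exp_ofReal_mul_I]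
  have hG1 : ∀ n x, ‖G n x‖ = 1 := fun n x => by
    simp only [G, norm_prod, norm_cellFactor, Finset.prod_const_one]
  have hdiff : Tendsto (fun n => ∫ x, (F n x - G n x) ∂(Measure.pi fun _ : Fin n => μ)) atTop
      (𝓝 0) := by
    refine tendsto_integral_of_eventually_close (M := 2) _ _ (fun n => (hFm n).sub (hGm n))
      (fun n x => (norm_sub_le _ _).trans (by rw [hF1, hG1]; norm_num)) fun δ hδ => ?_
    have hm1 : 0 < |m| + 1 := by positivity
    -- Here the deficit `k - N` must be `o(√k)`: replacing `k` by the number `N` of exceedances in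
    -- the centring shifts the phase by `m * (k - N) / √k`.
    refine ⟨_, h.tendsto_bad (lt_mem_nhds h.b_pos) (div_pos hδ hm1), ?_⟩
    filter_upwards [h.tendsto_u.eventually_gt_atTop 0, h.tendsto_k.eventually_gt_atTop 0]
      with n hu hk x hx
    simp only [not_not] at hx
    obtain ⟨hx1, hx2⟩ := hx
    have hR : 0 < topStat (fun i => r (x i)) (k n) := (div_pos_iff_of_pos_right hu).1 hx1
    have hk0 : (0 : ℝ) < k n := Nat.cast_pos.2 hk
    set s := √(k n : ℝ) with hs
    have hs0 : 0 < s := Real.sqrt_pos.2 hk0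
    have hs2 : s * s = k n := Real.mul_self_sqrt hk0.le
    set N := (topSet (fun i => r (x i)) (k n)).card with hN
    set R := topStat (fun i => r (x i)) (k n) with hRdef
    have hw : ∑ i ∈ topSet (fun i => r (x i)) (k n), cellWeight A β R (x i)
        = ∑ i ∈ topSet (fun i => r (x i)) (k n), cellWeight A θ R (x i) - m * N := by
      have : ∀ i ∈ topSet (fun i => r (x i)) (k n),
          cellWeight A β R (x i) = cellWeight A θ R (x i) - m := by
        intro i hi
        obtain ⟨j, hj⟩ := exists_mem_of_exceedance h.risk h.partition hR
          (show R < r (x i) from (Finset.mem_filter.1 hi).2)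
        rw [cellWeight_of_mem h.partition β hj, cellWeight_of_mem h.partition θ hj]
      rw [Finset.sum_congr rfl this, Finset.sum_sub_distrib, Finset.sum_const, nsmul_eq_mul, mul_comm]
    have hlin : ∑ j, θ j * (s * (cellFreq r (A j) (k n) x - p j))
        = (∑ i ∈ topSet (fun i => r (x i)) (k n), cellWeight A β R (x i)) / s
          - m * ((k n - N) / s) := by
      have h1 : ∑ j, θ j * (s * (cellFreq r (A j) (k n) x - p j))
          = s * (∑ j, θ j * cellFreq r (A j) (k n) x - m) := by
        rw [hm, ← Finset.sum_sub_distrib, Finset.mul_sum]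
        exact Finset.sum_congr rfl fun j _ => by ring
      rw [h1, sum_mul_cellFreq h.risk h.partition θ (k n) hR, hw, ← hs2]
      field_simp
      ring
    have hFG : F n x = G n x * Complex.exp (((-(m * ((k n - N) / s)) : ℝ) : ℂ) * Complex.I) := by
      simp only [F, G]
      rw [prod_cellFactor, ← Complex.exp_add, ← hs, hlin]
      congr 1
      push_cast
      ring
    have h3 : F n x - G n x - 0
        = G n x * (Complex.exp (((-(m * ((k n - N) / s)) : ℝ) : ℂ) * Complex.I) - 1) := by
      rw [hFG]; ring
    rw [h3, norm_mul, hG1, one_mul, mul_comm (((-(m * ((k n - N) / s)) : ℝ) : ℂ)) Complex.I]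
    refine Real.norm_exp_I_mul_ofReal_sub_one_le.trans ?_
    have hNk : (0 : ℝ) ≤ (k n - N) / s :=
      div_nonneg (sub_nonneg.2 (Nat.cast_le.2 (card_topSet_le _ _))) hs0.le
    rw [Real.norm_eq_abs, abs_neg, abs_mul, abs_of_nonneg hNk]
    have h4 : ((k n : ℝ) - N) / s ≤ δ / (|m| + 1) := (div_le_iff₀ hs0).2 hx2
    calc |m| * ((k n - N) / s) ≤ |m| * (δ / (|m| + 1)) := by gcongr
      _ ≤ (|m| + 1) * (δ / (|m| + 1)) := by gcongr; linarith
      _ = δ := by field_simp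
  have hsum := hdiff.add hmain
  rw [zero_add] at hsum
  refine hsum.congr fun n => ?_
  have hGi : Integrable (G n) (Measure.pi fun _ : Fin n => μ) :=
    Integrable.of_bound (hGm n).aestronglyMeasurable 1 (ae_of_all _ fun x => (hG1 n x).le)
  have hFi : Integrable (F n) (Measure.pi fun _ : Fin n => μ) :=
    Integrable.of_bound (hFm n).aestronglyMeasurable 1 (ae_of_all _ fun x => (hF1 n x).le)
  rw [integral_sub hFi hGi]
  exact sub_add_cancel _ _

end CellCounts

/-! ### From the second-order condition to the intermediate regime. -/

section Regime

variable {d K : ℕ} {μ ν : Measure (Orthant d)} {a : ℝ≥0 → ℝ} {r : Orthant d → ℝ≥0}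
  {A : Fin K → Set (Orthant d)} {k : ℕ → ℕ}

lemma tendsto_natCast_div_atTop (hk : Tendsto k atTop atTop)
    (hkn : Tendsto (fun n : ℕ => (k n : ℝ) / (n : ℝ)) atTop (𝓝 0)) :
    Tendsto (fun n : ℕ => (n : ℝ) / (k n : ℝ)) atTop atTop := by
  have h : Tendsto (fun n : ℕ => (k n : ℝ) / (n : ℝ)) atTop (𝓝[>] 0) := by
    refine tendsto_nhdsWithin_iff.2 ⟨hkn, ?_⟩
    filter_upwards [hk.eventually_gt_atTop 0, eventually_gt_atTop 0] with n h1 h2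
    exact Set.mem_Ioi.2 (div_pos (Nat.cast_pos.2 h1) (Nat.cast_pos.2 h2))
  refine h.inv_tendsto_nhdsGT_zero.congr fun n => ?_
  rw [Pi.inv_apply, inv_div]

lemma eventually_intermediate_le (hkn : Tendsto (fun n : ℕ => (k n : ℝ) / (n : ℝ)) atTop (𝓝 0)) :
    ∀ᶠ n in atTop, k n ≤ n := by
  filter_upwards [hkn.eventually (gt_mem_nhds one_pos), eventually_gt_atTop 0] with n h1 h2
  rw [div_lt_one (Nat.cast_pos.2 h2)] at h1
  exact_mod_cast h1.le

lemma limProb_eq [IsProbabilityMeasure μ] (hpar : HasParetoMargins μ)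
    (hν : IsExceedanceDistribution μ ν)
    (ha : SecondOrderCondition μ ν a) (hr : IsRiskFunctional r) (hA : IsAdmissiblePartition r A)
    (hbd : ∀ j, exponentMeasure ν (frontier (A j)) = 0)
    (hpos : 0 < exponentMeasure ν (exceedanceSet r)) (j : Fin K) :
    limProb μ r (A j) = (exponentMeasure ν (A j)).toReal / exceedanceMass ν r :=
  (tendsto_condProb hpar hν ha hr hA hbd hpos j).limUnder_eq

/-- The second-order condition yields an intermediate regime at the scale `U(n / k_n)`. -/
theorem SecondOrderCondition.intermediateRegime [IsProbabilityMeasure μ]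
    (ha : SecondOrderCondition μ ν a) (hν : IsExceedanceDistribution μ ν)
    (hpar : HasParetoMargins μ) (hr : IsRiskFunctional r) (hA : IsAdmissiblePartition r A)
    (hbd : ∀ j, exponentMeasure ν (frontier (A j)) = 0)
    (hpos : 0 < exponentMeasure ν (exceedanceSet r)) (hk : Tendsto k atTop atTop)
    (hkn : Tendsto (fun n : ℕ => (k n : ℝ) / (n : ℝ)) atTop (𝓝 0))
    (hka : Tendsto (fun n : ℕ => √(k n : ℝ) * a (tailQuantile μ ((n : ℝ) / (k n : ℝ)))) atTop
      (𝓝 0)) :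
    IntermediateRegime μ r A (fun j => limProb μ r (A j)) k
      (fun n => tailQuantile μ ((n : ℝ) / (k n : ℝ))) (exceedanceMass ν r) := by
  have hb := exceedanceMass_pos hν ha hr hA hpos
  have hT := tendsto_natCast_div_atTop hk hkn
  have htail := tail_pos hpar hν.dim_pos
  have hu := tendsto_tailQuantile_atTop htail hT
  have hV := tendsto_mul_tail_tailQuantile hν ha htail hT
  simp only [limProb_eq hpar hν ha hr hA hbd hpos]
  refine ⟨hr, hA, ?_, fun j => by positivity, hk, hu, hb, fun j => ?_, fun t ht => ?_, ?_⟩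
  · rw [← Finset.sum_div, sum_exponentMeasure_toReal hν ha hr hA, div_self]
    exact_mod_cast hb.ne'
  · exact tendsto_condProb_bias hpar hν ha hr hA hbd hpos hu (w := fun n => √(k n : ℝ)) hka j
  -- Since `(n / k) P(‖X‖ > U(n / k)) → 1`, ratios to the tail of the norm may be replaced by
  -- multiples of `n / k`.
  · have h := hV.mul (tendsto_exceedance_ratio hν ha hr hA hbd hu ht)
    rw [one_mul] at h
    refine h.congr fun n => ?_
    rw [mul_assoc, mul_div_cancel₀ _ (htail _).ne']
  · have h := (hV.comp tendsto_fst).mul (tendsto_atom hν ha hr hA hbd hu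
      (w := fun n => √(k n : ℝ)) (fun n => Real.sqrt_nonneg _) hka hb)
    rw [mul_zero] at h
    refine h.congr' ?_
    filter_upwards [(hk.eventually_gt_atTop 0).prod_inl (𝓝 (exceedanceMass ν r))] with z hz
    have hk0 : (0 : ℝ) < k z.1 := Nat.cast_pos.2 hz
    have hs : √(k z.1 : ℝ) ≠ 0 := (Real.sqrt_pos.2 hk0).ne'
    have hv := (htail (tailQuantile μ ((z.1 : ℝ) / (k z.1 : ℝ)))).ne'
    rw [Function.comp_apply]
    nth_rewrite 1 [← Real.mul_self_sqrt hk0.le]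
    generalize μ.real {x | tailQuantile μ ((z.1 : ℝ) / (k z.1 : ℝ)) < supNorm x} = V at *
    field_simp

end Regime

/-! ### Continuous mapping with varying maps, and joint convergence. -/

section ExtendedMapping

variable {Ω E : Type*} [MeasurableSpace Ω] {P : Measure Ω} [IsProbabilityMeasure P]

/-- Tightness from the portmanteau inequality for the closed sets `{x | N ≤ ‖x‖}`, which decrease to
the empty set. -/
lemma exists_tight_of_tendstoInDistribution [NormedAddCommGroup E] [MeasurableSpace E] [BorelSpace E]
    {T : ℕ → Ω → E} {m : Measure E} [IsProbabilityMeasure m]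
    (h : TendstoInDistribution T atTop id (fun _ => P) m) {δ : ℝ≥0∞} (hδ : 0 < δ) :
    ∃ R : ℝ, ∀ᶠ n in atTop, P {ω | R ≤ ‖T n ω‖} < δ := by
  have hanti : Antitone fun N : ℕ => {x : E | (N : ℝ) ≤ ‖x‖} := fun M N hMN x hx =>
    (Nat.cast_le.2 hMN).trans (show (N : ℝ) ≤ ‖x‖ from hx)
  have hcl : ∀ N : ℕ, IsClosed {x : E | (N : ℝ) ≤ ‖x‖} := fun N =>
    isClosed_le continuous_const continuous_norm
  have h0 := tendsto_measure_iInter_atTop (μ := m)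
    (fun N => (hcl N).measurableSet.nullMeasurableSet) hanti ⟨0, measure_ne_top _ _⟩
  have hempty : ⋂ N : ℕ, {x : E | (N : ℝ) ≤ ‖x‖} = ∅ := by
    refine Set.eq_empty_of_forall_notMem fun x hx => ?_
    obtain ⟨N, hN⟩ := exists_nat_gt ‖x‖
    exact absurd (Set.mem_iInter.1 hx N) (not_le.2 hN)
  rw [hempty, measure_empty] at h0
  obtain ⟨N, hN⟩ := (h0.eventually (gt_mem_nhds hδ)).exists
  refine ⟨N, ?_⟩
  have h1 := ProbabilityMeasure.limsup_measure_closed_le_of_tendsto h.tendsto (hcl N)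
  simp only [ProbabilityMeasure.coe_mk, Measure.map_id] at h1
  filter_upwards [eventually_lt_of_limsup_lt (h1.trans_lt hN)] with n hn
  rwa [Measure.map_apply_of_aemeasurable (h.forall_aemeasurable n) (hcl N).measurableSet] at hn

/-- The extended continuous mapping theorem for maps converging uniformly on bounded sets. -/
theorem tendstoInDistribution_comp_of_tendstoUniformlyOn [NormedAddCommGroup E] [MeasurableSpace E]
    [BorelSpace E] {T : ℕ → Ω → E} {m : Measure E} [IsProbabilityMeasure m]
    (h : TendstoInDistribution T atTop id (fun _ => P) m) {G : ℕ → E → ℝ} {g : E → ℝ}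
    (hg : Continuous g) (hm : ∀ n, AEMeasurable (fun ω => G n (T n ω)) P)
    (hG : ∀ R : ℝ, Tendsto (fun z : ℕ × E => G z.1 z.2 - g z.2)
      (atTop ×ˢ 𝓟 {x | ‖x‖ < R}) (𝓝 0)) :
    TendstoInDistribution (fun n ω => G n (T n ω)) atTop g (fun _ => P) m := by
  -- Slutsky: `g (T n)` converges by continuity, and `G n (T n) - g (T n)` tends to zero in
  -- probability, by uniform convergence on a ball that carries most of the mass.
  refine tendstoInDistribution_of_tendstoInMeasure_sub _ _ (h.continuous_comp hg) ?_ hm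
  refine tendstoInMeasure_iff_norm.2 fun ε hε => ?_
  rw [ENNReal.tendsto_nhds_zero]
  intro δ hδ
  obtain ⟨R, hR⟩ := exists_tight_of_tendstoInDistribution h hδ
  have h1 := (Metric.tendsto_nhds.1 (hG R)) ε hε
  rw [eventually_prod_principal_iff] at h1
  filter_upwards [hR, h1] with n hn1 hn2
  refine (measure_mono fun ω hω => ?_).trans hn1.le
  by_contra hlt
  have h2 := hn2 (T n ω) (not_le.1 hlt)
  rw [dist_zero_right] at h2
  simp only [Set.mem_ofPred_eq, Pi.sub_apply, Pi.zero_apply, sub_zero, Function.comp_apply] at hω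
  exact absurd h2 (not_lt.2 hω)

/-- Joint convergence in distribution of independent sequences. -/
lemma tendstoInDistribution_prodMk_of_indepFun {F : Type*} [TopologicalSpace E]
    [SecondCountableTopology E] [MeasurableSpace E] [BorelSpace E] [TopologicalSpace.PseudoMetrizableSpace E]
    [TopologicalSpace F] [TopologicalSpace.PseudoMetrizableSpace F]
    [SecondCountableTopology F] [MeasurableSpace F] [BorelSpace F] {U : ℕ → Ω → E} {V : ℕ → Ω → F}
    {m : Measure E} {m' : Measure F} [IsProbabilityMeasure m] [IsProbabilityMeasure m']
    (hU : TendstoInDistribution U atTop id (fun _ => P) m)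
    (hV : TendstoInDistribution V atTop id (fun _ => P) m')
    (hind : ∀ n, IndepFun (U n) (V n) P) :
    TendstoInDistribution (fun n ω => (U n ω, V n ω)) atTop id (fun _ => P) (m.prod m') := by
  have hm := fun n => (hU.forall_aemeasurable n).prodMk (hV.forall_aemeasurable n)
  refine ⟨hm, aemeasurable_id, ?_⟩
  have h1 := (ProbabilityMeasure.continuous_prod.tendsto _).comp
    (hU.tendsto.prodMk_nhds hV.tendsto)
  simp only [Measure.map_id] at h1 ⊢
  refine h1.congr fun n => ?_
  refine Subtype.ext ?_
  exact ((indepFun_iff_map_prod_eq_prod_map_map (hU.forall_aemeasurable n)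
    (hV.forall_aemeasurable n)).1 (hind n)).symm

end ExtendedMapping

/-! ### The Gaussian limit of multinomial frequencies. -/

section MultinomialLimit

variable {K : ℕ} {p : Fin K → ℝ}

/-- The covariance matrix of one multinomial trial. -/
noncomputable def multinomialCov (p : Fin K → ℝ) : Matrix (Fin K) (Fin K) ℝ :=
  Matrix.diagonal p - Matrix.vecMulVec p p

lemma dotProduct_multinomialCov (p x : Fin K → ℝ) :
    x ⬝ᵥ (multinomialCov p).mulVec x = ∑ j, x j ^ 2 * p j - (∑ j, x j * p j) ^ 2 := by
  rw [multinomialCov, Matrix.sub_mulVec, dotProduct_sub, Matrix.vecMulVec_mulVec]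
  congr 1
  · simp only [dotProduct, Matrix.mulVec_diagonal]
    exact Finset.sum_congr rfl fun j _ => by ring
  · simp only [dotProduct, sq, Finset.sum_mul, Finset.mul_sum, Pi.smul_apply,
      MulOpposite.smul_eq_mul_unop, MulOpposite.unop_op]
    exact Finset.sum_congr rfl fun i _ => Finset.sum_congr rfl fun j _ => by ring

/-- The difference of the two sides is the variance of `x` under the weights `p`. -/
lemma sq_sum_mul_le (hp : ∀ j, 0 ≤ p j) (hs : ∑ j, p j = 1) (x : Fin K → ℝ) :
    (∑ j, x j * p j) ^ 2 ≤ ∑ j, x j ^ 2 * p j := by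
  have h : 0 ≤ ∑ j, (x j - ∑ i, x i * p i) ^ 2 * p j :=
    Finset.sum_nonneg fun j _ => mul_nonneg (sq_nonneg _) (hp j)
  have e : ∑ j, (x j - ∑ i, x i * p i) ^ 2 * p j
      = ∑ j, x j ^ 2 * p j - (∑ i, x i * p i) ^ 2 := by
    set c := ∑ i, x i * p i with hc
    have e1 : ∀ j, (x j - c) ^ 2 * p j = x j ^ 2 * p j - 2 * c * (x j * p j) + c ^ 2 * p j :=
      fun j => by ring
    simp only [e1, Finset.sum_add_distrib, Finset.sum_sub_distrib, ← Finset.mul_sum, hs, ← hc]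
    ring
  linarith

lemma posSemidef_multinomialCov (hp : ∀ j, 0 ≤ p j) (hs : ∑ j, p j = 1) :
    (multinomialCov p).PosSemidef := by
  refine .of_dotProduct_mulVec_nonneg ?_ fun x => ?_
  · ext i j
    simp only [multinomialCov, Matrix.conjTranspose_apply, Matrix.sub_apply, star_trivial,
      Matrix.vecMulVec_apply, mul_comm, Matrix.diagonal_apply, eq_comm (a := i)]
    by_cases h : j = i
    · subst h; rfl
    · rw [if_neg h, if_neg h]
  · rw [star_trivial, dotProduct_multinomialCov]
    exact sub_nonneg.2 (sq_sum_mul_le hp hs x)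

/-- The Gaussian limit law of normalized multinomial frequencies. -/
noncomputable def multinomialLimit (p : Fin K → ℝ) : Measure (EuclideanSpace ℝ (Fin K)) :=
  multivariateGaussian 0 (multinomialCov p)

instance : IsProbabilityMeasure (multinomialLimit p) := by
  unfold multinomialLimit
  infer_instance

lemma charFun_multinomialLimit (hp : ∀ j, 0 ≤ p j) (hs : ∑ j, p j = 1)
    (t : EuclideanSpace ℝ (Fin K)) :
    charFun (multinomialLimit p) t
      = (Real.exp (-(∑ j, t j ^ 2 * p j - (∑ j, t j * p j) ^ 2) / 2) : ℂ) := by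
  rw [multinomialLimit, charFun_multivariateGaussian (posSemidef_multinomialCov hp hs),
    dotProduct_multinomialCov]
  simp only [inner_zero_right]
  push_cast
  congr 1
  ring

end MultinomialLimit

/-! ### Asymptotic normality for the observed samples. -/

section Empirical

variable {d K : ℕ} {μ : Measure (Orthant d)} {r : Orthant d → ℝ≥0}
  {A : Fin K → Set (Orthant d)} {p : Fin K → ℝ} {k : ℕ → ℕ} {u : ℕ → ℝ≥0} {b : ℝ≥0}
  {Ω : Type*} [MeasurableSpace Ω] {P : Measure Ω}
  {X : ℕ → Ω → Orthant d}

/-- For `k > n` the truncated `n - k` selects the same order statistic as `k = n`; only the factor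
`1 / k` differs. This gives measurability and dependence on the first `n` points alone for all `n`
and `k`. -/
lemma estProb_eq_mul_cellFreq (r : Orthant d → ℝ≥0) (B : Set (Orthant d)) (n k : ℕ)
    (x : ℕ → Orthant d) :
    estProb r B n k x
      = (min k n : ℕ) / (k : ℝ) * cellFreq r B (min k n) fun i : Fin n => x i := by
  rw [← estProb_eq_cellFreq r B (min_le_right k n)]
  have e : n - k = n - min k n := by omega
  unfold estProb
  rw [← e]
  rcases Nat.eq_zero_or_pos (min k n) with h | h
  · rcases Nat.le_total k n with h' | h'
    · rw [min_eq_left h'] at h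
      simp [h]
    · rw [min_eq_right h'] at h
      simp [h]
  · have : ((min k n : ℕ) : ℝ) ≠ 0 := (Nat.cast_pos.2 h).ne'
    rw [← mul_assoc]
    congr 1
    field_simp

lemma measurable_estProb (hr : Measurable r) {B : Set (Orthant d)} (hB : MeasurableSet B)
    (n k : ℕ) : Measurable (estProb r B n k) := by
  simp only [funext fun x => estProb_eq_mul_cellFreq r B n k x]
  have hx : Measurable fun (x : ℕ → Orthant d) (i : Fin n) => x i :=
    measurable_pi_lambda _ fun i => measurable_pi_apply (i : ℕ)
  exact ((measurable_cellFreq hr hB (min k n)).comp hx).const_mul _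

lemma estProb_congr (r : Orthant d → ℝ≥0) (B : Set (Orthant d)) {n : ℕ} (k : ℕ)
    {x y : ℕ → Orthant d} (h : ∀ i < n, x i = y i) : estProb r B n k x = estProb r B n k y := by
  rw [estProb_eq_mul_cellFreq, estProb_eq_mul_cellFreq]
  congr 2
  exact funext fun i => h i i.2

/-- The normalized vector of cell frequencies. -/
noncomputable def freqVector (r : Orthant d → ℝ≥0) (A : Fin K → Set (Orthant d)) (p : Fin K → ℝ)
    (n k : ℕ) (x : ℕ → Orthant d) : EuclideanSpace ℝ (Fin K) :=
  WithLp.toLp 2 fun j => √(k : ℝ) * (estProb r (A j) n k x - p j)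

lemma measurable_freqVector (hr : Measurable r) (hA : ∀ j, MeasurableSet (A j)) (p : Fin K → ℝ)
    (n k : ℕ) : Measurable (freqVector r A p n k) :=
  (WithLp.measurable_toLp 2 _).comp (measurable_pi_lambda _ fun j =>
    ((measurable_estProb hr (hA j) n k).sub_const _).const_mul _)

lemma freqVector_congr (r : Orthant d → ℝ≥0) (A : Fin K → Set (Orthant d)) (p : Fin K → ℝ)
    {n : ℕ} (k : ℕ) {x y : ℕ → Orthant d} (h : ∀ i < n, x i = y i) :
    freqVector r A p n k x = freqVector r A p n k y := by
  simp only [freqVector, estProb_congr r _ k h]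

/-- Asymptotic normality of the vector of cell frequencies. -/
theorem IntermediateRegime.tendstoInDistribution (h : IntermediateRegime μ r A p k u b)
    [IsProbabilityMeasure μ] [IsProbabilityMeasure P] (hkn : ∀ᶠ n in atTop, k n ≤ n)
    (hX : ∀ i, HasLaw (X i) μ P) (hind : iIndepFun X P) :
    TendstoInDistribution (fun n ω => freqVector r A p n (k n) fun i => X i ω) atTop id
      (fun _ => P) (multinomialLimit p) := by
  have hmX : AEMeasurable (fun ω i => X i ω) P :=
    aemeasurable_pi_lambda _ fun i => (hX i).aemeasurable
  have hmV := fun n => measurable_freqVector h.risk.measurable h.partition.measurableSet p n (k n)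
  refine ⟨fun n => (hmV n).comp_aemeasurable hmX, aemeasurable_id, ?_⟩
  refine ProbabilityMeasure.tendsto_of_tendsto_charFun fun t => ?_
  simp only [ProbabilityMeasure.coe_mk, Measure.map_id]
  rw [charFun_multinomialLimit h.prob_nonneg h.sum_prob]
  refine (h.tendsto_charFun fun j => t j).congr' ?_
  filter_upwards [hkn] with n hn
  have hF : AEMeasurable (fun ω (i : Fin n) => X i ω) P :=
    aemeasurable_pi_lambda _ fun i => (hX i).aemeasurable
  have hlaw : P.map (fun ω (i : Fin n) => X i ω) = Measure.pi fun _ => μ := by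
    rw [iIndepFun.map_fun_eq_pi_map (f := fun i : Fin n => X i) (fun i => (hX i).aemeasurable)
      (hind.precomp Fin.val_injective)]
    simp only [fun i => (hX i).map_eq]
  have hc : ∀ j, Measurable fun x : Fin n → Orthant d => cellFreq r (A j) (k n) x := fun j =>
    measurable_cellFreq h.risk.measurable (h.partition.measurableSet j) _
  have hV : AEMeasurable (fun ω => freqVector r A p n (k n) fun i => X i ω) P :=
    (hmV n).comp_aemeasurable hmX
  rw [← hlaw, integral_map hF, charFun_apply, integral_map hV]
  · refine integral_congr_ae (ae_of_all _ fun ω => ?_)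
    simp only [freqVector, PiLp.inner_apply, RCLike.inner_apply, conj_trivial,
      estProb_eq_cellFreq r _ hn]
    rw [mul_comm Complex.I]
  · fun_prop
  · refine Measurable.aestronglyMeasurable ?_
    refine Complex.measurable_exp.comp (Measurable.const_mul ?_ _)
    refine Complex.measurable_ofReal.comp ?_
    exact Finset.measurable_fun_sum _ fun j _ => (((hc j).sub_const _).const_mul _).const_mul _

/-- Statistics of the first observations of two independent samples are independent. -/
lemma indepFun_freqVector {Y : ℕ → Ω → Orthant d}
    (hX : ∀ i, AEMeasurable (X i) P) (hY : ∀ i, AEMeasurable (Y i) P)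
    (hind : iIndepFun (Sum.elim X Y) P) (hr : Measurable r) (hA : ∀ j, MeasurableSet (A j))
    (p q : Fin K → ℝ) (n k : ℕ) :
    IndepFun (fun ω => freqVector r A p n k fun i => X i ω)
      (fun ω => freqVector r A q n k fun i => Y i ω) P := by
  classical
  set S : Finset (ℕ ⊕ ℕ) := (Finset.range n).map ⟨Sum.inl, Sum.inl_injective⟩ with hS
  set T : Finset (ℕ ⊕ ℕ) := (Finset.range n).map ⟨Sum.inr, Sum.inr_injective⟩ with hT
  have hST : Disjoint S T := by
    rw [Finset.disjoint_left]
    intro a ha hb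
    simp only [hS, hT, Finset.mem_map, Function.Embedding.coeFn_mk] at ha hb
    obtain ⟨i, _, rfl⟩ := ha
    obtain ⟨j, _, hj⟩ := hb
    cases hj
  have hm : ∀ i, AEMeasurable (Sum.elim X Y i) P := by
    rintro (i | i)
    · exact hX i
    · exact hY i
  -- Extends a finite block of observations to a sequence. The filling value `0` is immaterial,
  -- since `freqVector` reads only the first `n` entries.
  let E (f : ℕ → ℕ ⊕ ℕ) (R : Finset (ℕ ⊕ ℕ)) (z : R → Orthant d) (i : ℕ) : Orthant d :=
    if h : f i ∈ R then z ⟨f i, h⟩ else 0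
  have hE : ∀ f R, Measurable (E f R) := fun f R => measurable_pi_lambda _ fun i => by
    by_cases h : f i ∈ R
    · simp only [E, dif_pos h]
      exact measurable_pi_apply _
    · simp only [E, dif_neg h]
      exact measurable_const
  have h1 := (hind.indepFun_finset₀ S T hST hm).comp
    ((measurable_freqVector hr hA p n k).comp (hE Sum.inl S))
    ((measurable_freqVector hr hA q n k).comp (hE Sum.inr T))
  convert h1 using 1
  · funext ω
    refine freqVector_congr _ _ _ _ fun i hi => ?_
    have : Sum.inl i ∈ S := by simp [hS, hi]
    simp [E, this]
  · funext ω
    refine freqVector_congr _ _ _ _ fun i hi => ?_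
    have : Sum.inr i ∈ T := by simp [hT, hi]
    simp [E, this]

end Empirical

/-! ### Expansions of the divergence. -/

section Expansion

variable {ι : Type*} {l : Filter ι} {c s t f : ι → ℝ} {R : ℝ} {p q : ℝ}

/-- The filter is left arbitrary so that `atTop ×ˢ 𝓟 {x | ‖x‖ < R}` can be inserted later; the
limits of this section then become uniform on balls. -/
lemma tendsto_bounded_mul_zero (hs : ∀ᶠ i in l, |s i| ≤ R) (hf : Tendsto f l (𝓝 0)) :
    Tendsto (fun i => s i * f i) l (𝓝 0) := by
  refine squeeze_zero_norm' (a := fun i => R * ‖f i‖) ?_ (by simpa using hf.norm.const_mul R)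
  filter_upwards [hs] with i hi
  rw [norm_mul]
  exact mul_le_mul_of_nonneg_right hi (norm_nonneg _)

lemma tendsto_bounded_div_zero (hs : ∀ᶠ i in l, |s i| ≤ R) (hc : Tendsto c l atTop) :
    Tendsto (fun i => s i / c i) l (𝓝 0) :=
  tendsto_bounded_mul_zero hs hc.inv_tendsto_atTop

/-- Uniform first-order expansion of the logarithm. -/
lemma tendsto_mul_log_sub (hp : 0 < p) (hs : ∀ᶠ i in l, |s i| ≤ R) (hc : Tendsto c l atTop) :
    Tendsto (fun i => c i * (Real.log (p + s i / c i) - Real.log p) - s i / p) l (𝓝 0) := by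
  have h1 := (hasDerivAt_iff_isLittleO_nhds_zero.1 (Real.hasDerivAt_log hp.ne')).comp_tendsto
    (tendsto_bounded_div_zero hs hc)
  have h2 := (Asymptotics.isBigO_refl c l).mul_isLittleO h1
  have h3 : (fun i => c i * ((fun h => h) ∘ fun i => s i / c i) i) =O[l] fun _ => (1 : ℝ) := by
    refine Asymptotics.IsBigO.of_bound R ?_
    filter_upwards [hs, hc.eventually_gt_atTop 0] with i hi hci
    rw [Function.comp_apply, mul_div_cancel₀ _ hci.ne']
    simpa using hi
  refine ((Asymptotics.isLittleO_one_iff ℝ).1 (h2.trans_isBigO h3)).congr' ?_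
  filter_upwards [hc.eventually_gt_atTop 0] with i hci
  simp only [Function.comp_apply, smul_eq_mul]
  field_simp

lemma eventually_abs_sub_le (hs : ∀ᶠ i in l, |s i| ≤ R) (ht : ∀ᶠ i in l, |t i| ≤ R) :
    ∀ᶠ i in l, |s i - t i| ≤ 2 * R := by
  filter_upwards [hs, ht] with i h1 h2
  have := abs_sub (s i) (t i)
  linarith

/-- Uniform first-order expansion of one summand of the divergence. -/
lemma tendsto_mul_klTerm_sub (hp : 0 < p) (hq : 0 < q) (hs : ∀ᶠ i in l, |s i| ≤ R)
    (ht : ∀ᶠ i in l, |t i| ≤ R) (hc : Tendsto c l atTop) :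
    Tendsto (fun i => c i * ((p + s i / c i - (q + t i / c i))
        * (Real.log (p + s i / c i) - Real.log (q + t i / c i))
        - (p - q) * (Real.log p - Real.log q))
      - (klPartial p q * s i + klPartial q p * t i)) l (𝓝 0) := by
  have hla := tendsto_mul_log_sub hp hs hc
  have hlb := tendsto_mul_log_sub hq ht hc
  have hst := eventually_abs_sub_le hs ht
  -- The remainder has three parts: `p - q` times the logarithmic remainders, `(s - t) / c` times
  -- the same remainders, and the product of the two linear increments, which is of order `1 / c`.
  have h1 := (hla.sub hlb).const_mul (p - q)
  have h2 := (tendsto_bounded_div_zero hst hc).mul (hla.sub hlb)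
  have h3 : Tendsto (fun i => (s i - t i) * (s i / p - t i / q) / c i) l (𝓝 0) := by
    refine tendsto_bounded_div_zero (R := 2 * R * (R / p + R / q)) ?_ hc
    filter_upwards [hst, hs, ht] with i h1 h2 h3
    rw [abs_mul]
    refine mul_le_mul h1 ?_ (abs_nonneg _) ((abs_nonneg _).trans h1)
    refine (abs_sub _ _).trans ?_
    rw [abs_div, abs_div, abs_of_pos hp, abs_of_pos hq]
    gcongr
  have h4 := (h1.add h2).add h3
  simp only [sub_zero, mul_zero, add_zero] at h4
  refine h4.congr' ?_
  filter_upwards [hc.eventually_gt_atTop 0] with i hci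
  rw [klPartial, klPartial, Real.log_div hp.ne' hq.ne', Real.log_div hq.ne' hp.ne']
  field_simp
  ring

/-- Uniform second-order expansion of one summand of the divergence on the diagonal. -/
lemma tendsto_sq_mul_klTerm (hp : 0 < p) (hs : ∀ᶠ i in l, |s i| ≤ R)
    (ht : ∀ᶠ i in l, |t i| ≤ R) (hc : Tendsto c l atTop) :
    Tendsto (fun i => c i ^ 2 * ((p + s i / c i - (p + t i / c i))
        * (Real.log (p + s i / c i) - Real.log (p + t i / c i)))
      - (s i - t i) ^ 2 / p) l (𝓝 0) := by
  -- For equal base points the first factor is `(s - t) / c`, so a first-order expansion of the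
  -- logarithm already yields the second-order term.
  have h0 := (tendsto_mul_log_sub hp hs hc).sub (tendsto_mul_log_sub hp ht hc)
  rw [sub_zero] at h0
  have h := tendsto_bounded_mul_zero (eventually_abs_sub_le hs ht) h0
  refine h.congr' ?_
  filter_upwards [hc.eventually_gt_atTop 0] with i hci
  field_simp
  ring

end Expansion

/-! ### The statistic as a function of the normalized frequencies. -/

section Statistic

variable {d K : ℕ} {r : Orthant d → ℝ≥0} {A : Fin K → Set (Orthant d)} {p q : Fin K → ℝ}

lemma klStat_eq_klDivergence (r : Orthant d → ℝ≥0) (A : Fin K → Set (Orthant d)) (p q : Fin K → ℝ)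
    (n : ℕ) {k : ℕ} (hk : 0 < k) (x y : ℕ → Orthant d) :
    klStat r A n k x y = klDivergence (fun j => p j + freqVector r A p n k x j / √(k : ℝ))
      (fun j => q j + freqVector r A q n k y j / √(k : ℝ)) := by
  have hs : √(k : ℝ) ≠ 0 := (Real.sqrt_pos.2 (Nat.cast_pos.2 hk)).ne'
  simp only [klStat, freqVector, mul_div_cancel_left₀ _ hs, add_sub_cancel]

lemma aemeasurable_klDivergence {E : Type*} [MeasurableSpace E] {m : Measure E}
    {f g : E → Fin K → ℝ} (hf : ∀ j, AEMeasurable (fun x => f x j) m)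
    (hg : ∀ j, AEMeasurable (fun x => g x j) m) :
    AEMeasurable (fun x => klDivergence (f x) (g x)) m := by
  unfold klDivergence
  exact Finset.aemeasurable_fun_sum Finset.univ fun j _ => ((hf j).sub (hg j)).mul
    ((hf j).log.sub (hg j).log)

lemma aemeasurable_klStat {E : Type*} [MeasurableSpace E] {m : Measure E}
    {X Y : ℕ → E → Orthant d} (hX : ∀ i, AEMeasurable (X i) m) (hY : ∀ i, AEMeasurable (Y i) m)
    (hr : Measurable r) (hA : ∀ j, MeasurableSet (A j)) (n k : ℕ) :
    AEMeasurable (fun x => klStat r A n k (fun i => X i x) fun i => Y i x) m := by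
  have h : ∀ Z : ℕ → E → Orthant d, (∀ i, AEMeasurable (Z i) m) →
      ∀ j, AEMeasurable (fun x => estProb r (A j) n k fun i => Z i x) m := fun Z hZ j =>
    (measurable_estProb hr (hA j) n k).comp_aemeasurable (aemeasurable_pi_lambda _ hZ)
  exact aemeasurable_klDivergence (h X hX) (h Y hY)

variable {k : ℕ → ℕ}

lemma eventually_abs_coord_le (R : ℝ) (j : Fin K) :
    (∀ᶠ z : ℕ × EuclideanSpace ℝ (Fin K) × EuclideanSpace ℝ (Fin K) in
      atTop ×ˢ 𝓟 {x | ‖x‖ < R}, |z.2.1 j| ≤ R) ∧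
    ∀ᶠ z : ℕ × EuclideanSpace ℝ (Fin K) × EuclideanSpace ℝ (Fin K) in
      atTop ×ˢ 𝓟 {x | ‖x‖ < R}, |z.2.2 j| ≤ R := by
  constructor
  · refine eventually_prod_principal_iff.2 (Eventually.of_forall fun n x hx => ?_)
    exact ((PiLp.norm_apply_le x.1 j).trans (norm_fst_le x)).trans (le_of_lt hx)
  · refine eventually_prod_principal_iff.2 (Eventually.of_forall fun n x hx => ?_)
    exact ((PiLp.norm_apply_le x.2 j).trans (norm_snd_le x)).trans (le_of_lt hx)

lemma tendsto_linearized_klDivergence (hk : Tendsto k atTop atTop) (hp : ∀ j, 0 < p j)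
    (hq : ∀ j, 0 < q j) (R : ℝ) :
    Tendsto (fun z : ℕ × EuclideanSpace ℝ (Fin K) × EuclideanSpace ℝ (Fin K) =>
      √(k z.1 : ℝ) * (klDivergence (fun j => p j + z.2.1 j / √(k z.1 : ℝ))
          (fun j => q j + z.2.2 j / √(k z.1 : ℝ)) - klDivergence p q)
        - ∑ j, (klPartial (p j) (q j) * z.2.1 j + klPartial (q j) (p j) * z.2.2 j))
      (atTop ×ˢ 𝓟 {x | ‖x‖ < R}) (𝓝 0) := by
  have h := tendsto_finsetSum Finset.univ fun j _ => tendsto_mul_klTerm_sub (hp j) (hq j)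
    (eventually_abs_coord_le R j).1 (eventually_abs_coord_le R j).2
    ((tendsto_sqrt_natCast_atTop hk).comp tendsto_fst)
  simp only [Finset.sum_const_zero] at h
  refine h.congr fun z => ?_
  rw [Finset.sum_sub_distrib, ← Finset.mul_sum, Finset.sum_sub_distrib]
  rfl

lemma tendsto_quadratic_klDivergence (hk : Tendsto k atTop atTop) (hp : ∀ j, 0 < p j) (R : ℝ) :
    Tendsto (fun z : ℕ × EuclideanSpace ℝ (Fin K) × EuclideanSpace ℝ (Fin K) =>
      (k z.1 : ℝ) / 2 * klDivergence (fun j => p j + z.2.1 j / √(k z.1 : ℝ))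
          (fun j => p j + z.2.2 j / √(k z.1 : ℝ))
        - ∑ j, (z.2.1 j - z.2.2 j) ^ 2 / (2 * p j))
      (atTop ×ˢ 𝓟 {x | ‖x‖ < R}) (𝓝 0) := by
  have h := (tendsto_finsetSum Finset.univ fun j _ => tendsto_sq_mul_klTerm (hp j)
    (eventually_abs_coord_le R j).1 (eventually_abs_coord_le R j).2
    ((tendsto_sqrt_natCast_atTop hk).comp tendsto_fst)).const_mul (1 / 2)
  simp only [Finset.sum_const_zero, mul_zero] at h
  refine h.congr fun z => ?_
  simp only [Function.comp_apply, Real.sq_sqrt (Nat.cast_nonneg _)]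
  rw [klDivergence, Finset.mul_sum, Finset.mul_sum, ← Finset.sum_sub_distrib]
  refine Finset.sum_congr rfl fun j _ => ?_
  rw [mul_comm 2 (p j), ← div_div]
  ring

end Statistic

/-! ### Identification of the normal and chi-squared limits. -/

section LimitLaws

variable {K : ℕ} {p q : Fin K → ℝ}

/-- The displayed variance is the sum of two multinomial variances, one per sample, of the linear
forms with coefficients `klPartial`; this gives nonnegativity and matches the characteristic
functions. -/
lemma asympVar_eq (p q : Fin K → ℝ) :
    asympVar p q = (∑ j, klPartial (p j) (q j) ^ 2 * p j - (∑ j, klPartial (p j) (q j) * p j) ^ 2)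
      + (∑ j, klPartial (q j) (p j) ^ 2 * q j - (∑ j, klPartial (q j) (p j) * q j) ^ 2) := by
  have key : ∀ f : Fin K → ℝ, (∑ j, f j) ^ 2
      = ∑ j, f j ^ 2 + 2 * ∑ i, ∑ j ∈ Finset.Ioi i, f i * f j := by
    intro f
    have h1 : ∀ i, ∑ j, f i * f j
        = f i ^ 2 + ∑ j ∈ Finset.Ioi i, f i * f j + ∑ j ∈ Finset.Iio i, f i * f j := by
      intro i
      have : (Finset.univ : Finset (Fin K)) = insert i (Finset.Ioi i ∪ Finset.Iio i) := by
        ext j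
        simp only [Finset.mem_univ, Finset.mem_insert, Finset.mem_union, Finset.mem_Ioi,
          Finset.mem_Iio, true_iff]
        rcases lt_trichotomy i j with h | h | h
        · exact Or.inr (Or.inl h)
        · exact Or.inl h.symm
        · exact Or.inr (Or.inr h)
      have hd : Disjoint (Finset.Ioi i) (Finset.Iio i) := by
        rw [Finset.disjoint_left]
        intro j h1 h2
        exact absurd (Finset.mem_Ioi.1 h1) (not_lt.2 (Finset.mem_Iio.1 h2).le)
      rw [this, Finset.sum_insert (by simp), Finset.sum_union hd]
      ring
    have h2 : ∑ i, ∑ j ∈ Finset.Iio i, f i * f j = ∑ i, ∑ j ∈ Finset.Ioi i, f i * f j := by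
      rw [Finset.sum_comm' (t' := Finset.univ) (s' := fun j => Finset.Ioi j) (by simp)]
      exact Finset.sum_congr rfl fun i _ => Finset.sum_congr rfl fun j _ => mul_comm _ _
    rw [sq, Finset.sum_mul_sum, Finset.sum_congr rfl fun i _ => h1 i, Finset.sum_add_distrib,
      Finset.sum_add_distrib, h2]
    ring
  rw [key, key, asympVar]
  simp only [mul_sub, mul_one, Finset.sum_add_distrib, Finset.sum_sub_distrib]
  have e1 : ∀ f g : Fin K → ℝ, ∑ j, (f j * g j) ^ 2 = ∑ j, f j ^ 2 * (g j * g j) := fun f g =>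
    Finset.sum_congr rfl fun j _ => by ring
  have e2 : ∀ f g : Fin K → ℝ, ∑ i, ∑ j ∈ Finset.Ioi i, f i * g i * (f j * g j)
      = ∑ i, ∑ j ∈ Finset.Ioi i, f i * f j * (g i * g j) := fun f g =>
    Finset.sum_congr rfl fun i _ => Finset.sum_congr rfl fun j _ => by ring
  rw [e1 (fun j => klPartial (p j) (q j)) p, e1 (fun j => klPartial (q j) (p j)) q,
    e2 (fun j => klPartial (p j) (q j)) p, e2 (fun j => klPartial (q j) (p j)) q]
  ring

lemma asympVar_nonneg (hp : ∀ j, 0 ≤ p j) (hq : ∀ j, 0 ≤ q j) (hps : ∑ j, p j = 1)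
    (hqs : ∑ j, q j = 1) : 0 ≤ asympVar p q := by
  rw [asympVar_eq]
  exact add_nonneg (sub_nonneg.2 (sq_sum_mul_le hp hps _)) (sub_nonneg.2 (sq_sum_mul_le hq hqs _))

lemma charFun_map_prod {E F G : Type*} [NormedAddCommGroup E] [InnerProductSpace ℝ E]
    [MeasurableSpace E] [NormedAddCommGroup F] [InnerProductSpace ℝ F] [MeasurableSpace F]
    [NormedAddCommGroup G] [InnerProductSpace ℝ G] [MeasurableSpace G] [BorelSpace G]
    [SecondCountableTopology G]
    (m : Measure E) (m' : Measure F) [SFinite m] [SFinite m'] {g : E × F → G} (hg : Measurable g)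
    {t : G} {a : E} {b : F} (h : ∀ z, inner ℝ (g z) t = inner ℝ z.1 a + inner ℝ z.2 b) :
    charFun ((m.prod m').map g) t = charFun m a * charFun m' b := by
  rw [charFun_apply, integral_map hg.aemeasurable, charFun_apply, charFun_apply,
    ← integral_prod_mul]
  · simp only [h, Complex.ofReal_add, add_mul, Complex.exp_add]
  · fun_prop

/-- Law of the linear limit. -/
lemma map_linear_multinomialLimit (hp : ∀ j, 0 ≤ p j) (hq : ∀ j, 0 ≤ q j) (hps : ∑ j, p j = 1)
    (hqs : ∑ j, q j = 1) :
    ((multinomialLimit p).prod (multinomialLimit q)).map (fun z =>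
      ∑ j, (klPartial (p j) (q j) * z.1 j + klPartial (q j) (p j) * z.2 j))
      = gaussianReal 0 (asympVar p q).toNNReal := by
  have hm : Measurable fun z : EuclideanSpace ℝ (Fin K) × EuclideanSpace ℝ (Fin K) =>
      ∑ j, (klPartial (p j) (q j) * z.1 j + klPartial (q j) (p j) * z.2 j) := by fun_prop
  have := Measure.isProbabilityMeasure_map
    (μ := (multinomialLimit p).prod (multinomialLimit q)) hm.aemeasurable
  refine Measure.ext_of_charFun (funext fun t => ?_)
  rw [charFun_map_prod _ _ hm (a := WithLp.toLp 2 fun j => t * klPartial (p j) (q j))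
    (b := WithLp.toLp 2 fun j => t * klPartial (q j) (p j)),
    charFun_multinomialLimit hp hps, charFun_multinomialLimit hq hqs, charFun_gaussianReal,
    Real.coe_toNNReal _ (asympVar_nonneg hp hq hps hqs), asympVar_eq,
    ← Complex.ofReal_mul, ← Real.exp_add, Complex.ofReal_exp]
  · simp only [mul_pow, mul_assoc, ← Finset.mul_sum]
    congr 1
    push_cast
    ring
  · intro z
    simp only [PiLp.inner_apply, RCLike.inner_apply, conj_trivial, ← Finset.sum_add_distrib,
      Finset.mul_sum]
    exact Finset.sum_congr rfl fun j _ => by ring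

lemma map_norm_sq_stdGaussian (F : Type*) [NormedAddCommGroup F] [InnerProductSpace ℝ F]
    [FiniteDimensional ℝ F] [MeasurableSpace F] [BorelSpace F] :
    (stdGaussian F).map (fun x => ‖x‖ ^ 2) = chiSquared (Module.finrank ℝ F) := by
  rw [stdGaussian, Measure.map_map (by fun_prop) (by fun_prop), chiSquared]
  congr 1
  funext x
  simp only [Function.comp_apply]
  rw [← real_inner_self_eq_norm_sq, (stdOrthonormalBasis ℝ F).orthonormal.inner_sum]
  simp [sq]

/-- Law of the quadratic limit. -/
lemma map_quadratic_multinomialLimit (hp : ∀ j, 0 < p j) (hps : ∑ j, p j = 1) :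
    ((multinomialLimit p).prod (multinomialLimit p)).map (fun z =>
      ∑ j, (z.1 j - z.2 j) ^ 2 / (2 * p j)) = chiSquared (K - 1) := by
  -- The difference of the two limits has covariance `2 (diag p - p pᵀ)`. Dividing coordinates by
  -- `√(2 p_j)` turns it into `1 - e eᵀ`, the orthogonal projection onto the complement `F` of the
  -- unit vector `e`.
  let e : EuclideanSpace ℝ (Fin K) := WithLp.toLp 2 fun j => √(p j)
  have he : ‖e‖ ^ 2 = 1 := by
    rw [EuclideanSpace.real_norm_sq_eq, ← hps]
    exact Finset.sum_congr rfl fun j _ => Real.sq_sqrt (hp j).le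
  have he1 : ‖e‖ = 1 := by
    nlinarith [norm_nonneg e]
  let F := (Submodule.span ℝ {e})ᗮ
  have hF : Module.finrank ℝ F = K - 1 := by
    have h1 := Submodule.finrank_add_finrank_orthogonal (Submodule.span ℝ {e})
    have hne : e ≠ 0 := fun h => by simp [h] at he1
    rw [finrank_span_singleton hne, finrank_euclideanSpace_fin] at h1
    change 1 + Module.finrank ℝ F = K at h1
    omega
  let L : EuclideanSpace ℝ (Fin K) × EuclideanSpace ℝ (Fin K) → EuclideanSpace ℝ (Fin K) :=
    fun z => WithLp.toLp 2 fun j => (z.1 j - z.2 j) / √(2 * p j)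
  have hL : Measurable L := (WithLp.measurable_toLp 2 _).comp (by fun_prop)
  have hs : Measurable (F.subtypeL : F → EuclideanSpace ℝ (Fin K)) := F.subtypeL.measurable
  have hlaw : ((multinomialLimit p).prod (multinomialLimit p)).map L
      = (stdGaussian F).map F.subtypeL := by
    have := Measure.isProbabilityMeasure_map
      (μ := (multinomialLimit p).prod (multinomialLimit p)) hL.aemeasurable
    have := Measure.isProbabilityMeasure_map (μ := stdGaussian F) hs.aemeasurable
    refine Measure.ext_of_charFun (funext fun t => ?_)
    rw [charFun_map_prod _ _ hL (a := WithLp.toLp 2 fun j => t j / √(2 * p j))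
      (b := WithLp.toLp 2 fun j => -(t j / √(2 * p j))), charFun_multinomialLimit
      (fun j => (hp j).le) hps, charFun_multinomialLimit (fun j => (hp j).le) hps,
      charFun_apply, integral_map hs.aemeasurable (by fun_prop)]
    · have h1 : ∀ x : F, inner ℝ (F.subtypeL x) t = inner ℝ x (F.orthogonalProjectionOnto t) :=
        fun x => (Submodule.inner_orthogonalProjectionOnto_eq_of_mem_left x t).symm
      simp only [h1]
      rw [← charFun_apply, charFun_stdGaussian, ← Complex.ofReal_mul, ← Real.exp_add,
        Complex.ofReal_exp]
      -- By Pythagoras the squared norm of the projection of `t` onto `F` is `‖t‖² - ⟨e, t⟩²`, which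
      -- is the exponent obtained from the two multinomial limits.
      have h2 := Submodule.norm_sq_eq_add_norm_sq_starProjection t (Submodule.span ℝ {e})
      rw [Submodule.starProjection_unit_singleton ℝ he1, norm_smul, he1, mul_one,
        Real.norm_eq_abs, sq_abs] at h2
      change ‖t‖ ^ 2 = _ + ‖F.orthogonalProjectionOnto t‖ ^ 2 at h2
      have h3 : inner ℝ e t = ∑ j, t j * √(p j) := by
        simp [e, PiLp.inner_apply]
      have h4 : ∀ j, t j / √(2 * p j) * p j = t j * √(p j) / √2 := fun j => by
        rw [Real.sqrt_mul zero_le_two]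
        have h5 := Real.sqrt_pos.2 (hp j)
        nth_rewrite 2 [← Real.mul_self_sqrt (hp j).le]
        field_simp
      have h5 : ∀ j, (t j / √(2 * p j)) ^ 2 * p j = t j ^ 2 / 2 := fun j => by
        have := hp j
        rw [div_pow, Real.sq_sqrt (by positivity)]
        field_simp
      rw [h3, EuclideanSpace.real_norm_sq_eq] at h2
      simp only [neg_sq, neg_mul, Finset.sum_neg_distrib, h4, h5, ← Finset.sum_div]
      simp only [div_pow, Real.sq_sqrt zero_le_two]
      have h6 : ‖F.orthogonalProjectionOnto t‖ ^ 2
          = ∑ j, t j ^ 2 - (∑ j, t j * √(p j)) ^ 2 := by linarith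
      rw [← Complex.ofReal_pow, h6]
      congr 1
      push_cast
      ring
    · intro z
      simp only [L, PiLp.inner_apply, RCLike.inner_apply, conj_trivial, ← Finset.sum_add_distrib]
      exact Finset.sum_congr rfl fun j _ => by ring
  have hg : (fun z : EuclideanSpace ℝ (Fin K) × EuclideanSpace ℝ (Fin K) =>
      ∑ j, (z.1 j - z.2 j) ^ 2 / (2 * p j)) = (fun x => ‖x‖ ^ 2) ∘ L := by
    funext z
    rw [Function.comp_apply, EuclideanSpace.real_norm_sq_eq]
    refine Finset.sum_congr rfl fun j _ => ?_
    simp only [L, div_pow]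
    rw [Real.sq_sqrt (by have := hp j; positivity)]
  rw [hg, ← Measure.map_map (by fun_prop) hL, hlaw, Measure.map_map (by fun_prop) hs, ← hF,
    ← map_norm_sq_stdGaussian]
  rfl

end LimitLaws

/-! ### Limit theorems for the divergence statistic. -/

section LimitTheorems

variable {d K : ℕ} {μX μY : Measure (Orthant d)} [IsProbabilityMeasure μX]
  [IsProbabilityMeasure μY] {r : Orthant d → ℝ≥0} {A : Fin K → Set (Orthant d)}
  {p q : Fin K → ℝ} {k : ℕ → ℕ} {uX uY : ℕ → ℝ≥0} {bX bY : ℝ≥0}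
  {Ω : Type*} [MeasurableSpace Ω] {P : Measure Ω} [IsProbabilityMeasure P]
  {X Y : ℕ → Ω → Orthant d}

lemma tendstoInDistribution_id_of_map_eq {E : Type*} [MeasurableSpace E] {m : Measure E}
    [IsProbabilityMeasure m] {m' : Measure ℝ} [IsProbabilityMeasure m'] {Z : ℕ → Ω → ℝ} {g : E → ℝ}
    (h : TendstoInDistribution Z atTop g (fun _ => P) m) (hg : m.map g = m') :
    TendstoInDistribution Z atTop id (fun _ => P) m' := by
  subst hg
  refine ⟨h.forall_aemeasurable, aemeasurable_id, ?_⟩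
  simpa only [Measure.map_id] using h.tendsto

theorem tendstoInDistribution_freqVector_prod (hX : ∀ i, HasLaw (X i) μX P)
    (hY : ∀ i, HasLaw (Y i) μY P) (hind : iIndepFun (Sum.elim X Y) P)
    (hkn : ∀ᶠ n in atTop, k n ≤ n) (h : IntermediateRegime μX r A p k uX bX)
    (h' : IntermediateRegime μY r A q k uY bY) :
    TendstoInDistribution (fun n ω => (freqVector r A p n (k n) fun i => X i ω,
        freqVector r A q n (k n) fun i => Y i ω)) atTop id (fun _ => P)
      ((multinomialLimit p).prod (multinomialLimit q)) :=
  tendstoInDistribution_prodMk_of_indepFun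
    (h.tendstoInDistribution hkn hX
      (iIndepFun.precomp (f := Sum.elim X Y) (g := Sum.inl) Sum.inl_injective hind))
    (h'.tendstoInDistribution hkn hY
      (iIndepFun.precomp (f := Sum.elim X Y) (g := Sum.inr) Sum.inr_injective hind))
    fun n => indepFun_freqVector (fun i => (hX i).aemeasurable) (fun i => (hY i).aemeasurable)
      hind h.risk.measurable h.partition.measurableSet p q n (k n)

/-- Asymptotic normality of the divergence statistic. -/
theorem tendstoInDistribution_klStat_sub (hX : ∀ i, HasLaw (X i) μX P)
    (hY : ∀ i, HasLaw (Y i) μY P) (hind : iIndepFun (Sum.elim X Y) P)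
    (hkn : ∀ᶠ n in atTop, k n ≤ n) (h : IntermediateRegime μX r A p k uX bX)
    (h' : IntermediateRegime μY r A q k uY bY) (hp : ∀ j, 0 < p j) (hq : ∀ j, 0 < q j) :
    TendstoInDistribution (fun n ω => √(k n : ℝ) *
        (klStat r A n (k n) (fun i => X i ω) (fun i => Y i ω) - klDivergence p q))
      atTop id (fun _ => P) (gaussianReal 0 (asympVar p q).toNNReal) := by
  let G (n : ℕ) (z : EuclideanSpace ℝ (Fin K) × EuclideanSpace ℝ (Fin K)) : ℝ := √(k n : ℝ) *
    (klDivergence (fun j => p j + z.1 j / √(k n : ℝ)) (fun j => q j + z.2 j / √(k n : ℝ))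
      - klDivergence p q)
  let T (n : ℕ) (ω : Ω) : EuclideanSpace ℝ (Fin K) × EuclideanSpace ℝ (Fin K) :=
    (freqVector r A p n (k n) fun i => X i ω, freqVector r A q n (k n) fun i => Y i ω)
  have e : ∀ n, (fun ω => √(k n : ℝ) *
      (klStat r A n (k n) (fun i => X i ω) (fun i => Y i ω) - klDivergence p q)) = fun ω => G n (T n ω) := by
    intro n
    funext ω
    -- Division by `√(k n)` is not invertible when `k n = 0`, but then the prefactor makes both
    -- sides zero.
    rcases Nat.eq_zero_or_pos (k n) with h0 | h0
    · simp [G, h0]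
    · simp only [G, T, klStat_eq_klDivergence r A p q n h0]
  have hm : ∀ n, AEMeasurable (fun ω => G n (T n ω)) P := fun n => by
    rw [← e n]
    exact ((aemeasurable_klStat (fun i => (hX i).aemeasurable)
      (fun i => (hY i).aemeasurable) h.risk.measurable h.partition.measurableSet n (k n)).sub_const
      _).const_mul _
  have hT : TendstoInDistribution T atTop id (fun _ => P)
      ((multinomialLimit p).prod (multinomialLimit q)) :=
    tendstoInDistribution_freqVector_prod hX hY hind hkn h h'
  rw [funext e]
  let g (z : EuclideanSpace ℝ (Fin K) × EuclideanSpace ℝ (Fin K)) : ℝ :=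
    ∑ j, (klPartial (p j) (q j) * z.1 j + klPartial (q j) (p j) * z.2 j)
  have hg : Continuous g := by fun_prop
  have hG : TendstoInDistribution (fun n ω => G n (T n ω)) atTop g (fun _ => P)
      ((multinomialLimit p).prod (multinomialLimit q)) :=
    tendstoInDistribution_comp_of_tendstoUniformlyOn hT hg hm
      (tendsto_linearized_klDivergence h.tendsto_k hp hq)
  exact tendstoInDistribution_id_of_map_eq hG
    (map_linear_multinomialLimit h.prob_nonneg h'.prob_nonneg h.sum_prob h'.sum_prob)

/-- Limit law of the divergence statistic under equality of the cell probabilities. -/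
theorem tendstoInDistribution_klStat (hX : ∀ i, HasLaw (X i) μX P)
    (hY : ∀ i, HasLaw (Y i) μY P) (hind : iIndepFun (Sum.elim X Y) P)
    (hkn : ∀ᶠ n in atTop, k n ≤ n) (h : IntermediateRegime μX r A p k uX bX)
    (h' : IntermediateRegime μY r A p k uY bY) (hp : ∀ j, 0 < p j) :
    TendstoInDistribution (fun n ω => (k n : ℝ) / 2 *
        klStat r A n (k n) (fun i => X i ω) (fun i => Y i ω))
      atTop id (fun _ => P) (chiSquared (K - 1)) := by
  let G (n : ℕ) (z : EuclideanSpace ℝ (Fin K) × EuclideanSpace ℝ (Fin K)) : ℝ := (k n : ℝ) / 2 *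
    klDivergence (fun j => p j + z.1 j / √(k n : ℝ)) (fun j => p j + z.2 j / √(k n : ℝ))
  let T (n : ℕ) (ω : Ω) : EuclideanSpace ℝ (Fin K) × EuclideanSpace ℝ (Fin K) :=
    (freqVector r A p n (k n) fun i => X i ω, freqVector r A p n (k n) fun i => Y i ω)
  have e : ∀ n, (fun ω => (k n : ℝ) / 2 *
      klStat r A n (k n) (fun i => X i ω) (fun i => Y i ω)) = fun ω => G n (T n ω) := by
    intro n
    funext ω
    rcases Nat.eq_zero_or_pos (k n) with h0 | h0
    · simp [G, h0]
    · simp only [G, T, klStat_eq_klDivergence r A p p n h0]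
  have hm : ∀ n, AEMeasurable (fun ω => G n (T n ω)) P := fun n => by
    rw [← e n]
    exact (aemeasurable_klStat (fun i => (hX i).aemeasurable)
      (fun i => (hY i).aemeasurable) h.risk.measurable h.partition.measurableSet n (k n)).const_mul _
  have hT : TendstoInDistribution T atTop id (fun _ => P)
      ((multinomialLimit p).prod (multinomialLimit p)) :=
    tendstoInDistribution_freqVector_prod hX hY hind hkn h h'
  rw [funext e]
  refine tendstoInDistribution_id_of_map_eq
    (tendstoInDistribution_comp_of_tendstoUniformlyOn hT ?_ hm
      (tendsto_quadratic_klDivergence h.tendsto_k hp))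
    (map_quadratic_multinomialLimit hp h.sum_prob)
  fun_prop

end LimitTheorems

end ExtremeKL

/-! ### The two-sample theorem. -/

theorem theorem1 {d K : ℕ}
    {Ω : Type*} [MeasurableSpace Ω] (P : Measure Ω) [IsProbabilityMeasure P]
    -- laws of the two standardized random vectors, and their exceedance distributions
    (μX μY νX νY : Measure (ExtremeKL.Orthant d))
    [IsProbabilityMeasure μX] [IsProbabilityMeasure μY]
    (hparX : ExtremeKL.HasParetoMargins μX) (hparY : ExtremeKL.HasParetoMargins μY)
    (hνX : ExtremeKL.IsExceedanceDistribution μX νX)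
    (hνY : ExtremeKL.IsExceedanceDistribution μY νY)
    (aX aY : ℝ≥0 → ℝ)
    (haX : ExtremeKL.SecondOrderCondition μX νX aX)
    (haY : ExtremeKL.SecondOrderCondition μY νY aY)
    -- independent i.i.d. samples from the two laws
    (X Y : ℕ → Ω → ExtremeKL.Orthant d)
    (hX : ∀ i, HasLaw (X i) μX P) (hY : ∀ i, HasLaw (Y i) μY P)
    (hindep : iIndepFun (Sum.elim X Y : ℕ ⊕ ℕ → Ω → ExtremeKL.Orthant d) P)
    -- risk functional and partition
    (r : ExtremeKL.Orthant d → ℝ≥0) (hr : ExtremeKL.IsRiskFunctional r)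
    (A : Fin K → Set (ExtremeKL.Orthant d)) (hA : ExtremeKL.IsAdmissiblePartition r A)
    (hbdX : ∀ j, ExtremeKL.exponentMeasure νX (frontier (A j)) = 0)
    (hbdY : ∀ j, ExtremeKL.exponentMeasure νY (frontier (A j)) = 0)
    (hposX : 0 < ExtremeKL.exponentMeasure νX (ExtremeKL.exceedanceSet r))
    (hposY : 0 < ExtremeKL.exponentMeasure νY (ExtremeKL.exceedanceSet r))
    -- limiting cell probabilities
    (p q : Fin K → ℝ)
    (hp : ∀ j, p j = ExtremeKL.limProb μX r (A j))
    (hq : ∀ j, q j = ExtremeKL.limProb μY r (A j))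
    (hp_mem : ∀ j, p j ∈ Set.Ioo (0 : ℝ) 1) (hq_mem : ∀ j, q j ∈ Set.Ioo (0 : ℝ) 1)
    -- intermediate sequence
    (k : ℕ → ℕ) (hk : Tendsto k atTop atTop)
    (hkn : Tendsto (fun n : ℕ => (k n : ℝ) / (n : ℝ)) atTop (𝓝 0))
    (hkX : Tendsto (fun n : ℕ =>
      √(k n : ℝ) * aX (ExtremeKL.tailQuantile μX ((n : ℝ) / (k n : ℝ)))) atTop (𝓝 0))
    (hkY : Tendsto (fun n : ℕ =>
      √(k n : ℝ) * aY (ExtremeKL.tailQuantile μY ((n : ℝ) / (k n : ℝ)))) atTop (𝓝 0)) :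
    -- the limits defining `p` and `q` exist
    (∀ j, Tendsto (ExtremeKL.condProb μX r (A j)) atTop (𝓝 (p j))) ∧
    (∀ j, Tendsto (ExtremeKL.condProb μY r (A j)) atTop (𝓝 (q j))) ∧
    -- null hypothesis
    ((∀ j, p j = q j) →
      TendstoInDistribution
        (fun (n : ℕ) (ω : Ω) => (k n : ℝ) / 2 *
          ExtremeKL.klStat r A n (k n) (fun i => X i ω) (fun i => Y i ω))
        atTop id (fun _ => P) (ExtremeKL.chiSquared (K - 1))) ∧
    -- alternative hypothesis
    ((∃ j, p j ≠ q j) →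
      TendstoInDistribution
        (fun (n : ℕ) (ω : Ω) => √(k n : ℝ) *
          (ExtremeKL.klStat r A n (k n) (fun i => X i ω) (fun i => Y i ω)
            - ExtremeKL.klDivergence p q))
        atTop id (fun _ => P) (gaussianReal 0 (ExtremeKL.asympVar p q).toNNReal)) := by
  obtain rfl : p = fun j => ExtremeKL.limProb μX r (A j) := funext hp
  obtain rfl : q = fun j => ExtremeKL.limProb μY r (A j) := funext hq
  have hcX := ExtremeKL.tendsto_condProb hparX hνX haX hr hA hbdX hposX
  have hcY := ExtremeKL.tendsto_condProb hparY hνY haY hr hA hbdY hposY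
  have hRX := haX.intermediateRegime hνX hparX hr hA hbdX hposX hk hkn hkX
  have hRY := haY.intermediateRegime hνY hparY hr hA hbdY hposY hk hkn hkY
  have hle := ExtremeKL.eventually_intermediate_le hkn
  refine ⟨fun j => ?_, fun j => ?_, fun heq => ?_, fun _ => ?_⟩
  · exact tendsto_nhds_limUnder ⟨_, hcX j⟩
  · exact tendsto_nhds_limUnder ⟨_, hcY j⟩
  -- Under the null hypothesis both samples are centred at the same `p`, as the quadratic expansion
  -- requires.
  · rw [← funext heq] at hRY
    exact ExtremeKL.tendstoInDistribution_klStat hX hY hindep hle hRX hRY fun j => (hp_mem j).1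
  · exact ExtremeKL.tendstoInDistribution_klStat_sub hX hY hindep hle hRX hRY
      (fun j => (hp_mem j).1) fun j => (hq_mem j).1
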